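/- Let $A,B,\Lambda\in\mathbb R$ and $t_0>0$. There is a constant $C=C(A,B,\Lambda,t_0)>0$ with the following property. Let $(M^5,\eta,\mathcal T,g,\Phi)$ be a Sasakian $5$-manifold, normalized so that $g=\eta\otimes\eta+d\eta(\cdot,\Phi\,\cdot)$ with $d\eta(X,Y)=\tfrac12\big(X\eta(Y)-Y\eta(X)-\eta([X,Y])\big)$, and let $\iota:M\to\mathbb R^{5+m}$ be a smooth isometric embedding with second fundamental form $\bar A$. Let $\Sigma$ be a compact smooth surface without boundary and let $F:\Sigma\times[0,t_0)\to M$ be a Legendrian mean curvature flow with Legendrian angle $\alpha$: $F$ and $\alpha$ are smooth, every $F_t$ is an immersion, $F_0$ is Legendrian ($F_0^*\eta=0$), and for all $t\in[0,t_0)$ $$H=-\nabla^k\alpha\,\Phi F_k,\qquad \frac{d}{dt}F=H-2\alpha\mathcal T,$$ where $H$ is the mean curvature vector of $F_t$ in $M$, $F_k=\partial F/\partial x^k$, and $\nabla^k\alpha=g^{kl}\partial_l\alpha$ is taken with respect to the induced metric. Let $\mu_t$ be the area measure of the induced metric $F_t^*g$, put $\bar F=\iota\circ F$ and $E=-\sum_i\bar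 A(e_i,e_i)$, with $(e_i)$ an orthonormal basis of the tangent plane of $F_t$, and suppose $\mu_0(\Sigma)\le\Lambda$. For $y_0\in\mathbb R^{5+m}$ let $$\rho(y,t)=\frac{1}{4\pi(t_0-t)}\exp\Big(-\frac{|y-y_0|^2}{4(t_0-t)}\Big)$$ be the backward heat kernel at $(y_0,t_0)$. Then for every $y_0\in\mathbb R^{5+m}$ and every $t\in[0,t_0)$ such that $|\alpha|\le A$ and $|E|\le B$ on $\Sigma\times[0,t]$, the function $t\mapsto\int_\Sigma\rho(\bar F_t,t)\,d\mu_t$ is differentiable at $t$ (from the right if $t=0$) and $$\frac{d}{dt}\int_\Sigma\rho\,d\mu_t\;\le\; C-\frac12\int_\Sigma\Big|H-2\alpha\mathcal T-E+\frac{(\bar F-y_0)^\perp}{2(t_0-t)}\Big|^2\rho\,d\mu_t,$$ where $\rho$ is evaluated at $(\bar F_t,t)$, $H$ and $\mathcal T$ are viewed in $\mathbb R^{5+m}$ through $d\iota$, and $(\cdot)^\perp$ is the component normal to $\bar F_t(\Sigma)$ in $\mathbb R^{5+m}$. -/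

import Mathlib

open scoped Manifold ContDiff InnerProductSpace
open MeasureTheory Set

universe u v

noncomputable section

/-- Euclidean `k`-space. -/
abbrev Euc (k : ℕ) : Type := EuclideanSpace ℝ (Fin k)

/-- The `j`-th standard basis vector. -/
def stdVec {k : ℕ} (j : Fin k) : Euc k := EuclideanSpace.single j (1 : ℝ)

/-- The partial derivative of `f` in the `j`-th coordinate direction. -/
def pderiv {k : ℕ} {V : Type*} [NormedAddCommGroup V] [NormedSpace ℝ V]
    (j : Fin k) (f : Euc k → V) (y : Euc k) : V :=
  fderiv ℝ f y (stdVec j)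

/-- A smooth Riemannian metric on a smooth `d`-manifold. -/
abbrev SmoothMetric (d : ℕ) (M : Type*) [TopologicalSpace M] [ChartedSpace (Euc d) M]
    [IsManifold (𝓡 d) ∞ M] : Type _ :=
  Bundle.ContMDiffRiemannianMetric (𝓡 d) ∞ (Euc d) (fun x : M => TangentSpace (𝓡 d) x)

section Sasakian

variable {d : ℕ} {M : Type*} [TopologicalSpace M] [ChartedSpace (Euc d) M]
  [IsManifold (𝓡 d) ∞ M]

/-- The vector field `X` is smooth near `x`. -/
def SmoothFieldAt (X : Π x : M, TangentSpace (𝓡 d) x) (x : M) : Prop :=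
  ContMDiffAt (𝓡 d) (𝓡 d).tangent ∞ (fun y => (⟨y, X y⟩ : TangentBundle (𝓡 d) M)) x

/-- The derivative of the function `f` at `x` in the direction `w`. -/
def dirDeriv (f : M → ℝ) (x : M) (w : TangentSpace (𝓡 d) x) : ℝ :=
  mfderiv (𝓡 d) 𝓘(ℝ, ℝ) f x w

/-- The exterior derivative of a one-form on two vector fields, with the normalization
`dη(X, Y) = (X η(Y) - Y η(X) - η([X, Y])) / 2` customary in contact metric geometry. -/
def contactD (η : Π x : M, TangentSpace (𝓡 d) x →L[ℝ] ℝ)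
    (X Y : Π x : M, TangentSpace (𝓡 d) x) (x : M) : ℝ :=
  (dirDeriv (fun y => η y (Y y)) x (X x) - dirDeriv (fun y => η y (X y)) x (Y x)
    - η x (VectorField.mlieBracket (𝓡 d) X Y x)) / 2

end Sasakian

/-- A Sasakian structure `(η, T, g, Φ)` on a smooth manifold. -/
structure SasakianStructure (d : ℕ) (M : Type*) [TopologicalSpace M] [ChartedSpace (Euc d) M]
    [IsManifold (𝓡 d) ∞ M] where
  /-- the Riemannian metric -/
  g : SmoothMetric d M
  /-- the contact form -/
  η : Π x : M, TangentSpace (𝓡 d) x →L[ℝ] ℝ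
  /-- the Reeb vector field -/
  T : Π x : M, TangentSpace (𝓡 d) x
  /-- the transverse complex structure, extended by zero on the Reeb direction -/
  Φ : Π x : M, TangentSpace (𝓡 d) x →L[ℝ] TangentSpace (𝓡 d) x
  smooth_T : ∀ x, SmoothFieldAt T x
  smooth_Φ : ∀ (X : Π x : M, TangentSpace (𝓡 d) x) (x : M), SmoothFieldAt X x →
    SmoothFieldAt (fun y => Φ y (X y)) x
  η_T : ∀ x, η x (T x) = 1
  reeb : ∀ (X : Π x : M, TangentSpace (𝓡 d) x) (x : M), SmoothFieldAt X x →
    contactD η T X x = 0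
  adapted : ∀ x (w : TangentSpace (𝓡 d) x), g.inner x (T x) w = η x w
  Φ_T : ∀ x, Φ x (T x) = 0
  Φ_sq : ∀ x (w : TangentSpace (𝓡 d) x), Φ x (Φ x w) = -(w - η x w • T x)
  contact_metric : ∀ (X Y : Π x : M, TangentSpace (𝓡 d) x) (x : M),
    SmoothFieldAt X x → SmoothFieldAt Y x →
    g.inner x (X x) (Y x) = η x (X x) * η x (Y x) + contactD η X (fun y => Φ y (Y y)) x
  /-- integrability (normality) of `Φ`: `[Φ, Φ] + 2 dη ⊗ T = 0` -/
  normal : ∀ (X Y : Π x : M, TangentSpace (𝓡 d) x) (x : M),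
    SmoothFieldAt X x → SmoothFieldAt Y x →
    Φ x (Φ x (VectorField.mlieBracket (𝓡 d) X Y x))
      + VectorField.mlieBracket (𝓡 d) (fun y => Φ y (X y)) (fun y => Φ y (Y y)) x
      - Φ x (VectorField.mlieBracket (𝓡 d) (fun y => Φ y (X y)) Y x)
      - Φ x (VectorField.mlieBracket (𝓡 d) X (fun y => Φ y (Y y)) x)
      + (2 * contactD η X Y x) • T x = 0

section LeviCivita

variable {d : ℕ} {M : Type*} [TopologicalSpace M] [ChartedSpace (Euc d) M]
  [IsManifold (𝓡 d) ∞ M]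

/-- The metric coefficients `g_ab` in the chart at `p`, as functions of the coordinates `z`. -/
def metricCoeff (g : SmoothMetric d M) (p : M) (z : Euc d) : Matrix (Fin d) (Fin d) ℝ :=
  Matrix.of fun a b =>
    g.inner ((extChartAt (𝓡 d) p).symm z)
      (mfderiv 𝓘(ℝ, Euc d) (𝓡 d) (extChartAt (𝓡 d) p).symm z (stdVec a))
      (mfderiv 𝓘(ℝ, Euc d) (𝓡 d) (extChartAt (𝓡 d) p).symm z (stdVec b))

/-- The Christoffel symbol `Γ^c_ab` of the Levi-Civita connection in the chart at `p`. -/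
def christoffel (g : SmoothMetric d M) (p : M) (z : Euc d) (c a b : Fin d) : ℝ :=
  (1 / 2) * ∑ e, (metricCoeff g p z)⁻¹ c e *
    (pderiv a (fun z' => metricCoeff g p z' b e) z
      + pderiv b (fun z' => metricCoeff g p z' a e) z
      - pderiv e (fun z' => metricCoeff g p z' a b) z)

end LeviCivita

section Immersion

variable {k d : ℕ} {S : Type*} [TopologicalSpace S] [ChartedSpace (Euc k) S]
  {M : Type*} [TopologicalSpace M] [ChartedSpace (Euc d) M] [IsManifold (𝓡 d) ∞ M]

/-- The coefficients `g_ij` of the metric induced by `F` in the chart of `S` at `x`, as functions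
of the coordinates `y`. -/
def inducedCoeff (g : SmoothMetric d M) (F : S → M) (x : S) (y : Euc k) : Matrix (Fin k) (Fin k) ℝ :=
  Matrix.of fun i j =>
    g.inner (F ((extChartAt (𝓡 k) x).symm y))
      (mfderiv 𝓘(ℝ, Euc k) (𝓡 d) (fun y' => F ((extChartAt (𝓡 k) x).symm y')) y (stdVec i))
      (mfderiv 𝓘(ℝ, Euc k) (𝓡 d) (fun y' => F ((extChartAt (𝓡 k) x).symm y')) y (stdVec j))

/-- The Riemannian measure `dμ` of the metric induced by `F`: the measure that in every chart is
`√(det g_ij)` times Lebesgue measure. The measures obtained in the various charts agree on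
overlaps, so their supremum is the measure they define together. -/
def inducedMeasure (k : ℕ) {S : Type*} [TopologicalSpace S] [ChartedSpace (Euc k) S]
    [MeasurableSpace S]
    (g : SmoothMetric d M) (F : S → M) : Measure S :=
  ⨆ x : S, Measure.map (extChartAt (𝓡 k) x).symm
    ((volume.restrict (extChartAt (𝓡 k) x).target).withDensity
      fun y => ENNReal.ofReal (Real.sqrt (inducedCoeff g F x y).det))

/-- The tangent vector `F_j = ∂F/∂x^j` at `x`, in the chart of `S` at `x`. -/
def tangentVec (F : S → M) (x : S) (j : Fin k) : TangentSpace (𝓡 d) (F x) :=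
  mfderiv (𝓡 k) (𝓡 d) F x (stdVec j : Euc k)

/-- The inverse induced metric `g^ij` at `x`, in the chart of `S` at `x`. -/
def inverseInduced (k : ℕ) {S : Type*} [TopologicalSpace S] [ChartedSpace (Euc k) S]
    (g : SmoothMetric d M) (F : S → M) (x : S) : Matrix (Fin k) (Fin k) ℝ :=
  (Matrix.of fun i j : Fin k => g.inner (F x) (tangentVec F x i) (tangentVec F x j))⁻¹

/-- The covariant derivative `∇_{∂_i} (∂_j F)` along `F` at `x` for the Levi-Civita connection of
`M`, whose `c`-th component in the chart at `F x` is `∂_i ∂_j F^c + Γ^c_ab ∂_i F^a ∂_j F^b`.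
(Tangent vectors of `M` at `p` are represented by their components in the chart at `p`.) -/
def covariantHessian (g : SmoothMetric d M) (F : S → M) (x : S) (i j : Fin k) :
    TangentSpace (𝓡 d) (F x) :=
  let f : Euc k → Euc d := writtenInExtChartAt (𝓡 k) (𝓡 d) x F
  let y : Euc k := extChartAt (𝓡 k) x x
  (WithLp.toLp 2 fun c => pderiv i (pderiv j f) y c +
    ∑ a, ∑ b, christoffel g (F x) (f y) c a b * pderiv i f y a * pderiv j f y b : Euc d)

/-- The mean curvature vector of `F : S → M` at `x`: the trace of the second fundamental form,
i.e. the component of `g^ij ∇_{∂_i} (∂_j F)` normal to `S` in `M`. -/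
def meanCurvature (k : ℕ) {S : Type*} [TopologicalSpace S] [ChartedSpace (Euc k) S]
    (g : SmoothMetric d M) (F : S → M) (x : S) : TangentSpace (𝓡 d) (F x) :=
  let h : TangentSpace (𝓡 d) (F x) :=
    ∑ i : Fin k, ∑ j : Fin k, inverseInduced k g F x i j • covariantHessian g F x i j
  h - ∑ i : Fin k, ∑ j : Fin k,
    (inverseInduced k g F x i j * g.inner (F x) h (tangentVec F x i)) • tangentVec F x j

/-- The vector `∇^k α v_k = g^kl ∂_l α Φ F_k` at `x`. -/
def angleField (k : ℕ) {S : Type*} [TopologicalSpace S] [ChartedSpace (Euc k) S]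
    (s : SasakianStructure d M) (F : S → M) (α : S → ℝ) (x : S) :
    TangentSpace (𝓡 d) (F x) :=
  ∑ i : Fin k, ∑ j : Fin k,
    (inverseInduced k s.g F x i j * dirDeriv α x (stdVec j : Euc k)) •
      s.Φ (F x) (tangentVec F x i)

end Immersion

/-- Legendrian mean curvature flow `F : S × [0, t₀) → M` of surfaces in a Sasakian `5`-manifold,
with Legendrian angle `α`: a smooth family of immersions, Legendrian at time `0`, whose mean
curvature vector is `H = -∇^k α v_k` and which solves `dF/dt = H - 2 α T`. -/
structure IsLegendrianMCF {M : Type*} [TopologicalSpace M] [ChartedSpace (Euc 5) M]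
    [IsManifold (𝓡 5) ∞ M] {S : Type*} [TopologicalSpace S] [ChartedSpace (Euc 2) S]
    (s : SasakianStructure 5 M) (t₀ : ℝ) (F : ℝ → S → M) (α : ℝ → S → ℝ) : Prop where
  smooth_F : ContMDiffOn (𝓘(ℝ, ℝ).prod (𝓡 2)) (𝓡 5) ∞ (fun p : ℝ × S => F p.1 p.2)
    (Ico 0 t₀ ×ˢ univ)
  smooth_α : ContMDiffOn (𝓘(ℝ, ℝ).prod (𝓡 2)) 𝓘(ℝ, ℝ) ∞ (fun p : ℝ × S => α p.1 p.2)
    (Ico 0 t₀ ×ˢ univ)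
  immersion : ∀ t ∈ Ico 0 t₀, ∀ x, Function.Injective (mfderiv (𝓡 2) (𝓡 5) (F t) x)
  legendrian : ∀ (x : S) (w : TangentSpace (𝓡 2) x),
    s.η (F 0 x) (mfderiv (𝓡 2) (𝓡 5) (F 0) x w) = 0
  angle : ∀ t ∈ Ico 0 t₀, ∀ x, meanCurvature 2 s.g (F t) x = -angleField 2 s (F t) (α t) x
  flow : ∀ t ∈ Ico 0 t₀, ∀ x,
    mfderivWithin 𝓘(ℝ, ℝ) (𝓡 5) (fun τ => F τ x) (Ico 0 t₀) t (1 : ℝ)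
      = meanCurvature 2 s.g (F t) x - (2 * α t x) • s.T (F t x)

section Embedding

variable {d N : ℕ} {M : Type*} [TopologicalSpace M] [ChartedSpace (Euc d) M]
  [IsManifold (𝓡 d) ∞ M]

/-- The differential of a map into Euclidean space, with values in that space. -/
def diffMap (k : ℕ) {S : Type*} [TopologicalSpace S] [ChartedSpace (Euc k) S]
    (f : S → Euc N) (x : S) : TangentSpace (𝓡 k) x →L[ℝ] Euc N :=
  mfderiv (𝓡 k) 𝓘(ℝ, Euc N) f x

/-- `ι` is a smooth isometric embedding of `(M, g)` into Euclidean space. -/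
structure IsIsometricEmbedding (g : SmoothMetric d M) (ι : M → Euc N) : Prop where
  smooth : ContMDiff (𝓡 d) 𝓘(ℝ, Euc N) ∞ ι
  embedding : Topology.IsEmbedding ι
  isometric : ∀ (p : M) (w w' : TangentSpace (𝓡 d) p),
    g.inner p w w' = ⟪diffMap d ι p w, diffMap d ι p w'⟫_ℝ

/-- The component of `w` orthogonal to the image of the differential of `f` at `x`. -/
def normalPart (k : ℕ) {S : Type*} [TopologicalSpace S] [ChartedSpace (Euc k) S]
    (f : S → Euc N) (x : S) (w : Euc N) : Euc N :=
  (LinearMap.range (diffMap k f x).toLinearMap)ᗮ.starProjection w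

/-- The second fundamental form of the image of `ι` at `p`: the normal part of the second
derivative of `ι` in the chart at `p`. -/
def secondFundamentalForm (d : ℕ) {M : Type*} [TopologicalSpace M] [ChartedSpace (Euc d) M]
    (ι : M → Euc N) (p : M) (w w' : TangentSpace (𝓡 d) p) : Euc N :=
  let f : Euc d → Euc N := fun z => ι ((extChartAt (𝓡 d) p).symm z)
  normalPart d ι p (fderiv ℝ (fun z => fderiv ℝ f z (w' : Euc d)) (extChartAt (𝓡 d) p p)
    (w : Euc d))

/-- The vector `E = -∑ Ā(e_i, e_i) = -g^ij Ā(F_i, F_j)` at `x`, where `Ā` is the second fundamental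
form of `M` in Euclidean space and `(e_i)` is an orthonormal basis of the tangent space of `S`. -/
def extrinsicE (k : ℕ) {S : Type*} [TopologicalSpace S] [ChartedSpace (Euc k) S]
    (g : SmoothMetric d M) (ι : M → Euc N) (F : S → M) (x : S) : Euc N :=
  -∑ i : Fin k, ∑ j : Fin k, inverseInduced k g F x i j •
    secondFundamentalForm d ι (F x) (tangentVec F x i) (tangentVec F x j)

/-- The backward heat kernel of dimension `n` at `(y₀, t₀)`. -/
def backwardHeatKernel (n : ℕ) (y₀ : Euc N) (t₀ : ℝ) (y : Euc N) (t : ℝ) : ℝ :=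
  1 / (4 * Real.pi * (t₀ - t)) ^ ((n : ℝ) / 2) * Real.exp (-‖y - y₀‖ ^ 2 / (4 * (t₀ - t)))

/-- The vector `H - 2 α T - E + (F̄ - y₀)^⊥ / (2 (t₀ - t))` at `x`, where `F̄ = ι ∘ F` and `⊥` is the
component normal to the surface. -/
def monotonicityVector (k : ℕ) {S : Type*} [TopologicalSpace S] [ChartedSpace (Euc k) S]
    (s : SasakianStructure d M) (ι : M → Euc N) (y₀ : Euc N) (t₀ t : ℝ) (F : S → M) (α : S → ℝ)
    (x : S) : Euc N :=
  diffMap d ι (F x) (meanCurvature k s.g F x) - (2 * α x) • diffMap d ι (F x) (s.T (F x))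
    - extrinsicE k s.g ι F x
    + (1 / (2 * (t₀ - t))) • normalPart k (fun x' => ι (F x')) x (ι (F x) - y₀)

end Embedding

end

noncomputable section

/-! ### Gram matrices, metric traces and tangential projections -/

section LinearAlgebra

variable {k : ℕ} {V : Type*} [NormedAddCommGroup V] [InnerProductSpace ℝ V]

/-! Write r = t₀ - t, X = F̄ - y₀, V = H - 2αT for the velocity in Euclidean space, and X^T, X^⊥ for
the parts of X tangent and normal to the surface. The argument is Huisken's monotonicity formula,
applied to a flow whose velocity is not quite the Euclidean mean curvature.

The velocity is normal to the surface. Since H is normal, only ⟪T, F_j⟫ = 0 is needed, that is, the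
flow stays Legendrian. Put θ_j = η(F_j). As H = -∇^kα ΦF_k and η ∘ Φ = 0, one has η(V) = -2α.
Differentiating this along the surface and using dη(V, F_j) = dη(H, F_j) = -g(H, ΦF_j) gives dθ_j/dt
= -2⟨dα, θ⟩ θ_j for each fixed point of the surface (`hasDerivWithinAt_contactPullback`). The
initial value is zero, so Gronwall's inequality gives θ = 0 (`contactPullback_eq_zero`).

By the Gauss formula the Euclidean mean curvature is H̄ = H - E (`meanCurvature_sub_extrinsicE_eq`).
For a normal velocity the area element changes by -⟪H̄, V⟫ dμ (`hasDerivWithinAt_area_of_normal`),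
so the derivative of ∫ρ is ∫ρ(1/r - |X|²/(4r²) - ⟪X, V⟫/(2r) - ⟪H̄, V⟫)
(`hasDerivWithinAt_integral_kernel`). The divergence theorem for the tangential part of ρX gives
∫ρ(2 - |X^T|²/(2r) + ⟪H̄, X^⊥⟫) = 0 (`integral_weightedDivergence`). Subtracting 1/(2r) times this
identity leaves -∫ρ⟪V + X^⊥/(2r), H̄ + X^⊥/(2r)⟫ (`hasDerivWithinAt_integral_kernel_square`).

If W is the vector in the conclusion, the two factors are W + E and W + 2αT. Since E is normal to M
and T is tangent to it, they are orthogonal, so the integrand is at most ρ(c - |W|²/2) with c = 2A²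
+ B²/2 (`neg_inner_add_add_le`). Hence I = ∫ρ satisfies I' ≤ cI - ½∫|W|²ρ on [0, t]. Discarding the
square and integrating gives I(t) ≤ I(0)e^{ct}, while ρ ≤ 1/(4πt₀) at time 0 gives I(0) ≤ max(Λ,
0)/(4πt₀). Inserting this bound for I(t) in the inequality at time t gives the constant.

Time derivatives are taken within `Ico 0 t₀`, so that the initial time needs no separate treatment.
-/

theorem sum_smul_stdVec (v : Euc k) : ∑ i, v i • stdVec i = v := by
  have := (EuclideanSpace.basisFun (Fin k) ℝ).sum_repr v
  simpa [stdVec] using this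

/-- The Gram matrix of the images of the standard basis vectors under `L`. -/
def gramOf (L : Euc k →L[ℝ] V) : Matrix (Fin k) (Fin k) ℝ :=
  Matrix.of fun i j => ⟪L (stdVec i), L (stdVec j)⟫_ℝ

/-- The trace of the bilinear form `B` with respect to the inner product pulled back by `L`. -/
def metricTrace (L : Euc k →L[ℝ] V) (B : Euc k → Euc k → ℝ) : ℝ :=
  ∑ i, ∑ j, (gramOf L)⁻¹ i j * B (stdVec i) (stdVec j)

/-- The orthogonal projection of `w` to the range of an injective `L`. -/
def tanProj (L : Euc k →L[ℝ] V) (w : V) : V :=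
  ∑ i, ∑ j, ((gramOf L)⁻¹ i j * ⟪w, L (stdVec i)⟫_ℝ) • L (stdVec j)

theorem gramOf_apply (L : Euc k →L[ℝ] V) (i j : Fin k) :
    gramOf L i j = ⟪L (stdVec i), L (stdVec j)⟫_ℝ := rfl

theorem gramOf_comm (L : Euc k →L[ℝ] V) (i j : Fin k) : gramOf L i j = gramOf L j i := by
  rw [gramOf_apply, gramOf_apply, real_inner_comm]

theorem gramOf_posDef {L : Euc k →L[ℝ] V} (hL : Function.Injective L) : (gramOf L).PosDef := by
  have h : LinearIndependent ℝ fun i => L (stdVec i) := by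
    have h1 : LinearIndependent ℝ (fun i : Fin k => (stdVec i : Euc k)) := by
      convert! (EuclideanSpace.basisFun (Fin k) ℝ).toBasis.linearIndependent using 1
      ext i : 1
      simp [stdVec]
    exact h1.map' L.toLinearMap (LinearMap.ker_eq_bot.2 hL)
  exact Matrix.posDef_gram_of_linearIndependent h

theorem gramOf_det_pos {L : Euc k →L[ℝ] V} (hL : Function.Injective L) : 0 < (gramOf L).det :=
  (gramOf_posDef hL).det_pos

theorem gramOf_inv_comm (L : Euc k →L[ℝ] V) (i j : Fin k) :
    (gramOf L)⁻¹ i j = (gramOf L)⁻¹ j i := by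
  have h : (gramOf L).transpose = gramOf L := by
    ext a b; exact gramOf_comm L b a
  have := congrFun (congrFun (Matrix.transpose_nonsing_inv (gramOf L)) j) i
  rw [h] at this
  simpa using this

theorem gramOf_inv_mul {L : Euc k →L[ℝ] V} (hL : Function.Injective L) :
    (gramOf L)⁻¹ * gramOf L = 1 :=
  Matrix.nonsing_inv_mul _ (isUnit_iff_ne_zero.2 (gramOf_det_pos hL).ne')

/-- On basis vectors this is g⁻¹g = 1; linearity does the rest. It makes `w - tanProj L w` normal to
the range of `L`. -/
theorem inner_tanProj {L : Euc k →L[ℝ] V} (hL : Function.Injective L) (w : V) (v : Euc k) :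
    ⟪tanProj L w, L v⟫_ℝ = ⟪w, L v⟫_ℝ := by
  have key : ∀ l, ⟪tanProj L w, L (stdVec l)⟫_ℝ = ⟪w, L (stdVec l)⟫_ℝ := by
    intro l
    have h : ∀ i, ∑ j, (gramOf L)⁻¹ i j * gramOf L j l = (1 : Matrix (Fin k) (Fin k) ℝ) i l := by
      intro i; rw [← gramOf_inv_mul hL, Matrix.mul_apply]
    simp only [tanProj, sum_inner, real_inner_smul_left, ← gramOf_apply]
    calc _ = ∑ i, ⟪w, L (stdVec i)⟫_ℝ * ∑ j, (gramOf L)⁻¹ i j * gramOf L j l := by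
          refine Finset.sum_congr rfl fun i _ => ?_
          rw [Finset.mul_sum]; refine Finset.sum_congr rfl fun j _ => ?_; ring
      _ = _ := by simp [h, Matrix.one_apply]
  rw [← sum_smul_stdVec v]
  simp [map_sum, inner_sum, real_inner_smul_right, key]

theorem tanProj_mem_range (L : Euc k →L[ℝ] V) (w : V) : tanProj L w ∈ LinearMap.range L.toLinearMap :=
  Submodule.sum_mem _ fun _ _ => Submodule.sum_mem _ fun _ _ =>
    Submodule.smul_mem _ _ (LinearMap.mem_range_self _ _)

/-- Replaces the abstract projection by an expression in the inverse Gram matrix, from which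
continuity and invariance can be read off. -/
theorem starProjection_range_orthogonal {L : Euc k →L[ℝ] V} (hL : Function.Injective L)
    [(LinearMap.range L.toLinearMap)ᗮ.HasOrthogonalProjection] (w : V) :
    (LinearMap.range L.toLinearMap)ᗮ.starProjection w = w - tanProj L w := by
  refine Submodule.eq_starProjection_of_mem_of_inner_eq_zero (u := w) ?_ ?_
  · rw [Submodule.mem_orthogonal]
    rintro _ ⟨v, rfl⟩
    change ⟪L v, w - tanProj L w⟫_ℝ = 0
    rw [inner_sub_right, real_inner_comm, real_inner_comm (tanProj L w), inner_tanProj hL, sub_self]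
  · intro z hz
    rw [sub_sub_cancel]
    exact (Submodule.mem_orthogonal _ _).1 hz _ (tanProj_mem_range L w)

theorem metricTrace_inner_mul (L : Euc k →L[ℝ] V) (w z : V) :
    metricTrace L (fun u v => ⟪w, L u⟫_ℝ * ⟪z, L v⟫_ℝ) = ⟪tanProj L w, z⟫_ℝ := by
  simp only [metricTrace, tanProj, sum_inner, real_inner_smul_left]
  refine Finset.sum_congr rfl fun i _ => Finset.sum_congr rfl fun j _ => ?_
  rw [real_inner_comm z]; ring

theorem bilinear_sum {B : Euc k → Euc k → ℝ} (hB : IsBilinearMap ℝ B) (u v : Euc k) :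
    B u v = ∑ i, ∑ j, u i * v j * B (stdVec i) (stdVec j) := by
  have h1 : ∀ w : Euc k, B u w = ∑ i, u i * B (stdVec i) w := by
    intro w
    have : B u w = B (∑ i, u i • stdVec i) w := by rw [sum_smul_stdVec]
    rw [this]
    change hB.toLinearMap (∑ i, u i • stdVec i) w = ∑ i, u i * hB.toLinearMap (stdVec i) w
    simp
  have h2 : ∀ w : Euc k, B w v = ∑ j, v j * B w (stdVec j) := by
    intro w
    have : B w v = B w (∑ j, v j • stdVec j) := by rw [sum_smul_stdVec]
    rw [this]
    change hB.toLinearMap w (∑ i, v i • stdVec i) = ∑ i, v i * hB.toLinearMap w (stdVec i)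
    simp
  rw [h1]
  refine Finset.sum_congr rfl fun i _ => ?_
  rw [h2, Finset.mul_sum]
  exact Finset.sum_congr rfl fun j _ => by ring

/-- The matrix of a linear map in the standard bases. -/
def stdMatrix (A : Euc k →L[ℝ] Euc k) : Matrix (Fin k) (Fin k) ℝ :=
  Matrix.of fun i j => A (stdVec j) i

theorem det_stdMatrix (A : Euc k →L[ℝ] Euc k) : (stdMatrix A).det = A.det := by
  have h : stdMatrix A = LinearMap.toMatrix (EuclideanSpace.basisFun (Fin k) ℝ).toBasis
      (EuclideanSpace.basisFun (Fin k) ℝ).toBasis A.toLinearMap := by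
    ext i j
    simp [stdMatrix, LinearMap.toMatrix_apply, stdVec]
  rw [h, LinearMap.det_toMatrix]

theorem bilinear_comp_matrix (A : Euc k →L[ℝ] Euc k) {C : Euc k → Euc k → ℝ}
    (hC : IsBilinearMap ℝ C) :
    (Matrix.of fun i j => C (A (stdVec i)) (A (stdVec j))) =
      (stdMatrix A).transpose * (Matrix.of fun i j => C (stdVec i) (stdVec j)) * stdMatrix A := by
  ext i j
  simp only [Matrix.of_apply, Matrix.mul_apply, Matrix.transpose_apply, stdMatrix]
  rw [bilinear_sum hC, Finset.sum_comm]
  refine Finset.sum_congr rfl fun l _ => ?_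
  rw [Finset.sum_mul]
  exact Finset.sum_congr rfl fun m _ => by ring

theorem gramOf_comp (L : Euc k →L[ℝ] V) (A : Euc k →L[ℝ] Euc k) :
    gramOf (L.comp A) = (stdMatrix A).transpose * gramOf L * stdMatrix A := by
  refine bilinear_comp_matrix A (C := fun u v => ⟪L u, L v⟫_ℝ) ⟨?_, ?_, ?_, ?_⟩ <;> intros <;>
    simp [inner_add_left, inner_add_right, real_inner_smul_left, real_inner_smul_right]

/-- The Jacobian factor that makes area densities in different charts define the same measure. -/
theorem sqrt_det_gramOf_comp (L : Euc k →L[ℝ] V) (A : Euc k →L[ℝ] Euc k) :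
    √(gramOf (L.comp A)).det = |A.det| * √(gramOf L).det := by
  rw [gramOf_comp, Matrix.det_mul, Matrix.det_mul, Matrix.det_transpose, det_stdMatrix,
    show A.det * (gramOf L).det * A.det = A.det ^ 2 * (gramOf L).det by ring,
    Real.sqrt_mul (sq_nonneg _), Real.sqrt_sq_eq_abs]

/-- The metric trace does not depend on the parametrization. -/
theorem metricTrace_comp {L : Euc k →L[ℝ] V} (hL : Function.Injective L)
    {A : Euc k →L[ℝ] Euc k} (hA : Function.Injective A) {B : Euc k → Euc k → ℝ}
    (hB : IsBilinearMap ℝ B) :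
    metricTrace (L.comp A) (fun u v => B (A u) (A v)) = metricTrace L B := by
  set a : Matrix (Fin k) (Fin k) ℝ := stdMatrix A with ha
  set b : Matrix (Fin k) (Fin k) ℝ := Matrix.of fun i j => B (stdVec i) (stdVec j) with hb
  have hg : gramOf (L.comp A) = a.transpose * gramOf L * a := gramOf_comp L A
  have hdet : 0 < (gramOf (L.comp A)).det := gramOf_det_pos (hL.comp hA)
  have hau : IsUnit a.det := by
    rw [isUnit_iff_ne_zero]; intro h0
    rw [hg, Matrix.det_mul, h0, mul_zero] at hdet
    exact hdet.false
  -- As the inverse Gram matrix is symmetric, the metric trace is tr(g⁻¹B). Under the substitution g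
  -- and B become aᵀga and aᵀBa, and a cancels by cyclicity of the trace.
  have htr : ∀ (K : Euc k →L[ℝ] V) (C : Euc k → Euc k → ℝ), metricTrace K C =
      Matrix.trace ((gramOf K)⁻¹ * Matrix.of fun i j => C (stdVec i) (stdVec j)) := by
    intro K C
    simp only [metricTrace, Matrix.trace, Matrix.diag, Matrix.mul_apply, Matrix.of_apply]
    rw [Finset.sum_comm]
    exact Finset.sum_congr rfl fun i _ => Finset.sum_congr rfl fun j _ => by
      rw [gramOf_inv_comm]
  rw [htr, htr, bilinear_comp_matrix A hB, hg, Matrix.mul_inv_rev, Matrix.mul_inv_rev]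
  have hat : IsUnit a.transpose.det := by rwa [Matrix.det_transpose]
  calc _ = Matrix.trace (a⁻¹ * ((gramOf L)⁻¹ * (a.transpose⁻¹ * (a.transpose * b) * a))) := by
        simp only [Matrix.mul_assoc]; rfl
    _ = Matrix.trace ((gramOf L)⁻¹ * (a.transpose⁻¹ * (a.transpose * b) * a) * a⁻¹) :=
        Matrix.trace_mul_comm _ _
    _ = _ := by
        rw [← Matrix.mul_assoc a.transpose⁻¹, Matrix.nonsing_inv_mul _ hat, Matrix.one_mul,
          ← Matrix.mul_assoc, Matrix.mul_assoc, Matrix.mul_nonsing_inv _ hau, Matrix.mul_one]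

end LinearAlgebra

/-! ### Smooth families on a half-open time interval -/

section TimeDependent

variable {E V : Type*} [NormedAddCommGroup E] [NormedSpace ℝ E]
  [NormedAddCommGroup V] [NormedSpace ℝ V] {t₀ : ℝ} {U : Set E} {f : ℝ → E → V}

theorem uniqueDiffOn_Ico_prod (hU : IsOpen U) : UniqueDiffOn ℝ (Ico 0 t₀ ×ˢ U) :=
  (uniqueDiffOn_Ico 0 t₀).prod hU.uniqueDiffOn

/-- Time and space partial derivatives are both read off one joint derivative within `Ico 0 t₀ ×ˢ
U`; their smoothness and the symmetry of mixed derivatives are inherited from it. -/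
theorem hasDerivWithinAt_time_aux
    (hf : ContDiffOn ℝ ∞ (fun p : ℝ × E => f p.1 p.2) (Ico 0 t₀ ×ˢ U)) {t : ℝ}
    (ht : t ∈ Ico 0 t₀) {y : E} (hy : y ∈ U) :
    HasDerivWithinAt (fun τ => f τ y)
      (fderivWithin ℝ (fun p : ℝ × E => f p.1 p.2) (Ico 0 t₀ ×ˢ U) (t, y) (1, 0)) (Ico 0 t₀) t := by
  have h := (hf.differentiableOn (by simp) (t, y) ⟨ht, hy⟩).hasFDerivWithinAt
  have hc : HasDerivWithinAt (fun τ : ℝ => (τ, y)) ((1 : ℝ), (0 : E)) (Ico 0 t₀) t :=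
    (hasDerivWithinAt_id t _).prodMk (hasDerivWithinAt_const t _ y)
  exact h.comp_hasDerivWithinAt t hc fun τ hτ => (⟨hτ, hy⟩ : (τ, y) ∈ Ico 0 t₀ ×ˢ U)

theorem hasFDerivAt_slice_aux (hU : IsOpen U)
    (hf : ContDiffOn ℝ ∞ (fun p : ℝ × E => f p.1 p.2) (Ico 0 t₀ ×ˢ U)) {t : ℝ}
    (ht : t ∈ Ico 0 t₀) {y : E} (hy : y ∈ U) :
    HasFDerivAt (f t)
      ((fderivWithin ℝ (fun p : ℝ × E => f p.1 p.2) (Ico 0 t₀ ×ˢ U) (t, y)).comp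
        (ContinuousLinearMap.inr ℝ ℝ E)) y := by
  have h := (hf.differentiableOn (by simp) (t, y) ⟨ht, hy⟩).hasFDerivWithinAt
  have hc : HasFDerivWithinAt (fun z : E => (t, z)) (ContinuousLinearMap.inr ℝ ℝ E) U y :=
    (hasFDerivAt_prodMk_right t y).hasFDerivWithinAt
  exact (h.comp y hc fun z hz => ⟨ht, hz⟩).hasFDerivAt (hU.mem_nhds hy)

theorem contDiffOn_slice (hf : ContDiffOn ℝ ∞ (fun p : ℝ × E => f p.1 p.2) (Ico 0 t₀ ×ˢ U)) {t : ℝ}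
    (ht : t ∈ Ico 0 t₀) : ContDiffOn ℝ ∞ (f t) U :=
  hf.comp (g := fun p : ℝ × E => f p.1 p.2) (f := fun z : E => (t, z))
    (by fun_prop) fun z hz => ⟨ht, hz⟩

theorem derivWithin_time_eq
    (hf : ContDiffOn ℝ ∞ (fun p : ℝ × E => f p.1 p.2) (Ico 0 t₀ ×ˢ U)) {p : ℝ × E}
    (hp : p ∈ Ico 0 t₀ ×ˢ U) :
    derivWithin (fun τ => f τ p.2) (Ico 0 t₀) p.1 =
      fderivWithin ℝ (fun p : ℝ × E => f p.1 p.2) (Ico 0 t₀ ×ˢ U) p (1, 0) :=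
  (hasDerivWithinAt_time_aux hf hp.1 hp.2).derivWithin (uniqueDiffOn_Ico 0 t₀ _ hp.1)

theorem hasDerivWithinAt_time
    (hf : ContDiffOn ℝ ∞ (fun p : ℝ × E => f p.1 p.2) (Ico 0 t₀ ×ˢ U)) {t : ℝ}
    (ht : t ∈ Ico 0 t₀) {y : E} (hy : y ∈ U) :
    HasDerivWithinAt (fun τ => f τ y) (derivWithin (fun τ => f τ y) (Ico 0 t₀) t) (Ico 0 t₀) t :=
  (hasDerivWithinAt_time_aux hf ht hy).differentiableWithinAt.hasDerivWithinAt

theorem contDiffOn_fderivWithin_prod (hU : IsOpen U)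
    (hf : ContDiffOn ℝ ∞ (fun p : ℝ × E => f p.1 p.2) (Ico 0 t₀ ×ˢ U)) :
    ContDiffOn ℝ ∞ (fderivWithin ℝ (fun p : ℝ × E => f p.1 p.2) (Ico 0 t₀ ×ˢ U))
      (Ico 0 t₀ ×ˢ U) :=
  hf.fderivWithin (uniqueDiffOn_Ico_prod hU) (by simp)

theorem contDiffOn_timeDeriv (hU : IsOpen U)
    (hf : ContDiffOn ℝ ∞ (fun p : ℝ × E => f p.1 p.2) (Ico 0 t₀ ×ˢ U)) :
    ContDiffOn ℝ ∞ (fun p : ℝ × E => derivWithin (fun τ => f τ p.2) (Ico 0 t₀) p.1)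
      (Ico 0 t₀ ×ˢ U) :=
  ((contDiffOn_fderivWithin_prod hU hf).clm_apply contDiffOn_const).congr
    fun _ hp => derivWithin_time_eq hf hp

theorem contDiffOn_fderiv_slice (hU : IsOpen U)
    (hf : ContDiffOn ℝ ∞ (fun p : ℝ × E => f p.1 p.2) (Ico 0 t₀ ×ˢ U)) :
    ContDiffOn ℝ ∞ (fun p : ℝ × E => fderiv ℝ (f p.1) p.2) (Ico 0 t₀ ×ˢ U) :=
  ((contDiffOn_fderivWithin_prod hU hf).clm_comp contDiffOn_const).congr
    fun _ hp => (hasFDerivAt_slice_aux hU hf hp.1 hp.2).fderiv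

/-- Time and space derivatives commute. -/
theorem hasDerivWithinAt_fderiv_slice (hU : IsOpen U) (ht₀ : 0 < t₀)
    (hf : ContDiffOn ℝ ∞ (fun p : ℝ × E => f p.1 p.2) (Ico 0 t₀ ×ˢ U)) {t : ℝ}
    (ht : t ∈ Ico 0 t₀) {y : E} (hy : y ∈ U) :
    HasDerivWithinAt (fun τ => fderiv ℝ (f τ) y)
      (fderiv ℝ (fun z => derivWithin (fun τ => f τ z) (Ico 0 t₀) t) y) (Ico 0 t₀) t := by
  set s := Ico 0 t₀ ×ˢ U with hs
  set g := fun p : ℝ × E => f p.1 p.2 with hg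
  have hsmooth := contDiffOn_fderivWithin_prod hU hf
  have hd := (hsmooth.differentiableOn (by simp) (t, y) ⟨ht, hy⟩).hasFDerivWithinAt
  have hc : HasDerivWithinAt (fun τ : ℝ => (τ, y)) ((1 : ℝ), (0 : E)) (Ico 0 t₀) t :=
    (hasDerivWithinAt_id t _).prodMk (hasDerivWithinAt_const t _ y)
  have h1 := hd.comp_hasDerivWithinAt t hc fun τ hτ => (⟨hτ, hy⟩ : (τ, y) ∈ s)
  have h2 := (h1.clm_comp (hasDerivWithinAt_const t _ (ContinuousLinearMap.inr ℝ ℝ E)))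
  have hc' : HasFDerivWithinAt (fun z : E => (t, z)) (ContinuousLinearMap.inr ℝ ℝ E) U y :=
    (hasFDerivAt_prodMk_right t y).hasFDerivWithinAt
  have h3 := ((hd.comp y hc' fun z hz => (⟨ht, hz⟩ : (t, z) ∈ s)).hasFDerivAt
    (hU.mem_nhds hy)).clm_apply (hasFDerivAt_const ((1 : ℝ), (0 : E)) y)
  -- At t = 0 the point is not interior, but it lies in the closure of the interior, which suffices
  -- for symmetry of the second derivative within the set.
  have hsymm : IsSymmSndFDerivWithinAt ℝ g s (t, y) := by
    refine ((hf (t, y) ⟨ht, hy⟩).of_le (m := 2) ENat.LEInfty.out).isSymmSndFDerivWithinAt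
      (by simp) (uniqueDiffOn_Ico_prod hU) ?_ ⟨ht, hy⟩
    rw [hs, interior_prod_eq, closure_prod_eq, interior_Ico, hU.interior_eq,
      closure_Ioo ht₀.ne]
    exact ⟨⟨ht.1, ht.2.le⟩, subset_closure hy⟩
  have e1 : fderiv ℝ (fun z => derivWithin (fun τ => f τ z) (Ico 0 t₀) t) y =
      (fderivWithin ℝ (fderivWithin ℝ g s) s (t, y) (1, 0)).comp
        (ContinuousLinearMap.inr ℝ ℝ E) := by
    have : (fun z => derivWithin (fun τ => f τ z) (Ico 0 t₀) t) =ᶠ[nhds y]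
        fun z => fderivWithin ℝ g s (t, z) (1, 0) := by
      filter_upwards [hU.mem_nhds hy] with z hz
      exact derivWithin_time_eq hf (p := (t, z)) ⟨ht, hz⟩
    rw [this.fderiv_eq]
    refine (h3.fderiv).trans ?_
    ext v
    have := hsymm (0, v) (1, 0)
    simpa using this
  rw [e1]
  refine (h2.congr_deriv ?_).congr_of_mem (fun τ hτ => ?_) ht
  · rw [ContinuousLinearMap.comp_zero, add_zero]
  · exact (hasFDerivAt_slice_aux hU hf hτ hy).fderiv

end TimeDependent

/-! ### Differentiation under the integral sign -/

section DifferentiateIntegral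

/-- Differentiation under the integral sign, up to the initial time. -/
theorem hasDerivWithinAt_integral_mul {k : ℕ} {t₀ : ℝ} {U : Set (Euc k)} (hU : IsOpen U)
    {u : ℝ → Euc k → ℝ} (hu : ContDiffOn ℝ ∞ (fun p : ℝ × Euc k => u p.1 p.2) (Ico 0 t₀ ×ˢ U))
    {χ : Euc k → ℝ} (hχ : Continuous χ) (hχc : HasCompactSupport χ) (hχU : tsupport χ ⊆ U)
    {t : ℝ} (ht : t ∈ Ico 0 t₀) :
    HasDerivWithinAt (fun τ => ∫ y in U, χ y * u τ y)
      (∫ y in U, χ y * derivWithin (fun τ => u τ y) (Ico 0 t₀) t) (Ico 0 t₀) t := by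
  -- Staying on [0, b] with t < b < t₀ keeps times in a compact set, on which the time derivative is
  -- bounded over the support of χ.
  obtain ⟨b, htb, hb⟩ := exists_between ht.2
  set K := tsupport χ with hK
  have hKc : IsCompact K := hχc
  have hcont : ContinuousOn (fun p : ℝ × Euc k => derivWithin (fun τ => u τ p.2) (Ico 0 t₀) p.1)
      (Icc 0 b ×ˢ K) :=
    (contDiffOn_timeDeriv hU hu).continuousOn.mono
      (prod_mono (fun τ hτ => ⟨hτ.1, hτ.2.trans_lt hb⟩) hχU)
  obtain ⟨C, hC⟩ := (isCompact_Icc.prod hKc).exists_bound_of_continuousOn hcont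
  have hC0 : 0 ≤ max C 0 := le_max_right _ _
  -- The family u is controlled only on U, but off the support of χ the product vanishes locally, so
  -- it is continuous on the whole plane or space.
  have hint : ∀ τ ∈ Ico 0 t₀, Continuous fun y => χ y * u τ y := by
    intro τ hτ
    refine continuous_iff_continuousAt.2 fun y => ?_
    by_cases hy : y ∈ K
    · exact hχ.continuousAt.mul
        ((contDiffOn_slice hu hτ).continuousOn.continuousAt (hU.mem_nhds (hχU hy)))
    · have : (fun y => χ y * u τ y) =ᶠ[nhds y] fun _ => 0 := by
        filter_upwards [(isClosed_tsupport χ).isOpen_compl.mem_nhds hy] with z hz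
        rw [image_eq_zero_of_notMem_tsupport hz, zero_mul]
      exact continuousAt_const.congr this.symm
  have hintg : ∀ τ ∈ Ico 0 t₀, Integrable (fun y => χ y * u τ y) (volume.restrict U) := fun τ hτ =>
    ((hint τ hτ).integrable_of_hasCompactSupport hχc.mul_right).restrict
  rw [hasDerivWithinAt_iff_tendsto_slope]
  have hev : ∀ᶠ τ in nhdsWithin t (Ico 0 t₀ \ {t}), τ ∈ Ico 0 b ∧ τ ≠ t := by
    have : Ico 0 t₀ \ {t} ∩ Iio b ∈ nhdsWithin t (Ico 0 t₀ \ {t}) :=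
      Filter.inter_mem self_mem_nhdsWithin (mem_nhdsWithin_of_mem_nhds (Iio_mem_nhds htb))
    filter_upwards [this] with τ hτ
    exact ⟨⟨hτ.1.1.1, hτ.2⟩, hτ.1.2⟩
  have hmain : Filter.Tendsto
      (fun τ => ∫ y in U, χ y * slope (fun τ => u τ y) t τ) (nhdsWithin t (Ico 0 t₀ \ {t}))
      (nhds (∫ y in U, χ y * derivWithin (fun τ => u τ y) (Ico 0 t₀) t)) := by
    refine tendsto_integral_filter_of_dominated_convergence (fun y => |χ y| * max C 0) ?_ ?_ ?_ ?_
    · filter_upwards [hev] with τ hτ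
      have h1 : (fun y => χ y * slope (fun τ => u τ y) t τ) =
          fun y => (τ - t)⁻¹ * (χ y * u τ y - χ y * u t y) := by
        ext y; rw [slope_def_field]; ring
      rw [h1]
      exact (continuous_const.mul ((hint τ ⟨hτ.1.1, hτ.1.2.trans hb⟩).sub
        (hint t ht))).aestronglyMeasurable
    · filter_upwards [hev] with τ hτ
      refine Filter.Eventually.of_forall fun y => ?_
      rw [norm_mul, Real.norm_eq_abs (χ y)]
      by_cases hy : y ∈ K
      · refine mul_le_mul_of_nonneg_left ?_ (abs_nonneg _)
        have hder : ∀ σ ∈ Icc 0 b, HasDerivWithinAt (fun τ => u τ y)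
            (derivWithin (fun τ => u τ y) (Ico 0 t₀) σ) (Icc 0 b) σ := fun σ hσ =>
          (hasDerivWithinAt_time hu ⟨hσ.1, hσ.2.trans_lt hb⟩ (hχU hy)).mono
            fun z hz => ⟨hz.1, hz.2.trans_lt hb⟩
        -- The mean value inequality on [0, b] bounds the difference quotients uniformly in τ, which
        -- gives the dominating function |χ|·max C 0.
        have hle := (convex_Icc 0 b).norm_image_sub_le_of_norm_hasDerivWithin_le hder
          (fun σ hσ => (hC (σ, y) ⟨hσ, hy⟩).trans (le_max_left C 0))
          (⟨ht.1, htb.le⟩ : t ∈ Icc 0 b) (⟨hτ.1.1, hτ.1.2.le⟩ : τ ∈ Icc 0 b)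
        rw [slope_def_field, norm_div, div_le_iff₀ (norm_pos_iff.2 (sub_ne_zero.2 hτ.2))]
        exact hle
      · rw [image_eq_zero_of_notMem_tsupport hy]; simp
    · exact ((hχ.abs.mul continuous_const).integrable_of_hasCompactSupport
        (hχc.norm.mul_right)).restrict
    · refine (ae_restrict_iff' hU.measurableSet).2 (Filter.Eventually.of_forall fun y hy => ?_)
      exact (hasDerivWithinAt_iff_tendsto_slope.1 (hasDerivWithinAt_time hu ht hy)).const_mul _
  refine hmain.congr' ?_
  filter_upwards [hev] with τ hτ
  rw [slope_def_field, ← integral_sub (hintg τ ⟨hτ.1.1, hτ.1.2.trans hb⟩) (hintg t ht),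
    ← integral_div]
  refine integral_congr_ae (Filter.Eventually.of_forall fun y => ?_)
  simp only [slope_def_field]; ring

end DifferentiateIntegral

/-! ### First variation of the area element -/

section AreaElement

variable {V : Type*} [NormedAddCommGroup V] [InnerProductSpace ℝ V]

theorem gramOf_det_two (L : Euc 2 →L[ℝ] V) :
    (gramOf L).det = ⟪L (stdVec 0), L (stdVec 0)⟫_ℝ * ⟪L (stdVec 1), L (stdVec 1)⟫_ℝ -
      ⟪L (stdVec 0), L (stdVec 1)⟫_ℝ ^ 2 := by
  rw [Matrix.det_fin_two, gramOf_comm L 1 0, ← gramOf_apply, ← gramOf_apply, ← gramOf_apply]; ring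

/-- In dimension two the adjugate gives the inverse Gram matrix explicitly, so the variation and
divergence identities become rational identities in the metric coefficients. -/
theorem metricTrace_two (L : Euc 2 →L[ℝ] V) (B : Euc 2 → Euc 2 → ℝ) :
    metricTrace L B = (⟪L (stdVec 1), L (stdVec 1)⟫_ℝ * B (stdVec 0) (stdVec 0)
      - ⟪L (stdVec 0), L (stdVec 1)⟫_ℝ * (B (stdVec 0) (stdVec 1) + B (stdVec 1) (stdVec 0))
      + ⟪L (stdVec 0), L (stdVec 0)⟫_ℝ * B (stdVec 1) (stdVec 1)) / (gramOf L).det := by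
  simp only [metricTrace, Fin.sum_univ_two, Matrix.inv_def, Ring.inverse_eq_inv',
    Matrix.adjugate_fin_two, Matrix.smul_apply, Matrix.of_apply, Matrix.cons_val', Matrix.cons_val_zero,
    Matrix.cons_val_one, Matrix.cons_val_fin_one, smul_eq_mul]
  rw [gramOf_comm L 1 0, gramOf_apply, gramOf_apply, gramOf_apply]
  ring

/-- The first variation of the area element. -/
theorem hasDerivWithinAt_sqrt_det_gramOf {L : ℝ → Euc 2 →L[ℝ] V} {L' : Euc 2 →L[ℝ] V} {s : Set ℝ}
    {t : ℝ} (h : HasDerivWithinAt L L' s t) (hL : Function.Injective (L t)) :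
    HasDerivWithinAt (fun τ => √(gramOf (L τ)).det)
      (√(gramOf (L t)).det * metricTrace (L t) (fun u v => ⟪L' u, L t v⟫_ℝ)) s t := by
  have hv : ∀ v, HasDerivWithinAt (fun τ => L τ v) (L' v) s t := fun v => by
    simpa using h.clm_apply (hasDerivWithinAt_const t s v)
  have hin : ∀ u v, HasDerivWithinAt (fun τ => ⟪L τ u, L τ v⟫_ℝ)
      (⟪L t u, L' v⟫_ℝ + ⟪L' u, L t v⟫_ℝ) s t := fun u v => (hv u).inner ℝ (hv v)
  have hpos := gramOf_det_pos hL
  have hdet := ((hin (stdVec 0) (stdVec 0)).mul (hin (stdVec 1) (stdVec 1))).sub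
    ((hin (stdVec 0) (stdVec 1)).pow 2)
  have hdet' : HasDerivWithinAt (fun τ => (gramOf (L τ)).det) _ s t :=
    hdet.congr_of_eventuallyEq (Filter.Eventually.of_forall fun τ => gramOf_det_two _)
      (gramOf_det_two _)
  refine (hdet'.sqrt hpos.ne').congr_deriv ?_
  rw [metricTrace_two]
  have hs : √(gramOf (L t)).det ≠ 0 := (Real.sqrt_pos.2 hpos).ne'
  have hsq : √(gramOf (L t)).det ^ 2 = (gramOf (L t)).det := Real.sq_sqrt hpos.le
  generalize √(gramOf (L t)).det = D at hs hsq ⊢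
  rw [← hsq]
  field_simp
  simp only [real_inner_comm (L' _)]
  ring

end AreaElement

/-! ### Normal variations -/

section NormalVariation

variable {V : Type*} [NormedAddCommGroup V] [InnerProductSpace ℝ V]

theorem isBilinearMap_inner_clm {E : Type*} [NormedAddCommGroup E] [NormedSpace ℝ E]
    (S : E →L[ℝ] E →L[ℝ] V) (w : V) : IsBilinearMap ℝ fun u v => ⟪S u v, w⟫_ℝ := by
  constructor <;> intros <;> simp [inner_add_left, real_inner_smul_left]

/-- The first variation of the area element for a normal variation. -/
theorem hasDerivWithinAt_area_of_normal {t₀ : ℝ} (ht₀ : 0 < t₀) {U : Set (Euc 2)} (hU : IsOpen U)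
    {f : ℝ → Euc 2 → V}
    (hf : ContDiffOn ℝ ∞ (fun p : ℝ × Euc 2 => f p.1 p.2) (Ico 0 t₀ ×ˢ U)) {t : ℝ}
    (ht : t ∈ Ico 0 t₀) {y : Euc 2} (hy : y ∈ U) (hinj : Function.Injective (fderiv ℝ (f t) y))
    (hn : ∀ z ∈ U, ∀ v, ⟪derivWithin (fun τ => f τ z) (Ico 0 t₀) t, fderiv ℝ (f t) z v⟫_ℝ = 0) :
    HasDerivWithinAt (fun τ => √(gramOf (fderiv ℝ (f τ) y)).det)
      (-(√(gramOf (fderiv ℝ (f t) y)).det * metricTrace (fderiv ℝ (f t) y) fun u v =>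
        ⟪fderiv ℝ (fderiv ℝ (f t)) y u v, derivWithin (fun τ => f τ y) (Ico 0 t₀) t⟫_ℝ))
      (Ico 0 t₀) t := by
  refine (hasDerivWithinAt_sqrt_det_gramOf (hasDerivWithinAt_fderiv_slice hU ht₀ hf ht hy)
    hinj).congr_deriv ?_
  rw [← mul_neg]
  congr 1
  have hV : ContDiffOn ℝ ∞ (fun z => derivWithin (fun τ => f τ z) (Ico 0 t₀) t) U :=
    contDiffOn_slice (f := fun t z => derivWithin (fun τ => f τ z) (Ico 0 t₀) t)
      (contDiffOn_timeDeriv hU hf) ht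
  have hVd := ((hV.differentiableOn (by simp)).differentiableAt (hU.mem_nhds hy)).hasFDerivAt
  have hfd := (((contDiffOn_slice hf ht).fderiv_of_isOpen hU (m := ∞) (by simp)).differentiableOn
    (by simp)).differentiableAt (hU.mem_nhds hy) |>.hasFDerivAt
  rw [metricTrace, metricTrace, ← Finset.sum_neg_distrib]
  refine Finset.sum_congr rfl fun i _ => ?_
  rw [← Finset.sum_neg_distrib]
  refine Finset.sum_congr rfl fun j _ => ?_
  rw [← mul_neg]
  congr 1
  -- Differentiating ⟪V, ∂_j f⟫ = 0 in direction i moves the derivative from the velocity to the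
  -- map: ⟪∂_i V, ∂_j f⟫ = -⟪V, ∂_i∂_j f⟫.
  have h1 := hVd.inner ℝ (hfd.clm_apply (hasFDerivAt_const (stdVec j : Euc 2) y))
  have h2 : (fun z => ⟪derivWithin (fun τ => f τ z) (Ico 0 t₀) t,
      fderiv ℝ (f t) z (stdVec j)⟫_ℝ) =ᶠ[nhds y] fun _ => 0 := by
    filter_upwards [hU.mem_nhds hy] with z hz using hn z hz _
  have h3 := h1.unique ((hasFDerivAt_const (0 : ℝ) y).congr_of_eventuallyEq h2)
  have h4 := congrArg (fun l => l (stdVec i)) h3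
  simp [fderivInnerCLM_apply] at h4
  rw [real_inner_comm]
  linarith [real_inner_comm (fderiv ℝ (fderiv ℝ (f t)) y (stdVec i) (stdVec j))
    (derivWithin (fun τ => f τ y) (Ico 0 t₀) t), real_inner_comm (fderiv ℝ (f t) y (stdVec j))
    ((fderiv ℝ (fun z => derivWithin (fun τ => f τ z) (Ico 0 t₀) t) y) (stdVec i))]

end NormalVariation

/-! ### The divergence theorem in a coordinate domain -/

section Divergence

variable {V : Type*} [NormedAddCommGroup V] [InnerProductSpace ℝ V]

/-- The component in direction `i` of the coordinate vector field whose divergence is the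
divergence of the tangential part of `ψ X` times the area element (`j` is the other index). -/
def areaFlux (f X : Euc 2 → V) (ψ : Euc 2 → ℝ) (i j : Fin 2) (y : Euc 2) : ℝ :=
  ψ y * ((⟪fderiv ℝ f y (stdVec j), fderiv ℝ f y (stdVec j)⟫_ℝ * ⟪X y, fderiv ℝ f y (stdVec i)⟫_ℝ
    - ⟪fderiv ℝ f y (stdVec i), fderiv ℝ f y (stdVec j)⟫_ℝ * ⟪X y, fderiv ℝ f y (stdVec j)⟫_ℝ)
    / √(⟪fderiv ℝ f y (stdVec i), fderiv ℝ f y (stdVec i)⟫_ℝ *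
        ⟪fderiv ℝ f y (stdVec j), fderiv ℝ f y (stdVec j)⟫_ℝ
        - ⟪fderiv ℝ f y (stdVec i), fderiv ℝ f y (stdVec j)⟫_ℝ ^ 2))

theorem contDiff_of_contDiffAt_tsupport {E W : Type*} [NormedAddCommGroup E] [NormedSpace ℝ E]
    [NormedAddCommGroup W] [NormedSpace ℝ W] {n : WithTop ℕ∞} {h : E → W}
    (hh : ∀ y ∈ tsupport h, ContDiffAt ℝ n h y) : ContDiff ℝ n h := by
  refine contDiff_iff_contDiffAt.2 fun y => ?_
  by_cases hy : y ∈ tsupport h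
  · exact hh y hy
  · exact contDiffAt_const.congr_of_eventuallyEq (notMem_tsupport_iff_eventuallyEq.1 hy)

theorem HasFDerivAt.hasDerivAt_along_stdVec {n : ℕ} {W : Type*} [NormedAddCommGroup W]
    [NormedSpace ℝ W] {h : Euc n → W} {h' : Euc n →L[ℝ] W} {y : Euc n} (hh : HasFDerivAt h h' y)
    (k : Fin n) : HasDerivAt (fun s : ℝ => h (y + s • (stdVec k : Euc n))) (h' (stdVec k)) 0 := by
  have hline : HasDerivAt (fun s : ℝ => y + s • (stdVec k : Euc n)) (stdVec k) 0 := by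
    simpa using ((hasDerivAt_id (0 : ℝ)).smul_const (stdVec k : Euc n)).const_add y
  exact HasFDerivAt.comp_hasDerivAt (0 : ℝ) (by simpa using hh) hline

/-- The quotient rule along a coordinate line, with a, b, c the metric coefficients, p, q the
pairings of X with the coordinate tangent vectors and ψ the weight. -/
theorem hasDerivAt_flux {a b c p q ψ : ℝ → ℝ} {a' b' c' p' q' ψ' s : ℝ}
    (ha : HasDerivAt a a' s) (hb : HasDerivAt b b' s) (hc : HasDerivAt c c' s)
    (hp : HasDerivAt p p' s) (hq : HasDerivAt q q' s) (hψ : HasDerivAt ψ ψ' s)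
    (hD : 0 < a s * c s - b s ^ 2) :
    HasDerivAt (fun r => ψ r * ((c r * p r - b r * q r) / √(a r * c r - b r ^ 2)))
      (ψ' * ((c s * p s - b s * q s) / √(a s * c s - b s ^ 2)) +
        ψ s * ((c' * p s + c s * p' - (b' * q s + b s * q')) / √(a s * c s - b s ^ 2)
        - (c s * p s - b s * q s) * (a' * c s + a s * c' - 2 * b s * b')
          / (2 * √(a s * c s - b s ^ 2) ^ 3))) s := by
  have hs : √(a s * c s - b s ^ 2) ≠ 0 := (Real.sqrt_pos.2 hD).ne'
  have h1 := ((ha.mul hc).sub (hb.pow 2)).sqrt hD.ne'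
  have h2 := hψ.mul (((hc.mul hp).sub (hb.mul hq)).div h1 hs)
  refine h2.congr_deriv ?_
  simp only [Pi.mul_apply, Pi.sub_apply, Pi.pow_apply, Pi.div_apply]
  generalize √(a s * c s - b s ^ 2) = D at hs
  field_simp
  ring

/-- The flux components are √g ψ g^{ij}⟪X, f_j⟫, whose coordinate divergence is √g times the
divergence of ψX^T. Since DX = Df, the vector X contributes its trace 2; replacing X by its
tangential part costs the trace of the second derivative against X^⊥. -/
theorem sum_fderiv_areaFlux {f X : Euc 2 → V} {ψ : Euc 2 → ℝ} {y : Euc 2}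
    (hf : ContDiffAt ℝ ∞ f y) (hX : HasFDerivAt X (fderiv ℝ f y) y) (hψ : DifferentiableAt ℝ ψ y)
    (hinj : Function.Injective (fderiv ℝ f y))
    (h0 : DifferentiableAt ℝ (areaFlux f X ψ 0 1) y)
    (h1 : DifferentiableAt ℝ (areaFlux f X ψ 1 0) y) :
    fderiv ℝ (areaFlux f X ψ 0 1) y (stdVec 0) + fderiv ℝ (areaFlux f X ψ 1 0) y (stdVec 1) =
    √(gramOf (fderiv ℝ f y)).det * (2 * ψ y
      + metricTrace (fderiv ℝ f y) (fun u v => fderiv ℝ ψ y u * ⟪X y, fderiv ℝ f y v⟫_ℝ)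
      + ψ y * metricTrace (fderiv ℝ f y)
          (fun u v => ⟪fderiv ℝ (fderiv ℝ f) y u v, X y - tanProj (fderiv ℝ f y) (X y)⟫_ℝ)) := by
  have hdet := gramOf_det_pos hinj
  have hdet2 := gramOf_det_two (fderiv ℝ f y)
  have hfd : HasFDerivAt (fderiv ℝ f) (fderiv ℝ (fderiv ℝ f) y) y :=
    ((hf.fderiv_right (m := ∞) (by simp)).differentiableAt (by simp)).hasFDerivAt
  have hsym : ∀ u v, fderiv ℝ (fderiv ℝ f) y u v = fderiv ℝ (fderiv ℝ f) y v u := fun u v =>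
    (hf.isSymmSndFDerivAt (n := ∞) (by simpa using ENat.LEInfty.out)) u v
  have hat : ∀ k : Fin 2, y + (0 : ℝ) • (stdVec k : Euc 2) = y := fun k => by simp
  have hfk : ∀ k i : Fin 2, HasDerivAt
      (fun s : ℝ => fderiv ℝ f (y + s • (stdVec k : Euc 2)) (stdVec i))
      (fderiv ℝ (fderiv ℝ f) y (stdVec k) (stdVec i)) 0 := fun k i => by
    simpa using (hfd.hasDerivAt_along_stdVec k).clm_apply (hasDerivAt_const (0 : ℝ) (stdVec i : Euc 2))
  have hg : ∀ k i j : Fin 2, HasDerivAt (fun s : ℝ =>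
      ⟪fderiv ℝ f (y + s • (stdVec k : Euc 2)) (stdVec i),
        fderiv ℝ f (y + s • (stdVec k : Euc 2)) (stdVec j)⟫_ℝ)
      (⟪fderiv ℝ (fderiv ℝ f) y (stdVec k) (stdVec j), fderiv ℝ f y (stdVec i)⟫_ℝ +
        ⟪fderiv ℝ (fderiv ℝ f) y (stdVec k) (stdVec i), fderiv ℝ f y (stdVec j)⟫_ℝ) 0 :=
    fun k i j => by
      have := (hfk k i).inner ℝ (hfk k j)
      simp only [hat] at this
      rwa [real_inner_comm (fderiv ℝ (fderiv ℝ f) y (stdVec k) (stdVec j))] at this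
  have hp : ∀ k i : Fin 2, HasDerivAt (fun s : ℝ => ⟪X (y + s • (stdVec k : Euc 2)),
        fderiv ℝ f (y + s • (stdVec k : Euc 2)) (stdVec i)⟫_ℝ)
      (⟪fderiv ℝ (fderiv ℝ f) y (stdVec k) (stdVec i), X y⟫_ℝ +
        ⟪fderiv ℝ f y (stdVec k), fderiv ℝ f y (stdVec i)⟫_ℝ) 0 := fun k i => by
      have := (hX.hasDerivAt_along_stdVec k).inner ℝ (hfk k i)
      simp only [hat] at this
      rwa [real_inner_comm (fderiv ℝ (fderiv ℝ f) y (stdVec k) (stdVec i))] at this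
  have hpos0 : 0 < ⟪fderiv ℝ f y (stdVec 0), fderiv ℝ f y (stdVec 0)⟫_ℝ *
      ⟪fderiv ℝ f y (stdVec 1), fderiv ℝ f y (stdVec 1)⟫_ℝ
      - ⟪fderiv ℝ f y (stdVec 0), fderiv ℝ f y (stdVec 1)⟫_ℝ ^ 2 := hdet2 ▸ hdet
  have hcomm : ⟪fderiv ℝ f y (stdVec 1), fderiv ℝ f y (stdVec 0)⟫_ℝ =
      ⟪fderiv ℝ f y (stdVec 0), fderiv ℝ f y (stdVec 1)⟫_ℝ := real_inner_comm _ _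
  have e0 := (h0.hasFDerivAt.hasDerivAt_along_stdVec 0).unique (hasDerivAt_flux (hg 0 0 0) (hg 0 0 1) (hg 0 1 1)
    (hp 0 0) (hp 0 1) (hψ.hasFDerivAt.hasDerivAt_along_stdVec 0) (by simpa only [hat] using hpos0))
  have e1 := (h1.hasFDerivAt.hasDerivAt_along_stdVec 1).unique (hasDerivAt_flux (hg 1 1 1) (hg 1 1 0) (hg 1 0 0)
    (hp 1 1) (hp 1 0) (hψ.hasFDerivAt.hasDerivAt_along_stdVec 1) (by
      simp only [hat]; rw [hcomm]; linarith [hpos0]))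
  simp only [hat] at e0 e1
  rw [e0, e1, metricTrace_two, metricTrace_two]
  simp only [inner_sub_right]
  have htan : ∀ w : V, ⟪w, tanProj (fderiv ℝ f y) (X y)⟫_ℝ = metricTrace (fderiv ℝ f y)
      (fun u v => ⟪X y, fderiv ℝ f y u⟫_ℝ * ⟪w, fderiv ℝ f y v⟫_ℝ) := fun w => by
    rw [metricTrace_inner_mul, real_inner_comm]
  simp only [htan, metricTrace_two]
  rw [hsym (stdVec 1) (stdVec 0), hcomm, hdet2, mul_comm ⟪fderiv ℝ f y (stdVec 1), fderiv ℝ f y (stdVec 1)⟫_ℝ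
      ⟪fderiv ℝ f y (stdVec 0), fderiv ℝ f y (stdVec 0)⟫_ℝ]
  have hsq := Real.sq_sqrt hpos0.le
  have hs := (Real.sqrt_pos.2 hpos0).ne'
  generalize √_ = D at hsq hs ⊢
  clear e0 e1 hg hp hfk hcomm hdet2 hdet htan
  generalize ⟪fderiv ℝ f y (stdVec 0), fderiv ℝ f y (stdVec 0)⟫_ℝ = a at *
  generalize ⟪fderiv ℝ f y (stdVec 0), fderiv ℝ f y (stdVec 1)⟫_ℝ = b at *
  generalize ⟪fderiv ℝ f y (stdVec 1), fderiv ℝ f y (stdVec 1)⟫_ℝ = c at *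
  have ha : a ≠ 0 := by
    rintro rfl
    nlinarith [sq_nonneg b]
  -- Solving D² = ac - b² for c removes the only relation among a, b, c and D, and leaves a rational
  -- identity.
  obtain rfl : c = (D ^ 2 + b ^ 2) / a := by
    field_simp; linarith
  rw [← hsq]
  field_simp
  ring

/-- The divergence theorem for the tangential part of `ψ X`, where `ψ` is supported in a
coordinate domain and `X` is the position vector up to a constant. -/
theorem integral_sqrt_det_mul_divergence {f X : Euc 2 → V} {ψ : Euc 2 → ℝ} {U : Set (Euc 2)}
    (hU : IsOpen U) (hf : ContDiffOn ℝ ∞ f U) {y₀ : V} (hX : ∀ y, X y = f y - y₀)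
    (hψ : ContDiff ℝ ∞ ψ) (hψc : HasCompactSupport ψ) (hψU : tsupport ψ ⊆ U)
    (hinj : ∀ y ∈ U, Function.Injective (fderiv ℝ f y)) :
    ∫ y in U, √(gramOf (fderiv ℝ f y)).det * (2 * ψ y
      + metricTrace (fderiv ℝ f y) (fun u v => fderiv ℝ ψ y u * ⟪X y, fderiv ℝ f y v⟫_ℝ)
      + ψ y * metricTrace (fderiv ℝ f y)
          (fun u v => ⟪fderiv ℝ (fderiv ℝ f) y u v, X y - tanProj (fderiv ℝ f y) (X y)⟫_ℝ)) = 0 := by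
  have hfat : ∀ y ∈ U, ContDiffAt ℝ ∞ f y := fun y hy => hf.contDiffAt (hU.mem_nhds hy)
  have hXat : ∀ y ∈ U, ContDiffAt ℝ ∞ X y := fun y hy => by
    rw [show X = fun y => f y - y₀ from funext hX]
    exact (hfat y hy).sub contDiffAt_const
  have hsupp : ∀ i j, tsupport (areaFlux f X ψ i j) ⊆ tsupport ψ := fun i j =>
    closure_mono fun y hy => left_ne_zero_of_mul hy
  have hflux : ∀ i j, i ≠ j → ContDiff ℝ 1 (areaFlux f X ψ i j) := by
    intro i j hij
    refine contDiff_of_contDiffAt_tsupport fun y hy => ?_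
    have hyU := hψU (hsupp i j hy)
    have hd : ∀ l, ContDiffAt ℝ 1 (fun z => fderiv ℝ f z (stdVec l)) y := fun l =>
      ((hfat y hyU).fderiv_right (m := 1) (by norm_num; exact ENat.LEInfty.out)).clm_apply contDiffAt_const
    have hX1 : ContDiffAt ℝ 1 X y := (hXat y hyU).of_le ENat.LEInfty.out
    have hpos : ⟪fderiv ℝ f y (stdVec i), fderiv ℝ f y (stdVec i)⟫_ℝ *
        ⟪fderiv ℝ f y (stdVec j), fderiv ℝ f y (stdVec j)⟫_ℝ
        - ⟪fderiv ℝ f y (stdVec i), fderiv ℝ f y (stdVec j)⟫_ℝ ^ 2 ≠ 0 := by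
      have h0 := (gramOf_det_pos (hinj y hyU)).ne'
      rw [gramOf_det_two] at h0
      simp only [real_inner_self_eq_norm_sq] at h0 ⊢
      fin_cases i <;> fin_cases j <;> simp at hij ⊢
      · exact h0
      · rwa [real_inner_comm, mul_comm]
    have hsq := ((((hd i).inner ℝ (hd i)).mul ((hd j).inner ℝ (hd j))).sub
      (((hd i).inner ℝ (hd j)).pow 2)).sqrt hpos
    exact (hψ.contDiffAt.of_le ENat.LEInfty.out).mul
      (((((hd j).inner ℝ (hd j)).mul (hX1.inner ℝ (hd i))).sub
        (((hd i).inner ℝ (hd j)).mul (hX1.inner ℝ (hd j)))).div hsq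
        (by rw [Real.sqrt_ne_zero']; 
            refine lt_of_le_of_ne ?_ hpos.symm
            nlinarith [real_inner_mul_inner_self_le (fderiv ℝ f y (stdVec i))
              (fderiv ℝ f y (stdVec j))]))
  have hint0 : ∀ (h : Euc 2 → ℝ) (i : Fin 2), ContDiff ℝ 1 h → HasCompactSupport h →
      Integrable (fun y => fderiv ℝ h y (stdVec i)) ∧ ∫ y, fderiv ℝ h y (stdVec i) = 0 := by
    intro h i hh hc
    have hI : Integrable (fun y => fderiv ℝ h y (stdVec i)) :=
      ((hh.continuous_fderiv one_ne_zero).clm_apply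
        continuous_const).integrable_of_hasCompactSupport
        (hc.fderiv_apply (𝕜 := ℝ) (v := (stdVec i : Euc 2)))
    refine ⟨hI, ?_⟩
    -- Integration by parts against the constant 1: a partial derivative of a compactly supported C¹
    -- function has integral zero.
    have := integral_mul_fderiv_eq_neg_fderiv_mul_of_integrable (f := h) (g := fun _ => (1 : ℝ))
      (v := (stdVec i : Euc 2)) (μ := volume) (by simpa using hI) (by simp)
      (by simpa using hh.continuous.integrable_of_hasCompactSupport hc)
      (fun y _ => hh.differentiable one_ne_zero y) (fun y _ => differentiableAt_const _)
    simpa using this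
  have hc : ∀ i j, HasCompactSupport (areaFlux f X ψ i j) := fun i j => hψc.mono
    (fun y hy => left_ne_zero_of_mul hy)
  have h0 := hint0 _ 0 (hflux 0 1 (by decide)) (hc 0 1)
  have h1 := hint0 _ 1 (hflux 1 0 (by decide)) (hc 1 0)
  have hsum : ∫ y, (fderiv ℝ (areaFlux f X ψ 0 1) y (stdVec 0) +
      fderiv ℝ (areaFlux f X ψ 1 0) y (stdVec 1)) = 0 := by
    rw [integral_add h0.1 h1.1, h0.2, h1.2, add_zero]
  have hset : ∫ y in U, (fderiv ℝ (areaFlux f X ψ 0 1) y (stdVec 0) +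
      fderiv ℝ (areaFlux f X ψ 1 0) y (stdVec 1)) = 0 := by
    rw [setIntegral_eq_integral_of_forall_compl_eq_zero, hsum]
    intro y hy
    have : ∀ i j, fderiv ℝ (areaFlux f X ψ i j) y = 0 := fun i j => by
      have hn : y ∉ tsupport (areaFlux f X ψ i j) := fun h => hy (hψU (hsupp i j h))
      exact image_eq_zero_of_notMem_tsupport fun h => hn (tsupport_fderiv_subset ℝ h)
    simp [this]
  rw [← hset]
  refine setIntegral_congr_fun hU.measurableSet fun y hy => ?_
  refine (sum_fderiv_areaFlux (hfat y hy) ?_ (hψ.differentiable (by simp) y) (hinj y hy)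
    ((hflux 0 1 (by decide)).differentiable one_ne_zero y)
    ((hflux 1 0 (by decide)).differentiable one_ne_zero y)).symm
  rw [show X = fun y => f y - y₀ from funext hX]
  exact (((hfat y hy).differentiableAt (by simp)).hasFDerivAt).sub_const _

end Divergence

/-! ### Differentials read in charts -/

section Charts

variable {k N : ℕ} {S : Type*} [TopologicalSpace S] [ChartedSpace (Euc k) S]

/-- The map `G` read in the chart at `p`. -/
def inChart (p : S) {W : Type*} (G : S → W) (y : Euc k) : W := G ((extChartAt (𝓡 k) p).symm y)

/-- The differential of a map to Euclidean space, as a map between Euclidean spaces. -/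
def eucDiff (k : ℕ) {S : Type*} [TopologicalSpace S] [ChartedSpace (Euc k) S]
    (G : S → Euc N) (x : S) : Euc k →L[ℝ] Euc N := diffMap k G x

/-- The differential of the inverse of the chart at `p`. -/
def chartSymmDeriv (p : S) (y : Euc k) : Euc k →L[ℝ] Euc k :=
  mfderiv 𝓘(ℝ, Euc k) (𝓡 k) (extChartAt (𝓡 k) p).symm y

theorem mem_chart_source_of_mem_target {p : S} {y : Euc k} (hy : y ∈ (extChartAt (𝓡 k) p).target) :
    (extChartAt (𝓡 k) p).symm y ∈ (chartAt (Euc k) p).source := by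
  rw [← extChartAt_source (I := 𝓡 k)]
  exact (extChartAt (𝓡 k) p).map_target hy

variable [IsManifold (𝓡 k) ∞ S]

theorem contMDiffOn_inChart {d : ℕ} {M : Type*} [TopologicalSpace M] [ChartedSpace (Euc d) M]
    {F : S → M} (hF : ContMDiff (𝓡 k) (𝓡 d) ∞ F) (p : S) :
    ContMDiffOn 𝓘(ℝ, Euc k) (𝓡 d) ∞ (inChart p F) (extChartAt (𝓡 k) p).target :=
  hF.comp_contMDiffOn (contMDiffOn_extChartAt_symm p)

theorem contDiffOn_inChart {W : Type*} [NormedAddCommGroup W] [NormedSpace ℝ W] {G : S → W}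
    (hG : ContMDiff (𝓡 k) 𝓘(ℝ, W) ∞ G) (p : S) :
    ContDiffOn ℝ ∞ (inChart p G) (extChartAt (𝓡 k) p).target :=
  (hG.comp_contMDiffOn (contMDiffOn_extChartAt_symm p)).contDiffOn

theorem mdifferentiableAt_chart_symm {p : S} {y : Euc k} (hy : y ∈ (extChartAt (𝓡 k) p).target) :
    MDifferentiableAt 𝓘(ℝ, Euc k) (𝓡 k) (extChartAt (𝓡 k) p).symm y :=
  ((contMDiffOn_extChartAt_symm (n := ∞) p).contMDiffAt
    ((isOpen_extChartAt_target p).mem_nhds hy)).mdifferentiableAt (by simp)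

/-- The differential of the chart itself is a left inverse. -/
theorem chartSymmDeriv_injective {p : S} {y : Euc k} (hy : y ∈ (extChartAt (𝓡 k) p).target) :
    Function.Injective (chartSymmDeriv p y) := by
  have h := mfderiv_extChartAt_comp_mfderivWithin_extChartAt_symm (I := 𝓡 k) hy
  rw [ModelWithCorners.range_eq_univ, mfderivWithin_univ] at h
  exact Function.LeftInverse.injective (g := mfderiv (𝓡 k) 𝓘(ℝ, Euc k) (extChartAt (𝓡 k) p)
    ((extChartAt (𝓡 k) p).symm y)) fun v => congrArg (fun l => l v) h

/-- The tangent space at p is identified with coordinate space through the chart at p, so at the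
centre of that chart no Jacobian appears. This links definitions made in the chart at the point with
derivatives of `inChart p`. -/
theorem chartSymmDeriv_self (p : S) :
    chartSymmDeriv p (extChartAt (𝓡 k) p p) = ContinuousLinearMap.id ℝ (Euc k) := by
  have h := mfderivWithin_range_extChartAt_symm (I := 𝓡 k) (x := p)
  rw [ModelWithCorners.range_eq_univ, mfderivWithin_univ] at h
  exact h

theorem fderiv_inChart_eq {W : Type*} [NormedAddCommGroup W] [NormedSpace ℝ W] {G : S → W}
    {p : S} {y : Euc k} (hy : y ∈ (extChartAt (𝓡 k) p).target)
    (hG : MDifferentiableAt (𝓡 k) 𝓘(ℝ, W) G ((extChartAt (𝓡 k) p).symm y)) (v : Euc k) :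
    fderiv ℝ (inChart p G) y v =
      mfderiv (𝓡 k) 𝓘(ℝ, W) G ((extChartAt (𝓡 k) p).symm y) (chartSymmDeriv p y v) := by
  have h := mfderiv_comp y hG (mdifferentiableAt_chart_symm hy)
  rw [mfderiv_eq_fderiv] at h
  exact congrArg (fun l => l v) h

theorem fderiv_inChart {G : S → Euc N} {p : S} {y : Euc k}
    (hy : y ∈ (extChartAt (𝓡 k) p).target)
    (hG : MDifferentiableAt (𝓡 k) 𝓘(ℝ, Euc N) G ((extChartAt (𝓡 k) p).symm y)) :
    fderiv ℝ (inChart p G) y =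
      (eucDiff k G ((extChartAt (𝓡 k) p).symm y)).comp (chartSymmDeriv p y) := by
  ext1 v
  exact fderiv_inChart_eq hy hG v

theorem fderiv_inChart_self {G : S → Euc N} {p : S}
    (hG : MDifferentiableAt (𝓡 k) 𝓘(ℝ, Euc N) G p) :
    fderiv ℝ (inChart p G) (extChartAt (𝓡 k) p p) = eucDiff k G p := by
  rw [fderiv_inChart (mem_extChartAt_target p) (by rwa [extChartAt_to_inv]), chartSymmDeriv_self,
    extChartAt_to_inv, ContinuousLinearMap.comp_id]

theorem fderiv_inChart_injective {G : S → Euc N} {p : S} {y : Euc k}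
    (hy : y ∈ (extChartAt (𝓡 k) p).target)
    (hG : MDifferentiableAt (𝓡 k) 𝓘(ℝ, Euc N) G ((extChartAt (𝓡 k) p).symm y))
    (hinj : Function.Injective (eucDiff k G ((extChartAt (𝓡 k) p).symm y))) :
    Function.Injective (fderiv ℝ (inChart p G) y) := by
  rw [fderiv_inChart hy hG]
  exact hinj.comp (chartSymmDeriv_injective hy)

/-- The chain rule for second derivatives. -/
theorem fderiv_fderiv_comp {E₁ E₂ W : Type*} [NormedAddCommGroup E₁] [NormedSpace ℝ E₁]
    [NormedAddCommGroup E₂] [NormedSpace ℝ E₂] [NormedAddCommGroup W] [NormedSpace ℝ W]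
    {g : E₂ → W} {ψ : E₁ → E₂} {y : E₁} (hg : ContDiffAt ℝ ∞ g (ψ y)) (hψ : ContDiffAt ℝ ∞ ψ y)
    (u v : E₁) :
    fderiv ℝ (fderiv ℝ (fun z => g (ψ z))) y u v =
      fderiv ℝ (fderiv ℝ g) (ψ y) (fderiv ℝ ψ y u) (fderiv ℝ ψ y v) +
        fderiv ℝ g (ψ y) (fderiv ℝ (fderiv ℝ ψ) y u v) := by
  have hgd : ∀ᶠ z in nhds y, DifferentiableAt ℝ g (ψ z) :=
    hψ.continuousAt.eventually ((hg.of_le (m := 1) ENat.LEInfty.out).eventually (by simp) |>.mono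
      fun z hz => hz.differentiableAt one_ne_zero)
  have hψd : ∀ᶠ z in nhds y, DifferentiableAt ℝ ψ z :=
    (hψ.of_le (m := 1) ENat.LEInfty.out).eventually (by simp) |>.mono
      fun z hz => hz.differentiableAt one_ne_zero
  have h1 : fderiv ℝ (fun z => g (ψ z)) =ᶠ[nhds y]
      fun z => (fderiv ℝ g (ψ z)).comp (fderiv ℝ ψ z) := by
    filter_upwards [hgd, hψd] with z hz1 hz2
    exact fderiv_comp z hz1 hz2
  rw [h1.fderiv_eq]
  have h2 : HasFDerivAt (fderiv ℝ g) _ (ψ y) :=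
    ((hg.fderiv_right (m := ∞) (by simp)).differentiableAt (by simp)).hasFDerivAt
  have h3 : HasFDerivAt (fderiv ℝ ψ) _ y :=
    ((hψ.fderiv_right (m := ∞) (by simp)).differentiableAt (by simp)).hasFDerivAt
  have h4 := (h2.comp y (hψ.differentiableAt (by simp)).hasFDerivAt).clm_comp h3
  rw [HasFDerivAt.fderiv (f := fun z => (fderiv ℝ g (ψ z)).comp (fderiv ℝ ψ z)) h4]
  simp [add_comm]

/-- Pairing the second derivative with a normal vector gives a bilinear form whose metric trace
does not depend on the chart. -/
theorem metricTrace_second_deriv_inChart {G : S → Euc N} (hG : ContMDiff (𝓡 k) 𝓘(ℝ, Euc N) ∞ G)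
    {p : S} {y : Euc k} (hy : y ∈ (extChartAt (𝓡 k) p).target) {x : S}
    (hx : x = (extChartAt (𝓡 k) p).symm y)
    (hinj : Function.Injective (eucDiff k G x)) {Z : Euc N}
    (hZ : ∀ v, ⟪eucDiff k G x v, Z⟫_ℝ = 0) :
    metricTrace (fderiv ℝ (inChart p G) y)
        (fun u v => ⟪fderiv ℝ (fderiv ℝ (inChart p G)) y u v, Z⟫_ℝ) =
      metricTrace (eucDiff k G x)
        (fun u v => ⟪fderiv ℝ (fderiv ℝ (inChart x G)) (extChartAt (𝓡 k) x x) u v, Z⟫_ℝ) := by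
  have hGd : ∀ z, MDifferentiableAt (𝓡 k) 𝓘(ℝ, Euc N) G z := fun z => hG.mdifferentiable (by simp) z
  set ψ : Euc k → Euc k := inChart p (extChartAt (𝓡 k) x) with hψdef
  have hψy : ψ y = extChartAt (𝓡 k) x x := by rw [hψdef, inChart, ← hx]
  have hxs : (extChartAt (𝓡 k) p).symm y ∈ (chartAt (Euc k) x).source := by
    rw [← hx]; exact mem_chart_source _ x
  have hψ : ContDiffAt ℝ ∞ ψ y := by
    have h1 : ContMDiffAt (𝓡 k) 𝓘(ℝ, Euc k) ∞ (extChartAt (𝓡 k) x)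
        ((extChartAt (𝓡 k) p).symm y) := contMDiffAt_extChartAt' hxs
    exact (h1.comp y ((contMDiffOn_extChartAt_symm (n := ∞) p).contMDiffAt
      ((isOpen_extChartAt_target p).mem_nhds hy))).contDiffAt
  have hev : inChart p G =ᶠ[nhds y] fun z => inChart x G (ψ z) := by
    have hc : ContinuousAt (extChartAt (𝓡 k) p).symm y :=
      (mdifferentiableAt_chart_symm hy).continuousAt
    have : (extChartAt (𝓡 k) x).source ∈ nhds ((extChartAt (𝓡 k) p).symm y) := by
      rw [← hx]; exact extChartAt_source_mem_nhds x
    filter_upwards [hc this] with z hz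
    simp only [inChart, hψdef]
    rw [(extChartAt (𝓡 k) x).left_inv hz]
  have hg : ContDiffAt ℝ ∞ (inChart x G) (ψ y) := by
    rw [hψy]
    exact (contDiffOn_inChart hG x).contDiffAt (extChartAt_target_mem_nhds x)
  have hg1 : fderiv ℝ (inChart x G) (ψ y) = eucDiff k G x := by
    rw [hψy, fderiv_inChart_self (hGd x)]
  have hfd : fderiv ℝ (inChart p G) y = (eucDiff k G x).comp (fderiv ℝ ψ y) := by
    rw [hev.fderiv_eq, ← hg1]
    exact fderiv_comp y (hg.differentiableAt (by simp)) (hψ.differentiableAt (by simp))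
  have hψi : Function.Injective (fderiv ℝ ψ y) := by
    have := fderiv_inChart_injective hy (hGd _) (by rwa [← hx])
    rw [hfd] at this
    exact Function.Injective.of_comp this
  have h2 : ∀ u v, ⟪fderiv ℝ (fderiv ℝ (inChart p G)) y u v, Z⟫_ℝ =
      ⟪fderiv ℝ (fderiv ℝ (inChart x G)) (extChartAt (𝓡 k) x x) (fderiv ℝ ψ y u)
        (fderiv ℝ ψ y v), Z⟫_ℝ := by
    intro u v
    -- The chain rule for second derivatives has an extra term dG(D²ψ(u, v)). It is tangent to the
    -- surface, so the normal vector Z does not see it.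
    rw [hev.fderiv.fderiv_eq, fderiv_fderiv_comp hg hψ, inner_add_left, hg1, hZ, add_zero, hψy]
  rw [hfd]
  simp only [h2]
  exact metricTrace_comp hinj hψi (isBilinearMap_inner_clm _ Z)

end Charts

/-! ### The area measure of an immersion -/

section AreaMeasure

variable {k N : ℕ} {S : Type*} [TopologicalSpace S] [ChartedSpace (Euc k) S]

/-- The area density of `G` in the chart at `p`. -/
def areaDensity (G : S → Euc N) (p : S) (y : Euc k) : ℝ := √(gramOf (fderiv ℝ (inChart p G) y)).det

theorem contDiffOn_fderiv_inChart [IsManifold (𝓡 k) ∞ S] {G : S → Euc N} (hG : ContMDiff (𝓡 k) 𝓘(ℝ, Euc N) ∞ G) (p : S) :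
    ContDiffOn ℝ ∞ (fderiv ℝ (inChart p G)) (extChartAt (𝓡 k) p).target :=
  (contDiffOn_inChart hG p).fderiv_of_isOpen (isOpen_extChartAt_target p) (by simp)

theorem continuous_gramOf_det {V : Type*} [NormedAddCommGroup V] [InnerProductSpace ℝ V] :
    Continuous fun L : Euc k →L[ℝ] V => (gramOf L).det := by
  refine Continuous.matrix_det (continuous_matrix fun i j => ?_)
  simp only [gramOf_apply]
  fun_prop

theorem continuousOn_areaDensity [IsManifold (𝓡 k) ∞ S] {G : S → Euc N} (hG : ContMDiff (𝓡 k) 𝓘(ℝ, Euc N) ∞ G) (p : S) :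
    ContinuousOn (areaDensity G p) (extChartAt (𝓡 k) p).target :=
  (Real.continuous_sqrt.comp continuous_gramOf_det).comp_continuousOn
    (contDiffOn_fderiv_inChart hG p).continuousOn

variable [MeasurableSpace S]

/-- The area measure of `G` on the domain of the chart at `p`. -/
def chartMeasure (k : ℕ) {S : Type*} [TopologicalSpace S] [ChartedSpace (Euc k) S]
    [MeasurableSpace S] (G : S → Euc N) (p : S) : Measure S :=
  Measure.map (extChartAt (𝓡 k) p).symm
    ((volume.restrict (extChartAt (𝓡 k) p).target).withDensity
      fun y => ENNReal.ofReal (areaDensity G p y))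

/-- The area measure of `G`. -/
def areaMeasure (k : ℕ) {S : Type*} [TopologicalSpace S] [ChartedSpace (Euc k) S]
    [MeasurableSpace S] (G : S → Euc N) : Measure S := ⨆ p : S, chartMeasure k G p

variable [BorelSpace S]

theorem aemeasurable_chart_symm (p : S) (μ : Measure (Euc k))
    (hμ : μ ≪ volume.restrict (extChartAt (𝓡 k) p).target) :
    AEMeasurable (extChartAt (𝓡 k) p).symm μ :=
  ((continuousOn_extChartAt_symm p).aemeasurable
    (isOpen_extChartAt_target p).measurableSet).mono_ac hμ

theorem measurableSet_chart_symm_preimage (p : S) {A : Set S} (hA : MeasurableSet A) :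
    MeasurableSet ((extChartAt (𝓡 k) p).symm ⁻¹' A ∩ (extChartAt (𝓡 k) p).target) := by
  have h1 : Measurable ((extChartAt (𝓡 k) p).target.domRestrict (extChartAt (𝓡 k) p).symm) :=
    (continuousOn_iff_continuous_domRestrict.1 (continuousOn_extChartAt_symm p)).measurable
  have h2 := (isOpen_extChartAt_target (I := 𝓡 k) p).measurableSet.subtype_image (h1 hA)
  convert h2 using 1
  ext y
  exact ⟨fun h => ⟨⟨y, h.2⟩, h.1, rfl⟩, by rintro ⟨⟨z, hz⟩, hzA, rfl⟩; exact ⟨hzA, hz⟩⟩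

theorem chartMeasure_apply (G : S → Euc N) (p : S) {A : Set S} (hA : MeasurableSet A) :
    chartMeasure k G p A = ∫⁻ y in (extChartAt (𝓡 k) p).symm ⁻¹' A ∩ (extChartAt (𝓡 k) p).target,
      ENNReal.ofReal (areaDensity G p y) := by
  rw [chartMeasure, Measure.map_apply_of_aemeasurable
    (aemeasurable_chart_symm p _ (withDensity_absolutelyContinuous _ _)) hA, withDensity_apply',
    Measure.restrict_restrict' (isOpen_extChartAt_target p).measurableSet]

theorem chartMeasure_compl_source (G : S → Euc N) (p : S) :
    chartMeasure k G p (chartAt (Euc k) p).sourceᶜ = 0 := by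
  rw [chartMeasure_apply G p (chartAt (Euc k) p).open_source.measurableSet.compl]
  have : (extChartAt (𝓡 k) p).symm ⁻¹' (chartAt (Euc k) p).sourceᶜ ∩ (extChartAt (𝓡 k) p).target
      = ∅ := by
    ext y
    simp only [mem_inter_iff, mem_preimage, mem_compl_iff, mem_empty_iff_false, iff_false, not_and]
    exact fun h hy => h (mem_chart_source_of_mem_target hy)
  rw [this]; simp

variable [IsManifold (𝓡 k) ∞ S]

/-- The area measures of two charts agree on the overlap. -/
theorem chartMeasure_eq_of_subset {G : S → Euc N} (hG : ContMDiff (𝓡 k) 𝓘(ℝ, Euc N) ∞ G) (x p : S)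
    {A : Set S} (hA : MeasurableSet A) (hx : A ⊆ (chartAt (Euc k) x).source)
    (hp : A ⊆ (chartAt (Euc k) p).source) :
    chartMeasure k G x A = chartMeasure k G p A := by
  rw [chartMeasure_apply G x hA, chartMeasure_apply G p hA]
  set φ := extChartAt (𝓡 k) x with hφ
  set χ := extChartAt (𝓡 k) p with hχ
  have hxs : ∀ a ∈ A, a ∈ φ.source := fun a ha => by rw [hφ, extChartAt_source]; exact hx ha
  have hps : ∀ a ∈ A, a ∈ χ.source := fun a ha => by rw [hχ, extChartAt_source]; exact hp ha
  have himg : φ.symm ⁻¹' A ∩ φ.target = (fun y => φ (χ.symm y)) '' (χ.symm ⁻¹' A ∩ χ.target) := by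
    ext z
    constructor
    · rintro ⟨hz, hzt⟩
      refine ⟨χ (φ.symm z), ⟨?_, χ.map_source (hps _ hz)⟩, ?_⟩
      · rw [mem_preimage, χ.left_inv (hps _ hz)]; exact hz
      · simp only [χ.left_inv (hps _ hz), φ.right_inv hzt]
    · rintro ⟨y, ⟨hy, hyt⟩, rfl⟩
      refine ⟨?_, φ.map_source (hxs _ hy)⟩
      rw [mem_preimage, φ.left_inv (hxs _ hy)]; exact hy
  have hsm : ∀ y ∈ χ.symm ⁻¹' A ∩ χ.target, ContDiffAt ℝ ∞ (fun y => φ (χ.symm y)) y := by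
    intro y hy
    have h1 : ContMDiffAt (𝓡 k) 𝓘(ℝ, Euc k) ∞ φ (χ.symm y) := contMDiffAt_extChartAt' (hx hy.1)
    exact (h1.comp y ((contMDiffOn_extChartAt_symm (n := ∞) p).contMDiffAt
      ((isOpen_extChartAt_target p).mem_nhds hy.2))).contDiffAt
  -- Change of variables along the transition map; its Jacobian is absorbed by
  -- `sqrt_det_gramOf_comp`.
  rw [himg, lintegral_image_eq_lintegral_abs_det_fderiv_mul volume
    (measurableSet_chart_symm_preimage p hA)
    (fun y hy => ((hsm y hy).differentiableAt (by simp)).hasFDerivAt.hasFDerivWithinAt)]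
  · refine setLIntegral_congr_fun (measurableSet_chart_symm_preimage p hA) fun y hy => ?_
    rw [← ENNReal.ofReal_mul (abs_nonneg _)]
    congr 1
    have hev : inChart p G =ᶠ[nhds y] fun z => inChart x G (φ (χ.symm z)) := by
      have hc : ContinuousAt χ.symm y := (mdifferentiableAt_chart_symm hy.2).continuousAt
      have : φ.source ∈ nhds (χ.symm y) :=
        (isOpen_extChartAt_source x).mem_nhds (hxs _ hy.1)
      filter_upwards [hc this] with z hz
      simp only [inChart]
      rw [φ.left_inv hz]
    have hg : DifferentiableAt ℝ (inChart x G) (φ (χ.symm y)) :=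
      ((contDiffOn_inChart hG x).differentiableOn (by simp)).differentiableAt
        ((isOpen_extChartAt_target x).mem_nhds (φ.map_source (hxs _ hy.1)))
    rw [areaDensity, areaDensity, ← sqrt_det_gramOf_comp, hev.fderiv_eq]
    congr 3
    exact (fderiv_comp y hg ((hsm y hy).differentiableAt (by simp))).symm
  · intro y hy z hz hyz
    have := φ.injOn (hxs _ hy.1) (hxs _ hz.1) hyz
    exact χ.symm.injOn hy.2 hz.2 this

/-- By agreement on overlaps, the measure of the chart at p plus the restriction of the supremum to
the complement of its domain dominates every chart measure, hence the supremum. On the chart domain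
the second summand vanishes. -/
theorem areaMeasure_restrict {G : S → Euc N} (hG : ContMDiff (𝓡 k) 𝓘(ℝ, Euc N) ∞ G) (p : S) :
    (areaMeasure k G).restrict (chartAt (Euc k) p).source = chartMeasure k G p := by
  set s := (chartAt (Euc k) p).source with hs
  have hsm : MeasurableSet s := (chartAt (Euc k) p).open_source.measurableSet
  have hself : ∀ x A, MeasurableSet A →
      chartMeasure k G x A = chartMeasure k G x (A ∩ (chartAt (Euc k) x).source) := by
    intro x A hA
    refine le_antisymm ?_ (measure_mono inter_subset_left)
    calc chartMeasure k G x A ≤ chartMeasure k G x ((A ∩ (chartAt (Euc k) x).source) ∪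
          (chartAt (Euc k) x).sourceᶜ) := measure_mono fun a ha => by
            by_cases h : a ∈ (chartAt (Euc k) x).source
            · exact Or.inl ⟨ha, h⟩
            · exact Or.inr h
      _ ≤ _ := measure_union_le _ _
      _ = _ := by rw [chartMeasure_compl_source, add_zero]
  have hle : areaMeasure k G ≤ chartMeasure k G p + (areaMeasure k G).restrict sᶜ := by
    refine iSup_le fun x => Measure.le_iff.2 fun A hA => ?_
    rw [← measure_inter_add_sdiff A hsm, Measure.add_apply, Measure.restrict_apply hA]
    refine add_le_add ?_ ((le_iSup (chartMeasure k G) x) _)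
    rw [hself x _ (hA.inter hsm), chartMeasure_eq_of_subset hG x p
      ((hA.inter hsm).inter (chartAt (Euc k) x).open_source.measurableSet) inter_subset_right
      (inter_subset_left.trans inter_subset_right)]
    exact measure_mono (inter_subset_left.trans inter_subset_left)
  refine Measure.ext fun A hA => ?_
  rw [Measure.restrict_apply hA]
  refine le_antisymm ((hle _).trans ?_) ?_
  · rw [Measure.add_apply, Measure.restrict_apply (hA.inter hsm), inter_assoc, inter_compl_self,
      inter_empty, measure_empty, add_zero]
    exact measure_mono inter_subset_left
  · rw [hself p A hA]
    exact (le_iSup (chartMeasure k G) p) _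

/-- The integral of a function supported in a chart domain. -/
theorem integral_areaMeasure_of_support {G : S → Euc N} (hG : ContMDiff (𝓡 k) 𝓘(ℝ, Euc N) ∞ G)
    (p : S) {h : S → ℝ} (hc : Continuous h) (hs : ∀ x ∉ (chartAt (Euc k) p).source, h x = 0) :
    ∫ x, h x ∂areaMeasure k G =
      ∫ y in (extChartAt (𝓡 k) p).target, areaDensity G p y * inChart p h y := by
  rw [← setIntegral_eq_integral_of_forall_compl_eq_zero (s := (chartAt (Euc k) p).source)
    (fun x hx => hs x hx), areaMeasure_restrict hG, chartMeasure,
    integral_map (aemeasurable_chart_symm p _ (withDensity_absolutelyContinuous _ _))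
      hc.aestronglyMeasurable, integral_withDensity_eq_integral_toReal_smul₀]
  · refine integral_congr_ae (Filter.Eventually.of_forall fun y => ?_)
    simp only [smul_eq_mul, inChart]
    rw [areaDensity, ENNReal.toReal_ofReal (Real.sqrt_nonneg _)]
  · exact ((continuousOn_areaDensity hG p).aemeasurable
      (isOpen_extChartAt_target p).measurableSet).ennreal_ofReal
  · exact Filter.Eventually.of_forall fun y => ENNReal.ofReal_lt_top

/-- The density is bounded on a compact neighbourhood inside each chart, so the measure is locally
finite; compactness of `S` finishes. -/
theorem isFiniteMeasure_areaMeasure [CompactSpace S] {G : S → Euc N}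
    (hG : ContMDiff (𝓡 k) 𝓘(ℝ, Euc N) ∞ G) : IsFiniteMeasure (areaMeasure k G) := by
  have hloc : IsLocallyFiniteMeasure (areaMeasure k G) := by
    refine ⟨fun x => ?_⟩
    set φ := extChartAt (𝓡 k) x with hφ
    obtain ⟨K, hKn, hKt, hKc⟩ := local_compact_nhds (extChartAt_target_mem_nhds (I := 𝓡 k) x)
    have hint : interior K ⊆ φ.target := interior_subset.trans hKt
    have hmeas : IsOpen (φ.source ∩ φ ⁻¹' interior K) :=
      (continuousOn_extChartAt x).isOpen_inter_preimage (isOpen_extChartAt_source x)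
        isOpen_interior
    refine ⟨φ.source ∩ φ ⁻¹' interior K, hmeas.mem_nhds
      ⟨mem_extChartAt_source x, mem_interior_iff_mem_nhds.2 hKn⟩, ?_⟩
    have h1 : areaMeasure k G (φ.source ∩ φ ⁻¹' interior K) =
        chartMeasure k G x (φ.source ∩ φ ⁻¹' interior K) := by
      rw [← areaMeasure_restrict hG x, Measure.restrict_apply hmeas.measurableSet,
        inter_eq_left.2 (inter_subset_left.trans (extChartAt_source (𝓡 k) x).subset)]
    rw [h1, chartMeasure_apply G x hmeas.measurableSet]
    obtain ⟨C, hC⟩ := hKc.exists_bound_of_continuousOn ((continuousOn_areaDensity hG x).mono hKt)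
    calc _ ≤ ∫⁻ y in K, ENNReal.ofReal (areaDensity G x y) := lintegral_mono_set fun y hy => by
            have := hy.1.2
            rw [mem_preimage, φ.right_inv hy.2] at this
            exact interior_subset this
      _ ≤ ∫⁻ y in K, ENNReal.ofReal C := setLIntegral_mono' hKc.measurableSet fun y hy =>
            ENNReal.ofReal_le_ofReal ((le_abs_self _).trans (hC y hy))
      _ < ⊤ := by
            rw [setLIntegral_const]
            exact ENNReal.mul_lt_top ENNReal.ofReal_lt_top hKc.measure_lt_top
  infer_instance

end AreaMeasure

/-! ### Exterior derivative of a one-form through the embedding -/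

section ContactForm

variable {d N : ℕ} {M : Type*} [TopologicalSpace M] [ChartedSpace (Euc d) M]
  [IsManifold (𝓡 d) ∞ M]

theorem contMDiffAt_diffMap_field {ι : M → Euc N} (hι : ContMDiff (𝓡 d) 𝓘(ℝ, Euc N) ∞ ι)
    {X : Π x : M, TangentSpace (𝓡 d) x} {p : M} (hX : SmoothFieldAt X p) :
    ContMDiffAt (𝓡 d) 𝓘(ℝ, Euc N) ∞ (fun y => diffMap d ι y (X y)) p := by
  have h1 := (hι.contMDiff_tangentMap (m := ∞) (by simp)).contMDiffAt (x := ⟨p, X p⟩)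
  have h2 := ContMDiffAt.comp p h1 hX
  exact (contMDiff_snd_tangentBundle_modelSpace (Euc N) 𝓘(ℝ, Euc N) (n := ∞)).contMDiffAt.comp p h2

/-- The Sasakian axioms speak of vector fields; extending single vectors turns them into pointwise
identities once the terms involved are tensorial. -/
theorem exists_smoothField (p : M) (w : TangentSpace (𝓡 d) p) :
    ∃ X : Π x : M, TangentSpace (𝓡 d) x, SmoothFieldAt X p ∧ X p = w :=
  ⟨FiberBundle.extend (Euc d) w, FiberBundle.contMDiffAt_extend (𝓡 d) (Euc d) w, by simp⟩

/-- The vector field `X` read in the chart at `p`. -/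
def fieldInChart (p : M) (X : Π x : M, TangentSpace (𝓡 d) x) (z : Euc d) : Euc d :=
  VectorField.mpullbackWithin 𝓘(ℝ, Euc d) (𝓡 d) (extChartAt (𝓡 d) p).symm X (range (𝓡 d)) z

theorem chartSymmDeriv_fieldInChart {p : M} {X : Π x : M, TangentSpace (𝓡 d) x} {z : Euc d}
    (hz : z ∈ (extChartAt (𝓡 d) p).target) :
    chartSymmDeriv p z (fieldInChart p X z) = X ((extChartAt (𝓡 d) p).symm z) := by
  have h := isInvertible_mfderivWithin_extChartAt_symm (I := 𝓡 d) hz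
  have h2 := h.self_apply_inverse (X ((extChartAt (𝓡 d) p).symm z))
  have h3 : mfderivWithin 𝓘(ℝ, Euc d) (𝓡 d) (extChartAt (𝓡 d) p).symm (range (𝓡 d)) z =
      mfderiv 𝓘(ℝ, Euc d) (𝓡 d) (extChartAt (𝓡 d) p).symm z := by
    rw [ModelWithCorners.range_eq_univ, mfderivWithin_univ]
  exact (congrArg (fun l => l (fieldInChart p X z)) h3).symm.trans h2

theorem fieldInChart_self (p : M) (X : Π x : M, TangentSpace (𝓡 d) x) :
    fieldInChart p X (extChartAt (𝓡 d) p p) = X p := by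
  have h := chartSymmDeriv_fieldInChart (X := X) (mem_extChartAt_target (I := 𝓡 d) p)
  rw [chartSymmDeriv_self] at h
  refine Eq.trans h ?_
  rw [extChartAt_to_inv]

theorem differentiableAt_fieldInChart {p : M} {X : Π x : M, TangentSpace (𝓡 d) x}
    (hX : SmoothFieldAt X p) :
    DifferentiableAt ℝ (fieldInChart p X) (extChartAt (𝓡 d) p p) := by
  have h := VectorField.contMDiffWithinAt_mpullbackWithin_extChartAt_symm (I := 𝓡 d) (s := univ) (n := ∞)
    (m := ∞) (contMDiffWithinAt_univ.2 hX) uniqueMDiffOn_univ (mem_univ p) (by simp)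
  have h2 := h.contMDiffAt (by simpa using extChartAt_target_mem_nhds (I := 𝓡 d) p)
  have h3 := contMDiffAt_vectorSpace_iff_contDiffAt.1 h2
  exact h3.differentiableAt (by simp)

/-- The differential of the chart at its centre is the identity, so pulling the bracket back costs
nothing at p. -/
theorem mlieBracket_eq_lieBracket (p : M) (X Y : Π x : M, TangentSpace (𝓡 d) x) :
    VectorField.mlieBracket (𝓡 d) X Y p =
      VectorField.lieBracket ℝ (fieldInChart p X) (fieldInChart p Y) (extChartAt (𝓡 d) p p) := by
  have h1 : (extChartAt (𝓡 d) p).symm ⁻¹' univ ∩ range (𝓡 d) = univ := by simp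
  have h2 : VectorField.mlieBracketWithin (𝓡 d) X Y univ p =
      (mfderiv (𝓡 d) 𝓘(ℝ, Euc d) (extChartAt (𝓡 d) p) p).inverse (VectorField.lieBracketWithin ℝ (E := Euc d)
        (fieldInChart p X) (fieldInChart p Y) ((extChartAt (𝓡 d) p).symm ⁻¹' univ ∩ range (𝓡 d))
        (extChartAt (𝓡 d) p p)) := rfl
  rw [h1, VectorField.lieBracketWithin_univ, mfderiv_extChartAt_self,
    VectorField.mlieBracketWithin_univ] at h2
  refine h2.trans ?_
  exact congrArg (fun l : Euc d →L[ℝ] Euc d => l _) (ContinuousLinearMap.inverse_id (R := ℝ))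

theorem dirDeriv_eq {h : M → ℝ} {p : M} (hh : MDifferentiableAt (𝓡 d) 𝓘(ℝ, ℝ) h p)
    (w : Euc d) : dirDeriv h p w = fderiv ℝ (inChart p h) (extChartAt (𝓡 d) p p) w := by
  rw [fderiv_inChart_eq (mem_extChartAt_target p) (by rwa [extChartAt_to_inv]), chartSymmDeriv_self]
  rw [extChartAt_to_inv]
  rfl

/-- The exterior derivative of the one-form `⟪ξ, dι ·⟫` does not involve derivatives of the
arguments. -/
theorem contactD_eq {ι ξ : M → Euc N} (hι : ContMDiff (𝓡 d) 𝓘(ℝ, Euc N) ∞ ι)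
    (hξ : ContMDiff (𝓡 d) 𝓘(ℝ, Euc N) ∞ ξ) {η : Π x : M, TangentSpace (𝓡 d) x →L[ℝ] ℝ}
    (hη : ∀ x w, η x w = ⟪ξ x, diffMap d ι x w⟫_ℝ) {X Y : Π x : M, TangentSpace (𝓡 d) x} {p : M}
    (hX : SmoothFieldAt X p) (hY : SmoothFieldAt Y p) :
    contactD η X Y p = (⟪diffMap d ξ p (X p), diffMap d ι p (Y p)⟫_ℝ
      - ⟪diffMap d ξ p (Y p), diffMap d ι p (X p)⟫_ℝ) / 2 := by
  set z := extChartAt (𝓡 d) p p with hz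
  have hιd : ∀ x, MDifferentiableAt (𝓡 d) 𝓘(ℝ, Euc N) ι x := fun x => hι.mdifferentiable (by simp) x
  have hξd : ∀ x, MDifferentiableAt (𝓡 d) 𝓘(ℝ, Euc N) ξ x := fun x => hξ.mdifferentiable (by simp) x
  have hιc : ContDiffAt ℝ ∞ (inChart p ι) z :=
    (contDiffOn_inChart hι p).contDiffAt (extChartAt_target_mem_nhds p)
  have hξc : HasFDerivAt (inChart p ξ) (eucDiff d ξ p) z := by
    rw [← fderiv_inChart_self (hξd p)]
    exact (((contDiffOn_inChart hξ p).contDiffAt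
      (extChartAt_target_mem_nhds p)).differentiableAt (by simp)).hasFDerivAt
  have hι2 : HasFDerivAt (fderiv ℝ (inChart p ι)) (fderiv ℝ (fderiv ℝ (inChart p ι)) z) z :=
    ((hιc.fderiv_right (m := ∞) (by simp)).differentiableAt (by simp)).hasFDerivAt
  -- The derivative of η(Y) splits into derivatives of ξ, of dι and of Y. After antisymmetrization
  -- the second cancels by symmetry of D²ι and the third against the bracket term.
  have key : ∀ Y : Π x : M, TangentSpace (𝓡 d) x, SmoothFieldAt Y p → ∀ w : Euc d,
      dirDeriv (fun y => η y (Y y)) p w = ⟪eucDiff d ξ p w, diffMap d ι p (Y p)⟫_ℝ +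
        ⟪ξ p, fderiv ℝ (fderiv ℝ (inChart p ι)) z w (Y p : Euc d)⟫_ℝ +
        ⟪ξ p, eucDiff d ι p (fderiv ℝ (fieldInChart p Y) z w)⟫_ℝ := by
    intro Y hY w
    have hmd : MDifferentiableAt (𝓡 d) 𝓘(ℝ, ℝ) (fun y => η y (Y y)) p := by
      have h2 := (contMDiffAt_diffMap_field hι hY)
      have h3 : ContMDiffAt (𝓡 d) 𝓘(ℝ, ℝ) ∞ (fun y => ⟪ξ y, diffMap d ι y (Y y)⟫_ℝ) p :=
        (contDiff_inner (𝕜 := ℝ) (E := Euc N) (n := ∞)).contMDiff.contMDiffAt.comp p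
          ((hξ p).prodMk_space h2)
      simp only [hη]
      exact h3.mdifferentiableAt (by simp)
    rw [dirDeriv_eq hmd]
    have hev : inChart p (fun y => η y (Y y)) =ᶠ[nhds z]
        fun y => ⟪inChart p ξ y, fderiv ℝ (inChart p ι) y (fieldInChart p Y y)⟫_ℝ := by
      filter_upwards [extChartAt_target_mem_nhds (I := 𝓡 d) p] with y hy
      rw [fderiv_inChart_eq hy (hιd _), chartSymmDeriv_fieldInChart hy]
      exact hη _ _
    rw [hev.fderiv_eq]
    have hd := hξc.inner ℝ (hι2.clm_apply (differentiableAt_fieldInChart hY).hasFDerivAt)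
    have e1 : inChart p ξ z = ξ p := by rw [inChart, hz, extChartAt_to_inv]
    have e2 : fderiv ℝ (inChart p ι) z = eucDiff d ι p := fderiv_inChart_self (hιd p)
    have e3 : fieldInChart p Y z = Y p := fieldInChart_self p Y
    rw [HasFDerivAt.fderiv hd, e2]
    change (fderivInnerCLM ℝ (inChart p ξ z, eucDiff d ι p (fieldInChart p Y z)))
      (eucDiff d ξ p w, eucDiff d ι p (fderiv ℝ (fieldInChart p Y) z w) +
        fderiv ℝ (fderiv ℝ (inChart p ι)) z w (fieldInChart p Y z)) = _
    rw [fderivInnerCLM_apply, e1, e3, inner_add_right]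
    change _ + ⟪eucDiff d ξ p w, eucDiff d ι p (Y p : Euc d)⟫_ℝ =
      ⟪eucDiff d ξ p w, eucDiff d ι p (Y p : Euc d)⟫_ℝ + _ + _
    ring
  have hsym : fderiv ℝ (fderiv ℝ (inChart p ι)) z (X p : Euc d) (Y p : Euc d) =
      fderiv ℝ (fderiv ℝ (inChart p ι)) z (Y p : Euc d) (X p : Euc d) :=
    hιc.isSymmSndFDerivAt (n := ∞) (by simpa using ENat.LEInfty.out) _ _
  have hbr : η p (VectorField.mlieBracket (𝓡 d) X Y p) =
      ⟪ξ p, eucDiff d ι p (fderiv ℝ (fieldInChart p Y) z (X p : Euc d))⟫_ℝ -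
      ⟪ξ p, eucDiff d ι p (fderiv ℝ (fieldInChart p X) z (Y p : Euc d))⟫_ℝ := by
    rw [hη, mlieBracket_eq_lieBracket, ← inner_sub_right, ← map_sub]
    change ⟪ξ p, eucDiff d ι p _⟫_ℝ = _
    rw [VectorField.lieBracket_eq]
    simp only [fieldInChart_self]
    rfl
  rw [contactD, show dirDeriv (fun y => η y (Y y)) p (X p) = _ from key Y hY (X p),
    show dirDeriv (fun y => η y (X y)) p (Y p) = _ from key X hX (Y p), hbr, hsym]
  change _ = (⟪eucDiff d ξ p (X p : Euc d), _⟫_ℝ - ⟪eucDiff d ξ p (Y p : Euc d), _⟫_ℝ) / 2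
  ring

end ContactForm

/-! ### Pointwise Sasakian identities -/

section SasakianAlgebra

variable {d N : ℕ} {M : Type*} [TopologicalSpace M] [ChartedSpace (Euc d) M]
  [IsManifold (𝓡 d) ∞ M] {s : SasakianStructure d M} {ι : M → Euc N}

/-- The Reeb vector field, viewed in Euclidean space. -/
def reebVec (s : SasakianStructure d M) (ι : M → Euc N) (p : M) : Euc N := diffMap d ι p (s.T p)

/-- The exterior derivative of the contact form in terms of the Reeb vector field in Euclidean
space. -/
def contactTwoForm (s : SasakianStructure d M) (ι : M → Euc N) (p : M) (w w' : TangentSpace (𝓡 d) p) :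
    ℝ :=
  (⟪diffMap d (reebVec s ι) p w, diffMap d ι p w'⟫_ℝ
    - ⟪diffMap d (reebVec s ι) p w', diffMap d ι p w⟫_ℝ) / 2

theorem contMDiff_reebVec (hι : IsIsometricEmbedding s.g ι) :
    ContMDiff (𝓡 d) 𝓘(ℝ, Euc N) ∞ (reebVec s ι) :=
  fun p => contMDiffAt_diffMap_field hι.smooth (s.smooth_T p)

theorem eta_eq_inner (hι : IsIsometricEmbedding s.g ι) (p : M) (w : TangentSpace (𝓡 d) p) :
    s.η p w = ⟪reebVec s ι p, diffMap d ι p w⟫_ℝ := by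
  rw [← s.adapted, hι.isometric]; rfl

theorem inner_reebVec_self (hι : IsIsometricEmbedding s.g ι) (p : M) :
    ⟪reebVec s ι p, reebVec s ι p⟫_ℝ = 1 :=
  (eta_eq_inner hι p (s.T p)).symm.trans (s.η_T p)

/-- Compute Φ³w in two ways: Φ(Φ²w) = -Φw because ΦT = 0, whereas Φ²(Φw) = -Φw + η(Φw)T. -/
theorem eta_Phi (s : SasakianStructure d M) (p : M) (w : TangentSpace (𝓡 d) p) :
    s.η p (s.Φ p w) = 0 := by
  have h1 := s.Φ_sq p (s.Φ p w)
  rw [s.Φ_sq p w, map_neg, map_sub, map_smul, s.Φ_T, smul_zero, sub_zero] at h1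
  have h2 : s.η p (s.Φ p w) • s.T p = 0 := by
    have h3 := neg_injective h1
    exact sub_eq_self.1 h3.symm
  have h4 := congrArg (s.η p) h2
  rw [map_smul, s.η_T, map_zero] at h4
  simpa using h4

theorem contactD_eq_contactTwoForm (hι : IsIsometricEmbedding s.g ι)
    {X Y : Π x : M, TangentSpace (𝓡 d) x} {p : M} (hX : SmoothFieldAt X p)
    (hY : SmoothFieldAt Y p) : contactD s.η X Y p = contactTwoForm s ι p (X p) (Y p) :=
  contactD_eq hι.smooth (contMDiff_reebVec hι) (eta_eq_inner hι) hX hY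

theorem contactTwoForm_reeb (hι : IsIsometricEmbedding s.g ι) (p : M) (w : TangentSpace (𝓡 d) p) :
    contactTwoForm s ι p (s.T p) w = 0 := by
  obtain ⟨X, hX, rfl⟩ := exists_smoothField p w
  rw [← contactD_eq_contactTwoForm hι (s.smooth_T p) hX, s.reeb X p hX]

theorem contactTwoForm_swap (p : M) (w w' : TangentSpace (𝓡 d) p) :
    contactTwoForm s ι p w w' = -contactTwoForm s ι p w' w := by
  simp only [contactTwoForm]; ring

theorem metric_eq (hι : IsIsometricEmbedding s.g ι) (p : M) (w w' : TangentSpace (𝓡 d) p) :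
    s.g.inner p w w' = s.η p w * s.η p w' + contactTwoForm s ι p w (s.Φ p w') := by
  obtain ⟨X, hX, rfl⟩ := exists_smoothField p w
  obtain ⟨Y, hY, rfl⟩ := exists_smoothField p w'
  rw [s.contact_metric X Y p hX hY, contactD_eq_contactTwoForm hι hX (s.smooth_Φ Y p hY)]

theorem contactTwoForm_add_smul (p : M) (w w₁ w₂ : TangentSpace (𝓡 d) p) (c : ℝ) :
    contactTwoForm s ι p w (w₁ + c • w₂) =
      contactTwoForm s ι p w w₁ + c * contactTwoForm s ι p w w₂ := by
  simp only [contactTwoForm, map_add, map_smul, inner_add_left, inner_add_right,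
    real_inner_smul_left, real_inner_smul_right]
  ring

/-- Decompose w' = Φ(-Φw') + η(w')T. The Reeb part is annihilated by dη, and the rest is the contact
metric identity applied to -Φw'. -/
theorem contactTwoForm_eq (hι : IsIsometricEmbedding s.g ι) (p : M) (w w' : TangentSpace (𝓡 d) p) :
    contactTwoForm s ι p w w' = -s.g.inner p w (s.Φ p w') := by
  have h1 : w' = s.Φ p (-s.Φ p w') + s.η p w' • s.T p := by
    rw [map_neg, s.Φ_sq]; simp
  have h2 := metric_eq hι p w (-s.Φ p w')
  rw [map_neg, map_neg, eta_Phi, neg_zero, mul_zero, zero_add] at h2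
  rw [h2]
  conv_lhs => rw [h1, contactTwoForm_add_smul, contactTwoForm_swap _ w (s.T p),
    contactTwoForm_reeb hι, neg_zero, mul_zero, add_zero]

/-- Follows from the contact metric identity and skew-symmetry of dη. The correction η ⊗ η is kept
because it is applied before the surface is known to be Legendrian; it produces the zeroth-order
term of the evolution of F^*η. -/
theorem inner_Phi_Phi (hι : IsIsometricEmbedding s.g ι) (p : M) (w w' : TangentSpace (𝓡 d) p) :
    s.g.inner p (s.Φ p w) (s.Φ p w') = s.g.inner p w w' - s.η p w * s.η p w' := by
  have h1 := metric_eq hι p w w'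
  rw [contactTwoForm_swap, contactTwoForm_eq hι, neg_neg] at h1
  rw [h1, s.g.symm p (s.Φ p w)]; ring

end SasakianAlgebra

/-! ### The Gauss formula -/

section GaussFormula

variable {d N : ℕ} {M : Type*} [TopologicalSpace M] [ChartedSpace (Euc d) M]
  [IsManifold (𝓡 d) ∞ M] {g : SmoothMetric d M} {ι : M → Euc N}

theorem isometric_injective (hι : IsIsometricEmbedding g ι) (p : M) :
    Function.Injective (eucDiff d ι p) := by
  rw [injective_iff_map_eq_zero]
  intro w hw
  by_contra hne
  have h1 := g.pos p w hne
  rw [hι.isometric p w w, show diffMap d ι p w = 0 from hw, inner_zero_left] at h1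
  exact h1.false

theorem normalPart_eq {k : ℕ} {S : Type*} [TopologicalSpace S] [ChartedSpace (Euc k) S]
    {G : S → Euc N} {x : S} (h : Function.Injective (eucDiff k G x)) (w : Euc N) :
    normalPart k G x w = w - tanProj (eucDiff k G x) w :=
  starProjection_range_orthogonal h w

theorem metricCoeff_eq (hι : IsIsometricEmbedding g ι) {p : M} {z : Euc d}
    (hz : z ∈ (extChartAt (𝓡 d) p).target) :
    metricCoeff g p z = gramOf (fderiv ℝ (inChart p ι) z) := by
  ext a b
  rw [gramOf_apply, fderiv_inChart_eq hz (hι.smooth.mdifferentiable (by simp) _),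
    fderiv_inChart_eq hz (hι.smooth.mdifferentiable (by simp) _)]
  exact hι.isometric _ _ _

theorem contDiffAt_inChart (hι : IsIsometricEmbedding g ι) (p : M) :
    ContDiffAt ℝ ∞ (inChart p ι) (extChartAt (𝓡 d) p p) :=
  (contDiffOn_inChart hι.smooth p).contDiffAt (extChartAt_target_mem_nhds p)

theorem pderiv_metricCoeff (hι : IsIsometricEmbedding g ι) (p : M) (a b c : Fin d) :
    pderiv c (fun z => metricCoeff g p z a b) (extChartAt (𝓡 d) p p) =
      ⟪fderiv ℝ (fderiv ℝ (inChart p ι)) (extChartAt (𝓡 d) p p) (stdVec c) (stdVec a),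
        eucDiff d ι p (stdVec b)⟫_ℝ +
      ⟪fderiv ℝ (fderiv ℝ (inChart p ι)) (extChartAt (𝓡 d) p p) (stdVec c) (stdVec b),
        eucDiff d ι p (stdVec a)⟫_ℝ := by
  set z := extChartAt (𝓡 d) p p with hz
  have hev : (fun z => metricCoeff g p z a b) =ᶠ[nhds z] fun z =>
      ⟪fderiv ℝ (inChart p ι) z (stdVec a), fderiv ℝ (inChart p ι) z (stdVec b)⟫_ℝ := by
    filter_upwards [extChartAt_target_mem_nhds (I := 𝓡 d) p] with y hy
    rw [metricCoeff_eq hι hy, gramOf_apply]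
  have h2 : HasFDerivAt (fderiv ℝ (inChart p ι)) (fderiv ℝ (fderiv ℝ (inChart p ι)) z) z :=
    (((contDiffAt_inChart hι p).fderiv_right (m := ∞) (by simp)).differentiableAt
      (by simp)).hasFDerivAt
  have h3 : ∀ v, HasFDerivAt (fun z => fderiv ℝ (inChart p ι) z v)
      ((fderiv ℝ (fderiv ℝ (inChart p ι)) z).flip v) z := fun v => by
    simpa using h2.clm_apply (hasFDerivAt_const v z)
  rw [pderiv, hev.fderiv_eq, ((h3 (stdVec a)).inner ℝ (h3 (stdVec b))).fderiv,
    fderiv_inChart_self (hι.smooth.mdifferentiable (by simp) p)]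
  simp only [ContinuousLinearMap.comp_apply, ContinuousLinearMap.prod_apply, fderivInnerCLM_apply,
    ContinuousLinearMap.flip_apply]
  rw [real_inner_comm, add_comm]

/-- With g_ab = ⟪ι_a, ι_b⟫ the three metric derivatives in Γ combine, by symmetry of second
derivatives, to 2⟪ι_ab, ι_e⟫. So Γ gives the coordinates of the tangential part of ι_ab. -/
theorem sum_christoffel_smul (hι : IsIsometricEmbedding g ι) (p : M) (a b : Fin d) :
    ∑ c, christoffel g p (extChartAt (𝓡 d) p p) c a b • eucDiff d ι p (stdVec c) =
      tanProj (eucDiff d ι p)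
        (fderiv ℝ (fderiv ℝ (inChart p ι)) (extChartAt (𝓡 d) p p) (stdVec a) (stdVec b)) := by
  set z := extChartAt (𝓡 d) p p with hz
  have hsym : ∀ u v, fderiv ℝ (fderiv ℝ (inChart p ι)) z u v =
      fderiv ℝ (fderiv ℝ (inChart p ι)) z v u := fun u v =>
    (contDiffAt_inChart hι p).isSymmSndFDerivAt (n := ∞) (by simpa using ENat.LEInfty.out) u v
  have hΓ : ∀ c, christoffel g p z c a b = ∑ e, (gramOf (eucDiff d ι p))⁻¹ c e *
      ⟪fderiv ℝ (fderiv ℝ (inChart p ι)) z (stdVec a) (stdVec b), eucDiff d ι p (stdVec e)⟫_ℝ := by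
    intro c
    rw [christoffel, metricCoeff_eq hι (mem_extChartAt_target p),
      fderiv_inChart_self (hι.smooth.mdifferentiable (by simp) p), Finset.mul_sum]
    refine Finset.sum_congr rfl fun e _ => ?_
    rw [pderiv_metricCoeff hι, pderiv_metricCoeff hι, pderiv_metricCoeff hι, ← hz,
      hsym (stdVec b) (stdVec a), hsym (stdVec e) (stdVec a), hsym (stdVec e) (stdVec b)]
    ring
  rw [tanProj, Finset.sum_comm]
  refine Finset.sum_congr rfl fun c _ => ?_
  rw [hΓ, Finset.sum_smul]
  exact Finset.sum_congr rfl fun e _ => by rw [gramOf_inv_comm]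

variable {k : ℕ} {S : Type*} [TopologicalSpace S] [ChartedSpace (Euc k) S]
  {F : S → M}

theorem contMDiff_comp_embedding (hι : IsIsometricEmbedding g ι) (hF : ContMDiff (𝓡 k) (𝓡 d) ∞ F) :
    ContMDiff (𝓡 k) 𝓘(ℝ, Euc N) ∞ fun x => ι (F x) := hι.smooth.comp hF

theorem diffMap_mfderiv (hι : IsIsometricEmbedding g ι) (hF : ContMDiff (𝓡 k) (𝓡 d) ∞ F) (x : S)
    (v : Euc k) :
    diffMap d ι (F x) (mfderiv (𝓡 k) (𝓡 d) F x v) = eucDiff k (fun x => ι (F x)) x v := by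
  have h := mfderiv_comp x (hι.smooth.mdifferentiable (by simp) (F x))
    (hF.mdifferentiable (by simp) x)
  exact (congrArg (fun l => l v) h).symm

theorem diffMap_tangentVec (hι : IsIsometricEmbedding g ι) (hF : ContMDiff (𝓡 k) (𝓡 d) ∞ F) (x : S)
    (j : Fin k) :
    diffMap d ι (F x) (tangentVec F x j) = eucDiff k (fun x => ι (F x)) x (stdVec j) :=
  diffMap_mfderiv hι hF x _

theorem inverseInduced_eq (hι : IsIsometricEmbedding g ι) (hF : ContMDiff (𝓡 k) (𝓡 d) ∞ F) (x : S) :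
    inverseInduced k g F x = (gramOf (eucDiff k (fun x => ι (F x)) x))⁻¹ := by
  rw [inverseInduced]
  congr 1
  ext i j
  rw [gramOf_apply, Matrix.of_apply, hι.isometric, diffMap_tangentVec hι hF,
    diffMap_tangentVec hι hF]

variable [IsManifold (𝓡 k) ∞ S]

theorem inducedCoeff_eq (hι : IsIsometricEmbedding g ι) (hF : ContMDiff (𝓡 k) (𝓡 d) ∞ F) {p : S}
    {y : Euc k} (hy : y ∈ (extChartAt (𝓡 k) p).target) :
    inducedCoeff g F p y = gramOf (fderiv ℝ (inChart p fun x => ι (F x)) y) := by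
  have hd : MDifferentiableAt 𝓘(ℝ, Euc k) (𝓡 d) (inChart p F) y :=
    ((contMDiffOn_inChart hF p).contMDiffAt
      ((isOpen_extChartAt_target p).mem_nhds hy)).mdifferentiableAt (by simp)
  have h := mfderiv_comp y (hι.smooth.mdifferentiable (by simp) (inChart p F y)) hd
  rw [mfderiv_eq_fderiv] at h
  have h2 : ∀ v, diffMap d ι (inChart p F y) (mfderiv 𝓘(ℝ, Euc k) (𝓡 d) (inChart p F) y v) =
      fderiv ℝ (inChart p fun x => ι (F x)) y v := fun v => (congrArg (fun l => l v) h).symm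
  ext i j
  exact (hι.isometric _ _ _).trans (congrArg₂ (fun a b => ⟪a, b⟫_ℝ) (h2 _) (h2 _))

theorem inducedMeasure_eq [MeasurableSpace S] (hι : IsIsometricEmbedding g ι)
    [BorelSpace S] (hF : ContMDiff (𝓡 k) (𝓡 d) ∞ F) :
    inducedMeasure k g F = areaMeasure k fun x => ι (F x) := by
  refine iSup_congr fun p => ?_
  rw [chartMeasure]
  congr 1
  refine withDensity_congr_ae ((ae_restrict_iff' (isOpen_extChartAt_target p).measurableSet).2
    (Filter.Eventually.of_forall fun y hy => ?_))
  simp only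
  rw [inducedCoeff_eq hι hF hy, areaDensity]

/-- The Gauss formula in coordinates. -/
theorem diffMap_covariantHessian_add (hι : IsIsometricEmbedding g ι)
    (hF : ContMDiff (𝓡 k) (𝓡 d) ∞ F) (x : S) (i j : Fin k) :
    diffMap d ι (F x) (covariantHessian g F x i j) +
      secondFundamentalForm d ι (F x) (tangentVec F x i) (tangentVec F x j) =
    fderiv ℝ (fderiv ℝ (inChart x fun x => ι (F x))) (extChartAt (𝓡 k) x x)
      (stdVec i) (stdVec j) := by
  set f : Euc k → Euc d := writtenInExtChartAt (𝓡 k) (𝓡 d) x F with hf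
  set y : Euc k := extChartAt (𝓡 k) x x with hy
  set z : Euc d := extChartAt (𝓡 d) (F x) (F x) with hz
  have hfy : f y = z := by
    simp only [hf, hy, hz, writtenInExtChartAt, Function.comp_apply, extChartAt_to_inv]
  have hfs : ContDiffAt ℝ ∞ f y := by
    have h1 : ContMDiffAt (𝓡 d) 𝓘(ℝ, Euc d) ∞ (extChartAt (𝓡 d) (F x))
        (F ((extChartAt (𝓡 k) x).symm y)) := by
      rw [hy, extChartAt_to_inv]; exact contMDiffAt_extChartAt
    exact (h1.comp y ((contMDiffOn_inChart hF x).contMDiffAt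
      (extChartAt_target_mem_nhds x))).contDiffAt
  have hT : ∀ j, tangentVec F x j = fderiv ℝ f y (stdVec j) := by
    intro j
    have h := (hF.mdifferentiable (by simp) x).mfderiv
    rw [ModelWithCorners.range_eq_univ, fderivWithin_univ] at h
    exact congrArg (fun l => l (stdVec j : Euc k)) h
  have hev : (inChart x fun x => ι (F x)) =ᶠ[nhds y] fun w => inChart (F x) ι (f w) := by
    have hc : ContinuousAt (inChart x F) y :=
      ((contMDiffOn_inChart hF x).contMDiffAt (extChartAt_target_mem_nhds x)).continuousAt
    have hm : (extChartAt (𝓡 d) (F x)).source ∈ nhds (inChart x F y) := by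
      rw [hy, inChart, extChartAt_to_inv]; exact extChartAt_source_mem_nhds (F x)
    filter_upwards [hc hm] with w hw
    have := (extChartAt (𝓡 d) (F x)).left_inv hw
    simp only [inChart] at this
    simp only [inChart, hf, writtenInExtChartAt, Function.comp_apply]
    rw [this]
  have hι1 : fderiv ℝ (inChart (F x) ι) (f y) = eucDiff d ι (F x) := by
    rw [hfy, fderiv_inChart_self (hι.smooth.mdifferentiable (by simp) _)]
  have hιs : ContDiffAt ℝ ∞ (inChart (F x) ι) (f y) := by
    rw [hfy]; exact contDiffAt_inChart hι (F x)
  -- The chain rule gives Dι(∂_i∂_j f) + D²ι(∂_i f, ∂_j f). The tangential part of the second term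
  -- supplies the Christoffel term, its normal part the second fundamental form.
  rw [hev.fderiv.fderiv_eq, fderiv_fderiv_comp hιs hfs, hι1, hfy]
  have hcov : covariantHessian g F x i j = WithLp.toLp 2 fun c => pderiv i (pderiv j f) y c +
      ∑ a, ∑ b, christoffel g (F x) (f y) c a b * pderiv i f y a * pderiv j f y b := rfl
  have hp2 : pderiv i (pderiv j f) y = fderiv ℝ (fderiv ℝ f) y (stdVec i) (stdVec j) := by
    have h1 : HasFDerivAt (fderiv ℝ f) (fderiv ℝ (fderiv ℝ f) y) y :=
      ((hfs.fderiv_right (m := ∞) (by simp)).differentiableAt (by simp)).hasFDerivAt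
    have h2 := h1.clm_apply (hasFDerivAt_const (stdVec j : Euc k) y)
    rw [pderiv, show pderiv j f = fun y => fderiv ℝ f y (stdVec j) from rfl, h2.fderiv]
    simp
  set Q := fderiv ℝ (fderiv ℝ (inChart (F x) ι)) z with hQ
  set D := eucDiff d ι (F x) with hD
  have hlin : ∀ c : ℝ, ∀ w, tanProj D (c • w) = c • tanProj D w := by
    intro c w
    simp only [tanProj, Finset.smul_sum, smul_smul, real_inner_smul_left]
    exact Finset.sum_congr rfl fun _ _ => Finset.sum_congr rfl fun _ _ => by congr 1; ring
  have hadd : ∀ w w', tanProj D (w + w') = tanProj D w + tanProj D w' := by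
    intro w w'
    simp only [tanProj, ← Finset.sum_add_distrib, inner_add_left, mul_add, add_smul]
  let τ : Euc N →ₗ[ℝ] Euc N := { toFun := tanProj D, map_add' := hadd, map_smul' := hlin }
  have hcovD : diffMap d ι (F x) (covariantHessian g F x i j) =
      D (fderiv ℝ (fderiv ℝ f) y (stdVec i) (stdVec j)) +
        tanProj D (Q (fderiv ℝ f y (stdVec i)) (fderiv ℝ f y (stdVec j))) := by
    have hsplit : (WithLp.toLp 2 fun c => pderiv i (pderiv j f) y c +
        ∑ a, ∑ b, christoffel g (F x) (f y) c a b * pderiv i f y a * pderiv j f y b : Euc d) =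
        fderiv ℝ (fderiv ℝ f) y (stdVec i) (stdVec j) + ∑ c, (∑ a, ∑ b,
          christoffel g (F x) z c a b * pderiv i f y a * pderiv j f y b) • (stdVec c : Euc d) := by
      rw [← hp2, ← hfy]
      ext c
      simp [stdVec, Pi.single_apply]
    rw [hcov]
    change D _ = _
    rw [hsplit, map_add, map_sum]
    congr 1
    have hQexp : Q (fderiv ℝ f y (stdVec i)) (fderiv ℝ f y (stdVec j)) =
        ∑ a, ∑ b, (pderiv i f y a * pderiv j f y b) • Q (stdVec a) (stdVec b) := by
      conv_lhs => rw [← sum_smul_stdVec (fderiv ℝ f y (stdVec i)),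
        ← sum_smul_stdVec (fderiv ℝ f y (stdVec j))]
      simp only [map_sum, map_smul, FunLike.coe_sum, Finset.sum_apply,
        FunLike.coe_smul, Pi.smul_apply, Finset.smul_sum, smul_smul]
      rw [Finset.sum_comm]
      exact Finset.sum_congr rfl fun a _ => Finset.sum_congr rfl fun b _ => by rw [mul_comm]; rfl
    have : tanProj D (Q (fderiv ℝ f y (stdVec i)) (fderiv ℝ f y (stdVec j))) =
        ∑ a, ∑ b, (pderiv i f y a * pderiv j f y b) • tanProj D (Q (stdVec a) (stdVec b)) := by
      rw [hQexp]
      change τ _ = ∑ a, ∑ b, _ • τ _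
      simp only [map_sum, map_smul]
    rw [this]
    simp only [map_smul]
    simp only [hQ, hD, hz, ← sum_christoffel_smul hι, Finset.smul_sum, Finset.sum_smul, smul_smul]
    rw [Finset.sum_comm]
    refine Finset.sum_congr rfl fun a _ => ?_
    rw [Finset.sum_comm]
    refine Finset.sum_congr rfl fun b _ => Finset.sum_congr rfl fun c _ => ?_
    congr 1; ring
  have hsff : secondFundamentalForm d ι (F x) (tangentVec F x i) (tangentVec F x j) =
      Q (fderiv ℝ f y (stdVec i)) (fderiv ℝ f y (stdVec j)) -
        tanProj D (Q (fderiv ℝ f y (stdVec i)) (fderiv ℝ f y (stdVec j))) := by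
    rw [secondFundamentalForm, normalPart_eq (isometric_injective hι _), hT, hT]
    have h1 : HasFDerivAt (fderiv ℝ (inChart (F x) ι)) Q z :=
      (((contDiffAt_inChart hι (F x)).fderiv_right (m := ∞) (by simp)).differentiableAt
        (by simp)).hasFDerivAt
    have h2 : ∀ u v : Euc d, fderiv ℝ (fun z => fderiv ℝ (inChart (F x) ι) z v) z u = Q u v := by
      intro u v
      have h3 := h1.clm_apply (hasFDerivAt_const v z)
      rw [h3.fderiv]; simp
    have h4 := h2 (fderiv ℝ f y (stdVec i)) (fderiv ℝ f y (stdVec j))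
    exact congrArg (fun w => w - tanProj D w) h4
  rw [hcovD, hsff]
  abel

end GaussFormula

/-! ### Mean curvature in M and in Euclidean space -/

section MeanCurvature

variable {d N k : ℕ} {M : Type*} [TopologicalSpace M] [ChartedSpace (Euc d) M]
  [IsManifold (𝓡 d) ∞ M] {g : SmoothMetric d M} {ι : M → Euc N}
  {S : Type*} [TopologicalSpace S] [ChartedSpace (Euc k) S] {F : S → M}

theorem diffMap_meanCurvature (hι : IsIsometricEmbedding g ι) (hF : ContMDiff (𝓡 k) (𝓡 d) ∞ F)
    (x : S) : ∃ h : Euc N,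
      h = ∑ i, ∑ j, (gramOf (eucDiff k (fun x => ι (F x)) x))⁻¹ i j •
        diffMap d ι (F x) (covariantHessian g F x i j) ∧
      diffMap d ι (F x) (meanCurvature k g F x) =
        h - tanProj (eucDiff k (fun x => ι (F x)) x) h := by
  have hmap : diffMap d ι (F x) (∑ i : Fin k, ∑ j : Fin k,
      inverseInduced k g F x i j • covariantHessian g F x i j) =
      ∑ i, ∑ j, (gramOf (eucDiff k (fun x => ι (F x)) x))⁻¹ i j •
        diffMap d ι (F x) (covariantHessian g F x i j) := by
    simp only [map_sum, map_smul, inverseInduced_eq hι hF]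
  refine ⟨_, rfl, ?_⟩
  rw [← hmap, meanCurvature]
  generalize (∑ i : Fin k, ∑ j : Fin k,
      inverseInduced k g F x i j • covariantHessian g F x i j) = h₀
  simp only [map_sub, map_sum, map_smul, hι.isometric, inverseInduced_eq hι hF,
    diffMap_tangentVec hι hF, tanProj]

theorem inner_normalPart_eucDiff {f : S → Euc N} {x : S}
    (h : Function.Injective (eucDiff k f x)) (w : Euc N) (v : Euc k) :
    ⟪normalPart k f x w, eucDiff k f x v⟫_ℝ = 0 := by
  rw [normalPart_eq h, inner_sub_left, inner_tanProj h, sub_self]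

theorem inner_meanCurvature_tangent (hι : IsIsometricEmbedding g ι)
    (hF : ContMDiff (𝓡 k) (𝓡 d) ∞ F) {x : S}
    (hinj : Function.Injective (eucDiff k (fun x => ι (F x)) x)) (v : Euc k) :
    ⟪diffMap d ι (F x) (meanCurvature k g F x), eucDiff k (fun x => ι (F x)) x v⟫_ℝ = 0 := by
  obtain ⟨h, -, hH⟩ := diffMap_meanCurvature hι hF x
  rw [hH, inner_sub_left, inner_tanProj hinj, sub_self]

/-- Each Ā is normal to M. This is what later makes E orthogonal to T and to the tangent plane of
the surface. -/
theorem inner_extrinsicE (hι : IsIsometricEmbedding g ι) (x : S) (w : TangentSpace (𝓡 d) (F x)) :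
    ⟪extrinsicE k g ι F x, diffMap d ι (F x) w⟫_ℝ = 0 := by
  have h : ∀ w₁ w₂, ⟪secondFundamentalForm d ι (F x) w₁ w₂, diffMap d ι (F x) w⟫_ℝ = 0 := by
    intro w₁ w₂
    exact inner_normalPart_eucDiff (isometric_injective hι _) _ _
  simp only [extrinsicE, inner_neg_left, sum_inner, real_inner_smul_left, h, mul_zero,
    Finset.sum_const_zero, neg_zero]

variable [IsManifold (𝓡 k) ∞ S]

/-- The trace of the Gauss formula; the tangential correction in H is invisible to a vector Z normal
to the surface. -/
theorem inner_meanCurvature_sub_extrinsicE (hι : IsIsometricEmbedding g ι)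
    (hF : ContMDiff (𝓡 k) (𝓡 d) ∞ F) {x : S} {Z : Euc N}
    (hZ : ∀ v, ⟪eucDiff k (fun x => ι (F x)) x v, Z⟫_ℝ = 0) :
    ⟪diffMap d ι (F x) (meanCurvature k g F x) - extrinsicE k g ι F x, Z⟫_ℝ =
      metricTrace (eucDiff k (fun x => ι (F x)) x) (fun u v =>
        ⟪fderiv ℝ (fderiv ℝ (inChart x fun x => ι (F x))) (extChartAt (𝓡 k) x x) u v, Z⟫_ℝ) := by
  obtain ⟨h, hh, hH⟩ := diffMap_meanCurvature hι hF x
  have ht : ⟪tanProj (eucDiff k (fun x => ι (F x)) x) h, Z⟫_ℝ = 0 := by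
    simp only [tanProj, sum_inner, real_inner_smul_left, hZ, mul_zero, Finset.sum_const_zero]
  rw [hH, sub_sub, inner_sub_left, inner_add_left, ht, zero_add, hh, metricTrace, extrinsicE,
    inner_neg_left, sub_neg_eq_add, ← inner_add_left, ← Finset.sum_add_distrib, sum_inner]
  refine Finset.sum_congr rfl fun i _ => ?_
  rw [← Finset.sum_add_distrib, sum_inner]
  refine Finset.sum_congr rfl fun j _ => ?_
  rw [inverseInduced_eq hι hF, ← smul_add, diffMap_covariantHessian_add hι hF,
    real_inner_smul_left]

end MeanCurvature

/-! ### Time-dependent maps on the surface -/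

section TimeDependentMaps

variable {k d : ℕ} {S : Type*} [TopologicalSpace S] [ChartedSpace (Euc k) S]
  {M : Type*} [TopologicalSpace M] [ChartedSpace (Euc d) M] {t₀ : ℝ}

theorem contMDiff_slice {E H Q : Type*} [NormedAddCommGroup E] [NormedSpace ℝ E]
    [TopologicalSpace H] {I : ModelWithCorners ℝ E H} [TopologicalSpace Q] [ChartedSpace H Q]
    {F : ℝ → S → Q} (hF : ContMDiffOn (𝓘(ℝ, ℝ).prod (𝓡 k)) I ∞ (fun p : ℝ × S => F p.1 p.2)
      (Ico 0 t₀ ×ˢ univ)) {t : ℝ} (ht : t ∈ Ico 0 t₀) : ContMDiff (𝓡 k) I ∞ (F t) := by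
  rw [← contMDiffOn_univ]
  exact hF.comp (t := Ico 0 t₀ ×ˢ univ) (f := fun x : S => (t, x))
    (contMDiff_const.prodMk contMDiff_id).contMDiffOn fun x _ => ⟨ht, mem_univ x⟩

theorem contMDiffOn_time {F : ℝ → S → M}
    (hF : ContMDiffOn (𝓘(ℝ, ℝ).prod (𝓡 k)) (𝓡 d) ∞ (fun p : ℝ × S => F p.1 p.2)
      (Ico 0 t₀ ×ˢ univ)) (x : S) : ContMDiffOn 𝓘(ℝ, ℝ) (𝓡 d) ∞ (fun τ => F τ x) (Ico 0 t₀) :=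
  hF.comp (t := Ico 0 t₀ ×ˢ univ) (f := fun τ : ℝ => (τ, x))
    (contMDiff_id.prodMk contMDiff_const).contMDiffOn fun _ hτ => ⟨hτ, mem_univ x⟩

theorem contDiffOn_time_inChart [IsManifold (𝓡 k) ∞ S] {W : Type*} [NormedAddCommGroup W]
    [NormedSpace ℝ W] {G : ℝ → S → W}
    (hG : ContMDiffOn (𝓘(ℝ, ℝ).prod (𝓡 k)) 𝓘(ℝ, W) ∞ (fun p : ℝ × S => G p.1 p.2)
      (Ico 0 t₀ ×ˢ univ)) (p : S) :
    ContDiffOn ℝ ∞ (fun q : ℝ × Euc k => inChart p (G q.1) q.2)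
      (Ico 0 t₀ ×ˢ (extChartAt (𝓡 k) p).target) := by
  rw [← contMDiffOn_iff_contDiffOn]
  refine hG.comp (t := Ico 0 t₀ ×ˢ univ)
    (f := fun q : ℝ × Euc k => (q.1, (extChartAt (𝓡 k) p).symm q.2)) ?_
    fun _ hq => ⟨hq.1, mem_univ _⟩
  refine (contDiff_fst.contMDiff.contMDiffOn).prodMk ?_
  exact (contMDiffOn_extChartAt_symm p).comp (contDiff_snd.contMDiff.contMDiffOn) fun q hq => hq.2

end TimeDependentMaps

/-! ### Continuity of the inverse metric -/

section GramInverse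

variable {k : ℕ} {V : Type*} [NormedAddCommGroup V] [InnerProductSpace ℝ V]

theorem continuous_gramOf : Continuous fun L : Euc k →L[ℝ] V => gramOf L := by
  refine continuous_matrix fun i j => ?_
  simp only [gramOf_apply]
  fun_prop

theorem continuousOn_gramOf_inv {X : Type*} [TopologicalSpace X] {L : X → Euc k →L[ℝ] V}
    {A : Set X} (hL : ContinuousOn L A) (hinj : ∀ x ∈ A, Function.Injective (L x)) :
    ContinuousOn (fun x => (gramOf (L x))⁻¹) A := by
  have hg : ContinuousOn (fun x => gramOf (L x)) A := continuous_gramOf.comp_continuousOn hL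
  have hd : ContinuousOn (fun x => (gramOf (L x)).det) A :=
    continuous_gramOf_det.comp_continuousOn hL
  have ha : ContinuousOn (fun x => (gramOf (L x)).adjugate) A :=
    (Continuous.matrix_adjugate continuous_id).comp_continuousOn hg
  simp only [Matrix.inv_def, Ring.inverse_eq_inv']
  exact (hd.inv₀ fun x hx => (gramOf_det_pos (hinj x hx)).ne').smul ha

end GramInverse

/-! ### Preservation of the Legendrian condition -/

section LegendrianFlow

variable {N : ℕ} {M : Type*} [TopologicalSpace M] [ChartedSpace (Euc 5) M]
  [IsManifold (𝓡 5) ∞ M] {s : SasakianStructure 5 M} {ι : M → Euc N}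
  {S : Type*} [TopologicalSpace S] [ChartedSpace (Euc 2) S]
  {t₀ : ℝ} {F : ℝ → S → M} {α : ℝ → S → ℝ}

/-- The velocity of the flow in Euclidean space. -/
def flowVelocity (s : SasakianStructure 5 M) (ι : M → Euc N) (F : S → M) (α : S → ℝ) (x : S) :
    Euc N :=
  diffMap 5 ι (F x) (meanCurvature 2 s.g F x) - (2 * α x) • reebVec s ι (F x)

theorem derivWithin_comp_flow (hflow : IsLegendrianMCF s t₀ F α) {W : M → Euc N}
    (hW : ContMDiff (𝓡 5) 𝓘(ℝ, Euc N) ∞ W) {t : ℝ} (ht : t ∈ Ico 0 t₀) (x : S) :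
    derivWithin (fun τ => W (F τ x)) (Ico 0 t₀) t =
      diffMap 5 W (F t x) (meanCurvature 2 s.g (F t) x - (2 * α t x) • s.T (F t x)) := by
  have hu : UniqueMDiffWithinAt 𝓘(ℝ, ℝ) (Ico 0 t₀) t :=
    (uniqueDiffOn_Ico 0 t₀ t ht).uniqueMDiffWithinAt
  have h := mfderiv_comp_mfderivWithin t (hW.mdifferentiable (by simp) (F t x))
    ((contMDiffOn_time hflow.smooth_F x).mdifferentiableOn (by simp) t ht) hu
  rw [mfderivWithin_eq_fderivWithin] at h
  rw [← hflow.flow t ht x]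
  exact congrArg (fun l => l (1 : ℝ)) h

theorem derivWithin_embedding_flow (hflow : IsLegendrianMCF s t₀ F α)
    (hι : IsIsometricEmbedding s.g ι) {t : ℝ} (ht : t ∈ Ico 0 t₀) (x : S) :
    derivWithin (fun τ => ι (F τ x)) (Ico 0 t₀) t = flowVelocity s ι (F t) (α t) x := by
  rw [derivWithin_comp_flow hflow hι.smooth ht, map_sub, map_smul]
  rfl

theorem inner_reebVec_meanCurvature (hflow : IsLegendrianMCF s t₀ F α)
    (hι : IsIsometricEmbedding s.g ι) {t : ℝ} (ht : t ∈ Ico 0 t₀) (x : S) :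
    ⟪reebVec s ι (F t x), diffMap 5 ι (F t x) (meanCurvature 2 s.g (F t) x)⟫_ℝ = 0 := by
  rw [← eta_eq_inner hι, hflow.angle t ht, angleField]
  simp only [map_neg, map_sum, map_smul, eta_Phi, smul_zero, Finset.sum_const_zero, neg_zero]

theorem inner_reebVec_flowVelocity (hflow : IsLegendrianMCF s t₀ F α)
    (hι : IsIsometricEmbedding s.g ι) {t : ℝ} (ht : t ∈ Ico 0 t₀) (x : S) :
    ⟪reebVec s ι (F t x), flowVelocity s ι (F t) (α t) x⟫_ℝ = -2 * α t x := by
  rw [flowVelocity, inner_sub_right, inner_reebVec_meanCurvature hflow hι ht,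
    real_inner_smul_right, inner_reebVec_self hι]
  ring

theorem eucDiff_injective_of_flow (hflow : IsLegendrianMCF s t₀ F α)
    (hι : IsIsometricEmbedding s.g ι) {t : ℝ} (ht : t ∈ Ico 0 t₀) (x : S) :
    Function.Injective (eucDiff 2 (fun x => ι (F t x)) x) := by
  intro v w h
  rw [← diffMap_mfderiv hι (contMDiff_slice hflow.smooth_F ht),
    ← diffMap_mfderiv hι (contMDiff_slice hflow.smooth_F ht)] at h
  exact hflow.immersion t ht x (isometric_injective hι _ h)

/-- The pullback of the contact form to the surface, on the `j`-th coordinate vector. -/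
def contactPullback (s : SasakianStructure 5 M) (ι : M → Euc N) (F : S → M) (x : S) (j : Fin 2) :
    ℝ := ⟪reebVec s ι (F x), eucDiff 2 (fun x => ι (F x)) x (stdVec j)⟫_ℝ

/-- The pairing of the pullback of the contact form with the differential of the angle. -/
def contactAnglePairing (s : SasakianStructure 5 M) (ι : M → Euc N) (F : S → M) (α : S → ℝ)
    (x : S) : ℝ :=
  ∑ i, ∑ l, (gramOf (eucDiff 2 (fun x => ι (F x)) x))⁻¹ i l * dirDeriv α x (stdVec l : Euc 2) *
    contactPullback s ι F x i

/-- Insert H = -g^{kl}∂_lα ΦF_k and contract g(ΦF_i, ΦF_j) = g_ij - θ_iθ_j with g^{il}∂_lα. -/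
theorem inner_meanCurvature_Phi (hflow : IsLegendrianMCF s t₀ F α)
    (hι : IsIsometricEmbedding s.g ι) {t : ℝ} (ht : t ∈ Ico 0 t₀) (x : S) (j : Fin 2) :
    s.g.inner (F t x) (meanCurvature 2 s.g (F t) x) (s.Φ (F t x) (tangentVec (F t) x j)) =
      -(dirDeriv (α t) x (stdVec j : Euc 2) -
        contactAnglePairing s ι (F t) (α t) x * contactPullback s ι (F t) x j) := by
  have hF := contMDiff_slice hflow.smooth_F ht
  have hη : ∀ i, s.η (F t x) (tangentVec (F t) x i) = contactPullback s ι (F t) x i := by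
    intro i
    rw [eta_eq_inner hι, diffMap_tangentVec hι hF, contactPullback]
  have hg : ∀ i, s.g.inner (F t x) (s.Φ (F t x) (tangentVec (F t) x i))
      (s.Φ (F t x) (tangentVec (F t) x j)) =
      gramOf (eucDiff 2 (fun x => ι (F t x)) x) i j -
        contactPullback s ι (F t) x i * contactPullback s ι (F t) x j := by
    intro i
    rw [inner_Phi_Phi hι, hη, hη, hι.isometric, diffMap_tangentVec hι hF, diffMap_tangentVec hι hF,
      gramOf_apply]
  have hinv : ∀ l, ∑ i, (gramOf (eucDiff 2 (fun x => ι (F t x)) x))⁻¹ i l *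
      gramOf (eucDiff 2 (fun x => ι (F t x)) x) i j = if l = j then 1 else 0 := by
    intro l
    have := congrFun (congrFun (gramOf_inv_mul (eucDiff_injective_of_flow hflow hι ht x)) l) j
    rw [Matrix.mul_apply, Matrix.one_apply] at this
    rw [← this]
    exact Finset.sum_congr rfl fun i _ => by rw [gramOf_inv_comm]
  rw [hflow.angle t ht, angleField]
  simp only [map_neg, map_sum, map_smul, neg_apply,
    sum_apply, smul_apply, hg, inverseInduced_eq hι hF,
    smul_eq_mul]
  rw [neg_inj, contactAnglePairing, Finset.sum_mul]
  simp only [Finset.sum_mul, mul_sub, Finset.sum_sub_distrib]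
  congr 1
  · rw [Finset.sum_comm]
    calc _ = ∑ l, dirDeriv (α t) x (stdVec l : Euc 2) * ∑ i,
          (gramOf (eucDiff 2 (fun x => ι (F t x)) x))⁻¹ i l *
            gramOf (eucDiff 2 (fun x => ι (F t x)) x) i j := by
          refine Finset.sum_congr rfl fun l _ => ?_
          rw [Finset.mul_sum]
          exact Finset.sum_congr rfl fun i _ => by ring
      _ = _ := by simp [hinv]
  · exact Finset.sum_congr rfl fun i _ => Finset.sum_congr rfl fun l _ => by ring

/-- The Reeb component of the velocity drops out of dη, and the rest is -g(H, ΦF_j). -/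
theorem contactTwoForm_flow (hflow : IsLegendrianMCF s t₀ F α)
    (hι : IsIsometricEmbedding s.g ι) {t : ℝ} (ht : t ∈ Ico 0 t₀) (x : S) (j : Fin 2) :
    contactTwoForm s ι (F t x) (meanCurvature 2 s.g (F t) x - (2 * α t x) • s.T (F t x))
        (tangentVec (F t) x j) =
      dirDeriv (α t) x (stdVec j : Euc 2) -
        contactAnglePairing s ι (F t) (α t) x * contactPullback s ι (F t) x j := by
  rw [contactTwoForm_swap, sub_eq_add_neg, ← neg_smul, contactTwoForm_add_smul,
    contactTwoForm_swap _ _ (s.T _), contactTwoForm_reeb hι, contactTwoForm_swap,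
    contactTwoForm_eq hι, inner_meanCurvature_Phi hflow hι ht]
  ring

theorem contMDiffOn_comp_flow (hflow : IsLegendrianMCF s t₀ F α) {W : M → Euc N}
    (hW : ContMDiff (𝓡 5) 𝓘(ℝ, Euc N) ∞ W) :
    ContMDiffOn (𝓘(ℝ, ℝ).prod (𝓡 2)) 𝓘(ℝ, Euc N) ∞ (fun p : ℝ × S => W (F p.1 p.2))
      (Ico 0 t₀ ×ˢ univ) :=
  hW.comp_contMDiffOn hflow.smooth_F

variable [IsManifold (𝓡 2) ∞ S]

/-- Cartan's formula by hand. The derivative of ⟪ξ, F_j⟫ is ⟪dξ(V), F_j⟫ + ⟪ξ, ∂_jV⟫, and ⟪ξ, V⟫ =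
-2α turns it into 2dη(V, F_j) - 2∂_jα. The terms ∂_jα cancel, leaving an equation linear in θ_j with
coefficient -2⟨dα, θ⟩ and no space derivatives of θ. -/
theorem hasDerivWithinAt_contactPullback (hflow : IsLegendrianMCF s t₀ F α)
    (hι : IsIsometricEmbedding s.g ι) (ht₀ : 0 < t₀) {t : ℝ} (ht : t ∈ Ico 0 t₀) (x : S)
    (j : Fin 2) :
    HasDerivWithinAt (fun τ => contactPullback s ι (F τ) x j)
      (-2 * contactAnglePairing s ι (F t) (α t) x * contactPullback s ι (F t) x j)
      (Ico 0 t₀) t := by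
  have hF := contMDiff_slice hflow.smooth_F ht
  have hU := isOpen_extChartAt_target (I := 𝓡 2) x
  have hy := mem_extChartAt_target (I := 𝓡 2) x
  have hξ := contMDiff_reebVec hι
  have hG := contDiffOn_time_inChart (G := fun τ x => ι (F τ x))
    (contMDiffOn_comp_flow hflow hι.smooth) x
  have hW := contDiffOn_time_inChart (G := fun τ x => reebVec s ι (F τ x))
    (contMDiffOn_comp_flow hflow hξ) x
  set y := extChartAt (𝓡 2) x x with hydef
  have hsymm : (extChartAt (𝓡 2) x).symm y = x := extChartAt_to_inv x
  have hV : ∀ z : Euc 2, derivWithin (fun τ => inChart x (fun x => ι (F τ x)) z) (Ico 0 t₀) t =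
      inChart x (flowVelocity s ι (F t) (α t)) z := fun _ =>
    derivWithin_embedding_flow hflow hι ht _
  have h1 := hasDerivWithinAt_time (f := fun τ => inChart x fun x => reebVec s ι (F τ x)) hW ht hy
  have h2 := (hasDerivWithinAt_fderiv_slice (f := fun τ => inChart x fun x => ι (F τ x)) hU ht₀
    hG ht hy).clm_apply
    (hasDerivWithinAt_const t (Ico 0 t₀) (stdVec j : Euc 2))
  have h3 := h1.inner ℝ h2
  have hfun : ∀ τ ∈ Ico 0 t₀, contactPullback s ι (F τ) x j =
      ⟪inChart x (fun x => reebVec s ι (F τ x)) y,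
        fderiv ℝ (inChart x fun x => ι (F τ x)) y (stdVec j)⟫_ℝ := by
    intro τ hτ
    rw [contactPullback, fderiv_inChart_self
      ((contMDiff_comp_embedding hι (contMDiff_slice hflow.smooth_F hτ)).mdifferentiable
        (by simp) x), inChart, hsymm]
  refine (h3.congr hfun (hfun t ht)).congr_deriv ?_
  have hvel : DifferentiableAt ℝ (inChart x (flowVelocity s ι (F t) (α t))) y := by
    have := ((contDiffOn_slice (f := fun τ z => derivWithin
      (fun τ => inChart x (fun x => ι (F τ x)) z) (Ico 0 t₀) τ) (contDiffOn_timeDeriv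
      (f := fun τ => inChart x fun x => ι (F τ x)) hU hG)
      ht).contDiffAt (hU.mem_nhds hy)).differentiableAt (by simp)
    exact this.congr_of_eventuallyEq (Filter.Eventually.of_forall fun z => (hV z).symm)
  have hreeb : DifferentiableAt ℝ (inChart x fun x => reebVec s ι (F t x)) y :=
    ((contDiffOn_slice (f := fun τ => inChart x fun x => reebVec s ι (F τ x)) hW ht).contDiffAt (hU.mem_nhds hy)).differentiableAt (by simp)
  have hangle : ∀ z : Euc 2, ⟪inChart x (fun x => reebVec s ι (F t x)) z,
      inChart x (flowVelocity s ι (F t) (α t)) z⟫_ℝ = -2 * inChart x (α t) z := fun _ =>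
    inner_reebVec_flowVelocity hflow hι ht _
  have hα : DifferentiableAt ℝ (inChart x (α t)) y :=
    ((contDiffOn_inChart (contMDiff_slice hflow.smooth_α ht) x).contDiffAt
      (hU.mem_nhds hy)).differentiableAt (by simp)
  -- The differential along the surface of ⟪ξ, V⟫ = -2α, used to eliminate ⟪ξ, ∂_jV⟫.
  have h4 := (hreeb.hasFDerivAt.inner ℝ hvel.hasFDerivAt).unique
    ((hα.hasFDerivAt.const_mul (-2)).congr_of_eventuallyEq (Filter.Eventually.of_forall hangle))
  have h5 := congrArg (fun l => l (stdVec j : Euc 2)) h4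
  simp only [ContinuousLinearMap.comp_apply, ContinuousLinearMap.prod_apply,
    fderivInnerCLM_apply, smul_apply, smul_eq_mul] at h5
  rw [show (fun z => derivWithin (fun τ => inChart x (fun x => ι (F τ x)) z) (Ico 0 t₀) t) =
    inChart x (flowVelocity s ι (F t) (α t)) from funext hV, map_zero, add_zero]
  have hdα : dirDeriv (α t) x (stdVec j : Euc 2) = fderiv ℝ (inChart x (α t)) y (stdVec j) :=
    dirDeriv_eq ((contMDiff_slice hflow.smooth_α ht).mdifferentiable (by simp) x) _
  have hcf := contactTwoForm_flow hflow hι ht x j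
  rw [contactTwoForm, hdα] at hcf
  have e1 : derivWithin (fun τ => inChart x (fun x => reebVec s ι (F τ x)) y) (Ico 0 t₀) t =
      diffMap 5 (reebVec s ι) (F t x)
        (meanCurvature 2 s.g (F t) x - (2 * α t x) • s.T (F t x)) := by
    have := derivWithin_comp_flow hflow hξ ht x
    rw [← this]
    simp only [inChart, hsymm]
  have e2 : fderiv ℝ (inChart x fun x => ι (F t x)) y (stdVec j) =
      diffMap 5 ι (F t x) (tangentVec (F t) x j) := by
    rw [diffMap_tangentVec hι hF, fderiv_inChart_self
      ((contMDiff_comp_embedding hι hF).mdifferentiable (by simp) x)]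
  have e3 : fderiv ℝ (inChart x fun x => reebVec s ι (F t x)) y (stdVec j) =
      diffMap 5 (reebVec s ι) (F t x) (tangentVec (F t) x j) := by
    rw [fderiv_inChart_self (G := fun x => reebVec s ι (F t x)) ((hξ.comp hF).mdifferentiable (by simp) x)]
    have h := mfderiv_comp x (hξ.mdifferentiable (by simp) (F t x))
      (hF.mdifferentiable (by simp) x)
    exact congrArg (fun l => l (stdVec j : Euc 2)) h
  have e4 : inChart x (flowVelocity s ι (F t) (α t)) y =
      diffMap 5 ι (F t x) (meanCurvature 2 s.g (F t) x - (2 * α t x) • s.T (F t x)) := by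
    rw [inChart, hsymm, ← derivWithin_embedding_flow hflow hι ht,
      derivWithin_comp_flow hflow hι.smooth ht]
  rw [e3, e4] at h5
  rw [e1, e2]
  linarith

theorem continuousOn_contactAnglePairing (hflow : IsLegendrianMCF s t₀ F α)
    (hι : IsIsometricEmbedding s.g ι) (ht₀ : 0 < t₀) (x : S) :
    ContinuousOn (fun τ => contactAnglePairing s ι (F τ) (α τ) x) (Ico 0 t₀) := by
  have hU := isOpen_extChartAt_target (I := 𝓡 2) x
  have hy := mem_extChartAt_target (I := 𝓡 2) x
  have hpath : ContinuousOn (fun τ : ℝ => (τ, extChartAt (𝓡 2) x x)) (Ico 0 t₀) := by fun_prop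
  have hmaps : MapsTo (fun τ : ℝ => (τ, extChartAt (𝓡 2) x x)) (Ico 0 t₀)
      (Ico 0 t₀ ×ˢ (extChartAt (𝓡 2) x).target) := fun _ hτ => ⟨hτ, hy⟩
  have hL : ContinuousOn (fun τ => eucDiff 2 (fun x => ι (F τ x)) x) (Ico 0 t₀) := by
    refine ((contDiffOn_fderiv_slice (f := fun τ => inChart x fun x => ι (F τ x)) hU
      (contDiffOn_time_inChart (G := fun τ x => ι (F τ x))
      (contMDiffOn_comp_flow hflow hι.smooth) x)).continuousOn.comp hpath hmaps).congr
      fun τ hτ => ?_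
    exact (fderiv_inChart_self ((contMDiff_comp_embedding hι
      (contMDiff_slice hflow.smooth_F hτ)).mdifferentiable (by simp) x)).symm
  have hα : ∀ l : Fin 2, ContinuousOn (fun τ => dirDeriv (α τ) x (stdVec l : Euc 2))
      (Ico 0 t₀) := by
    intro l
    refine (((contDiffOn_fderiv_slice (f := fun τ => inChart x (α τ)) hU (contDiffOn_time_inChart hflow.smooth_α
      x)).continuousOn.comp hpath hmaps).clm_apply (g := fun _ => (stdVec l : Euc 2))
      continuousOn_const).congr fun τ hτ => ?_
    exact dirDeriv_eq ((contMDiff_slice hflow.smooth_α hτ).mdifferentiable (by simp) x) _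
  have hθ : ∀ i : Fin 2, ContinuousOn (fun τ => contactPullback s ι (F τ) x i) (Ico 0 t₀) :=
    fun i τ hτ => (hasDerivWithinAt_contactPullback hflow hι ht₀ hτ x i).continuousWithinAt
  have hinv := continuousOn_gramOf_inv hL fun τ hτ => eucDiff_injective_of_flow hflow hι hτ x
  refine continuousOn_finsetSum _ fun i _ => continuousOn_finsetSum _ fun l _ => ?_
  exact (((continuous_apply_apply i l).comp_continuousOn hinv).mul (hα l)).mul (hθ i)

/-- The flow preserves the Legendrian condition. -/
theorem contactPullback_eq_zero (hflow : IsLegendrianMCF s t₀ F α)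
    (hι : IsIsometricEmbedding s.g ι) (ht₀ : 0 < t₀) {t : ℝ} (ht : t ∈ Ico 0 t₀) (x : S)
    (j : Fin 2) : contactPullback s ι (F t) x j = 0 := by
  have hsub : Icc 0 t ⊆ Ico 0 t₀ := fun τ hτ => ⟨hτ.1, hτ.2.trans_lt ht.2⟩
  -- The coefficient contains θ itself, but Gronwall's inequality needs only its boundedness on [0,
  -- t] along the given flow.
  obtain ⟨K, hK⟩ := isCompact_Icc.exists_bound_of_continuousOn
    ((continuousOn_contactAnglePairing hflow hι ht₀ x).mono hsub)
  have hd := fun τ (hτ : τ ∈ Ico 0 t₀) => hasDerivWithinAt_contactPullback hflow hι ht₀ hτ x j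
  have h0 : contactPullback s ι (F 0) x j = 0 := by
    have := hflow.legendrian x (stdVec j : Euc 2)
    rwa [eta_eq_inner hι, diffMap_mfderiv hι
      (contMDiff_slice hflow.smooth_F ⟨le_rfl, ht₀⟩)] at this
  have h := norm_le_gronwallBound_of_norm_deriv_right_le (δ := 0) (K := 2 * K) (ε := 0)
    (f := fun τ => contactPullback s ι (F τ) x j)
    (fun τ hτ => ((hd τ (hsub hτ)).mono hsub).continuousWithinAt)
    (fun τ hτ => (hd τ (hsub (Ico_subset_Icc_self hτ))).mono_of_mem_nhdsWithin
      (Filter.mem_of_superset (Ico_mem_nhdsGE (hτ.2.trans ht.2))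
        (Ico_subset_Ico_left hτ.1)))
    (by simp [h0]) (fun τ hτ => by
      have := hK τ (Ico_subset_Icc_self hτ)
      rw [norm_mul, norm_mul, norm_neg, Real.norm_ofNat, add_zero]
      gcongr) t ⟨ht.1, le_rfl⟩
  rw [gronwallBound_ε0_δ0] at h
  exact norm_le_zero_iff.1 h

theorem inner_reebVec_tangent (hflow : IsLegendrianMCF s t₀ F α)
    (hι : IsIsometricEmbedding s.g ι) (ht₀ : 0 < t₀) {t : ℝ} (ht : t ∈ Ico 0 t₀) (x : S)
    (v : Euc 2) : ⟪reebVec s ι (F t x), eucDiff 2 (fun x => ι (F t x)) x v⟫_ℝ = 0 := by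
  rw [← sum_smul_stdVec v, map_sum, inner_sum]
  refine Finset.sum_eq_zero fun j _ => ?_
  rw [map_smul, real_inner_smul_right]
  exact mul_eq_zero_of_right _ (contactPullback_eq_zero hflow hι ht₀ ht x j)

/-- H is normal by definition, and T is normal because the surface has stayed Legendrian. -/
theorem inner_flowVelocity_tangent (hflow : IsLegendrianMCF s t₀ F α)
    (hι : IsIsometricEmbedding s.g ι) (ht₀ : 0 < t₀) {t : ℝ} (ht : t ∈ Ico 0 t₀) (x : S)
    (v : Euc 2) :
    ⟪flowVelocity s ι (F t) (α t) x, eucDiff 2 (fun x => ι (F t x)) x v⟫_ℝ = 0 := by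
  rw [flowVelocity, inner_sub_left, real_inner_smul_left,
    inner_reebVec_tangent hflow hι ht₀ ht, mul_zero, sub_zero]
  exact inner_meanCurvature_tangent hι (contMDiff_slice hflow.smooth_F ht)
    (eucDiff_injective_of_flow hflow hι ht x) v

end LegendrianFlow

/-! ### The mean curvature vector in Euclidean space -/

section EuclideanMeanCurvature

variable {k N : ℕ}

/-- Paired with z, the projection is the metric trace of a bilinear form, which is independent of
the parametrization. -/
theorem tanProj_comp {L : Euc k →L[ℝ] Euc N} (hL : Function.Injective L)
    {A : Euc k →L[ℝ] Euc k} (hA : Function.Injective A) (w : Euc N) :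
    tanProj (L.comp A) w = tanProj L w := by
  refine ext_inner_right ℝ fun z => ?_
  rw [← metricTrace_inner_mul, ← metricTrace_inner_mul]
  refine metricTrace_comp (B := fun u v => ⟪w, L u⟫_ℝ * ⟪z, L v⟫_ℝ) hL hA ?_
  constructor <;> intros <;>
    simp only [map_add, map_smul, inner_add_right, real_inner_smul_right, smul_eq_mul] <;> ring

theorem inner_tanProj_of_normal {L : Euc k →L[ℝ] Euc N} {Z : Euc N} (hZ : ∀ v, ⟪L v, Z⟫_ℝ = 0)
    (w : Euc N) : ⟪tanProj L w, Z⟫_ℝ = 0 := by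
  simp only [tanProj, sum_inner, real_inner_smul_left, hZ, mul_zero, Finset.sum_const_zero]

/-- The difference a - b is itself an admissible normal test vector. Normal vectors can therefore be
compared through traces of scalar forms. -/
theorem eq_of_normal {L : Euc k →L[ℝ] Euc N} {a b : Euc N} (ha : ∀ v, ⟪a, L v⟫_ℝ = 0)
    (hb : ∀ v, ⟪b, L v⟫_ℝ = 0) (h : ∀ Z, (∀ v, ⟪L v, Z⟫_ℝ = 0) → ⟪a, Z⟫_ℝ = ⟪b, Z⟫_ℝ) : a = b := by
  rw [← sub_eq_zero, ← inner_self_eq_zero (𝕜 := ℝ), inner_sub_left]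
  rw [h (a - b) fun v => by rw [real_inner_comm, inner_sub_left, ha, hb, sub_zero], sub_self]

/-- The normal part of the trace, with respect to the metric induced by `L`, of the symmetric
vector-valued form `B`. -/
def normalTrace (L : Euc k →L[ℝ] Euc N) (B : Euc k →L[ℝ] Euc k →L[ℝ] Euc N) : Euc N :=
  (∑ i, ∑ j, (gramOf L)⁻¹ i j • B (stdVec i) (stdVec j)) -
    tanProj L (∑ i, ∑ j, (gramOf L)⁻¹ i j • B (stdVec i) (stdVec j))

theorem inner_normalTrace_tangent {L : Euc k →L[ℝ] Euc N} (hL : Function.Injective L)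
    (B : Euc k →L[ℝ] Euc k →L[ℝ] Euc N) (v : Euc k) : ⟪normalTrace L B, L v⟫_ℝ = 0 := by
  rw [normalTrace, inner_sub_left, inner_tanProj hL, sub_self]

theorem inner_normalTrace (L : Euc k →L[ℝ] Euc N) (B : Euc k →L[ℝ] Euc k →L[ℝ] Euc N)
    {Z : Euc N} (hZ : ∀ v, ⟪L v, Z⟫_ℝ = 0) :
    ⟪normalTrace L B, Z⟫_ℝ = metricTrace L fun u v => ⟪B u v, Z⟫_ℝ := by
  rw [normalTrace, inner_sub_left, inner_tanProj_of_normal hZ, sub_zero, metricTrace, sum_inner]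
  exact Finset.sum_congr rfl fun i _ => by simp only [sum_inner, real_inner_smul_left]

variable {S : Type*} [TopologicalSpace S] [ChartedSpace (Euc k) S]

/-- The mean curvature vector of an immersion into Euclidean space. -/
def eucMeanCurvature (k : ℕ) {S : Type*} [TopologicalSpace S] [ChartedSpace (Euc k) S]
    (G : S → Euc N) (x : S) : Euc N :=
  normalTrace (eucDiff k G x) (fderiv ℝ (fderiv ℝ (inChart x G)) (extChartAt (𝓡 k) x x))

theorem continuous_of_continuousOn_inChart {W : Type*} [TopologicalSpace W] {h : S → W}
    (hh : ∀ p : S, ContinuousOn (inChart p h) (extChartAt (𝓡 k) p).target) : Continuous h := by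
  refine continuous_iff_continuousAt.2 fun p => ?_
  have h1 : ContinuousOn (fun x => inChart p h (extChartAt (𝓡 k) p x))
      (extChartAt (𝓡 k) p).source :=
    (hh p).comp (continuousOn_extChartAt p) (extChartAt (𝓡 k) p).mapsTo
  refine ((h1.congr fun x hx => ?_).continuousAt (extChartAt_source_mem_nhds p))
  rw [inChart, (extChartAt (𝓡 k) p).left_inv hx]

variable [IsManifold (𝓡 k) ∞ S] {G : S → Euc N}

/-- The definition uses a different chart at every point; continuity and integration need one
formula valid throughout a fixed chart. Both sides are normal and have the same chart-independent
normal pairings. -/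
theorem eucMeanCurvature_eq_inChart (hG : ContMDiff (𝓡 k) 𝓘(ℝ, Euc N) ∞ G)
    (hinj : ∀ x, Function.Injective (eucDiff k G x)) (p : S) {y : Euc k}
    (hy : y ∈ (extChartAt (𝓡 k) p).target) :
    eucMeanCurvature k G ((extChartAt (𝓡 k) p).symm y) =
      normalTrace (fderiv ℝ (inChart p G) y) (fderiv ℝ (fderiv ℝ (inChart p G)) y) := by
  have hd := hG.mdifferentiable (by simp) ((extChartAt (𝓡 k) p).symm y)
  have hL := fderiv_inChart hy hd
  have hLi := fderiv_inChart_injective hy hd (hinj _)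
  refine (eq_of_normal (L := fderiv ℝ (inChart p G) y) (inner_normalTrace_tangent hLi _)
    (fun v => ?_) fun Z hZ => ?_).symm
  · rw [hL]
    exact inner_normalTrace_tangent (hinj _) _ _
  · have hsurj : Function.Surjective (chartSymmDeriv p y) :=
      LinearMap.surjective_of_injective (f := (chartSymmDeriv p y).toLinearMap)
        (chartSymmDeriv_injective hy)
    have hZ' : ∀ v, ⟪eucDiff k G ((extChartAt (𝓡 k) p).symm y) v, Z⟫_ℝ = 0 := by
      intro v
      obtain ⟨w, rfl⟩ := hsurj v
      have := hZ w
      rwa [hL] at this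
    rw [inner_normalTrace _ _ hZ, eucMeanCurvature, inner_normalTrace _ _ hZ']
    exact metricTrace_second_deriv_inChart hG hy rfl (hinj _) hZ'

theorem continuousOn_tanProj {X : Type*} [TopologicalSpace X] {L : X → Euc k →L[ℝ] Euc N}
    {w : X → Euc N} {A : Set X} (hL : ContinuousOn L A) (hw : ContinuousOn w A)
    (hinj : ∀ x ∈ A, Function.Injective (L x)) : ContinuousOn (fun x => tanProj (L x) (w x)) A := by
  have hinv := continuousOn_gramOf_inv hL hinj
  refine continuousOn_finsetSum _ fun i _ => continuousOn_finsetSum _ fun j _ => ?_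
  exact (((continuous_apply_apply i j).comp_continuousOn hinv).mul
    (hw.inner (𝕜 := ℝ) (hL.clm_apply continuousOn_const))).smul (hL.clm_apply continuousOn_const)

theorem continuousOn_normalTrace {X : Type*} [TopologicalSpace X] {L : X → Euc k →L[ℝ] Euc N}
    {B : X → Euc k →L[ℝ] Euc k →L[ℝ] Euc N} {A : Set X} (hL : ContinuousOn L A)
    (hB : ContinuousOn B A) (hinj : ∀ x ∈ A, Function.Injective (L x)) :
    ContinuousOn (fun x => normalTrace (L x) (B x)) A := by
  have hinv := continuousOn_gramOf_inv hL hinj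
  have h : ContinuousOn (fun x => ∑ i, ∑ j, (gramOf (L x))⁻¹ i j • B x (stdVec i) (stdVec j))
      A := by
    refine continuousOn_finsetSum _ fun i _ => continuousOn_finsetSum _ fun j _ => ?_
    exact ((continuous_apply_apply i j).comp_continuousOn hinv).smul
      ((hB.clm_apply continuousOn_const).clm_apply continuousOn_const)
  exact h.sub (continuousOn_tanProj hL h hinj)

theorem continuous_eucMeanCurvature (hG : ContMDiff (𝓡 k) 𝓘(ℝ, Euc N) ∞ G)
    (hinj : ∀ x, Function.Injective (eucDiff k G x)) : Continuous (eucMeanCurvature k G) := by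
  refine continuous_of_continuousOn_inChart (k := k) fun p => ?_
  refine (continuousOn_normalTrace (contDiffOn_fderiv_inChart hG p).continuousOn
    ((contDiffOn_fderiv_inChart hG p).fderiv_of_isOpen (m := ∞) (isOpen_extChartAt_target (I := 𝓡 k) p)
      (by simp)).continuousOn fun y hy => fderiv_inChart_injective hy
        (hG.mdifferentiable (by simp) _) (hinj _)).congr fun y hy => ?_
  exact eucMeanCurvature_eq_inChart hG hinj p hy

theorem tanProj_inChart (hG : ContMDiff (𝓡 k) 𝓘(ℝ, Euc N) ∞ G)
    (hinj : ∀ x, Function.Injective (eucDiff k G x)) {p : S} {y : Euc k}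
    (hy : y ∈ (extChartAt (𝓡 k) p).target) (w : Euc N) :
    tanProj (eucDiff k G ((extChartAt (𝓡 k) p).symm y)) w =
      tanProj (fderiv ℝ (inChart p G) y) w := by
  rw [fderiv_inChart hy (hG.mdifferentiable (by simp) _),
    tanProj_comp (hinj _) (chartSymmDeriv_injective hy)]

theorem continuous_tanProj (hG : ContMDiff (𝓡 k) 𝓘(ℝ, Euc N) ∞ G)
    (hinj : ∀ x, Function.Injective (eucDiff k G x)) {w : S → Euc N} (hw : Continuous w) :
    Continuous fun x => tanProj (eucDiff k G x) (w x) := by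
  refine continuous_of_continuousOn_inChart (k := k) fun p => ?_
  refine (continuousOn_tanProj (w := inChart p w) (contDiffOn_fderiv_inChart hG p).continuousOn
    (hw.comp_continuousOn (continuousOn_extChartAt_symm p))
    fun y hy => fderiv_inChart_injective hy
        (hG.mdifferentiable (by simp) _) (hinj _)).congr fun y hy => ?_
  exact tanProj_inChart hG hinj hy _

end EuclideanMeanCurvature

/-! ### Partitions of unity and extension by zero -/

section Localization

variable {k : ℕ} {S : Type*} [TopologicalSpace S]
  [ChartedSpace (Euc k) S]

/-- A finite smooth partition of unity subordinate to chart domains. -/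
theorem exists_finite_partition (k : ℕ) (S : Type*) [TopologicalSpace S] [ChartedSpace (Euc k) S]
    [IsManifold (𝓡 k) ∞ S] [CompactSpace S] [T2Space S] :
    ∃ (T : Finset S) (χ : S → S → ℝ), (∀ p, ContMDiff (𝓡 k) 𝓘(ℝ, ℝ) ∞ (χ p)) ∧
      (∀ p, tsupport (χ p) ⊆ (chartAt (Euc k) p).source) ∧ ∀ x, ∑ p ∈ T, χ p x = 1 := by
  obtain ⟨f, hf⟩ := SmoothPartitionOfUnity.exists_isSubordinate_chartAt_source (𝓡 k) S
  have hfin := f.locallyFinite.finite_nonempty_of_compact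
  refine ⟨hfin.toFinset, fun p => f p, fun p => (f p).contMDiff, hf, fun x => ?_⟩
  rw [← f.sum_eq_one (mem_univ x)]
  refine (finsum_eq_sum_of_support_subset _ fun p hp => ?_).symm
  rw [Finite.coe_toFinset]
  exact ⟨x, hp⟩

/-- The function `ψ` read in the chart at `p`, extended by zero. -/
def extendInChart (k : ℕ) {S : Type*} [TopologicalSpace S] [ChartedSpace (Euc k) S] (p : S) (ψ : S → ℝ) : Euc k → ℝ :=
  indicator (extChartAt (𝓡 k) p).target (inChart p ψ)

theorem extendInChart_eventuallyEq (p : S) (ψ : S → ℝ) {y : Euc k}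
    (hy : y ∈ (extChartAt (𝓡 k) p).target) : extendInChart k p ψ =ᶠ[nhds y] inChart p ψ :=
  Filter.eventuallyEq_of_mem ((isOpen_extChartAt_target (I := 𝓡 k) p).mem_nhds hy) fun _ hz =>
    indicator_of_mem hz _

variable [CompactSpace S]

/-- By compactness of `S` the topological support is compact, so its chart image is a compact subset
of the target; this makes extension by zero harmless. -/
theorem extendInChart_support {p : S} {ψ : S → ℝ} (hs : tsupport ψ ⊆ (chartAt (Euc k) p).source) :
    HasCompactSupport (extendInChart k p ψ) ∧
      tsupport (extendInChart k p ψ) ⊆ (extChartAt (𝓡 k) p).target := by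
  rw [← extChartAt_source (𝓡 k)] at hs
  have hK : IsCompact (extChartAt (𝓡 k) p '' tsupport ψ) :=
    (isClosed_tsupport ψ).isCompact.image_of_continuousOn ((continuousOn_extChartAt p).mono hs)
  have hsub : Function.support (extendInChart k p ψ) ⊆ extChartAt (𝓡 k) p '' tsupport ψ := by
    intro y hy
    have hyt : y ∈ (extChartAt (𝓡 k) p).target := mem_of_indicator_ne_zero hy
    rw [Function.mem_support, extendInChart, indicator_of_mem hyt] at hy
    exact ⟨_, subset_tsupport ψ hy, (extChartAt (𝓡 k) p).right_inv hyt⟩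
  refine ⟨HasCompactSupport.of_support_subset_isCompact hK hsub, ?_⟩
  refine (closure_minimal hsub hK.isClosed).trans ?_
  rintro _ ⟨x, hx, rfl⟩
  exact (extChartAt (𝓡 k) p).map_source (hs hx)

theorem contDiff_extendInChart [T2Space S] [IsManifold (𝓡 k) ∞ S] {p : S} {ψ : S → ℝ} (hψ : ContMDiff (𝓡 k) 𝓘(ℝ, ℝ) ∞ ψ)
    (hs : tsupport ψ ⊆ (chartAt (Euc k) p).source) : ContDiff ℝ ∞ (extendInChart k p ψ) := by
  refine contDiff_of_contDiffAt_tsupport fun y hy => ?_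
  have hyt := (extendInChart_support hs).2 hy
  exact ((contDiffOn_inChart hψ p).contDiffAt ((isOpen_extChartAt_target (I := 𝓡 k) p).mem_nhds
    hyt)).congr_of_eventuallyEq (extendInChart_eventuallyEq p ψ hyt)

end Localization

/-! ### The divergence theorem on the closed surface -/

section WeightedDivergence

variable {N : ℕ} {S : Type*} [TopologicalSpace S] [ChartedSpace (Euc 2) S]

/-- The divergence on the surface of `ψ` times the tangential part of `G - y₀`. -/
def weightedDivergence (G : S → Euc N) (y₀ : Euc N) (ψ : S → ℝ) (x : S) : ℝ :=
  2 * ψ x + metricTrace (eucDiff 2 G x)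
      (fun u v => dirDeriv ψ x (u : Euc 2) * ⟪G x - y₀, eucDiff 2 G x v⟫_ℝ)
    + ψ x * ⟪eucMeanCurvature 2 G x, G x - y₀ - tanProj (eucDiff 2 G x) (G x - y₀)⟫_ℝ

variable {G : S → Euc N} {y₀ : Euc N}

theorem weightedDivergence_of_eventuallyEq_zero {ψ : S → ℝ} {x : S} (h : ψ =ᶠ[nhds x] 0) :
    weightedDivergence G y₀ ψ x = 0 := by
  have h1 : ∀ u : Euc 2, dirDeriv ψ x u = 0 := by
    intro u
    have h2 : mfderiv (𝓡 2) 𝓘(ℝ, ℝ) ψ x = mfderiv (𝓡 2) 𝓘(ℝ, ℝ) (fun _ : S => (0 : ℝ)) x :=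
      h.mfderiv_eq
    rw [mfderiv_const] at h2
    exact congrArg (fun l => l u) h2
  have h0 : ψ x = 0 := h.self_of_nhds
  simp only [weightedDivergence, h1, h0, metricTrace, zero_mul, mul_zero, Finset.sum_const_zero,
    add_zero]

variable [IsManifold (𝓡 2) ∞ S]

/-- Additivity in ψ lets a partition of unity reduce the global divergence theorem to weights
supported in one chart. -/
theorem weightedDivergence_sum {T : Finset S} {φ : S → S → ℝ}
    (hφ : ∀ p, ContMDiff (𝓡 2) 𝓘(ℝ, ℝ) ∞ (φ p)) (x : S) :
    weightedDivergence G y₀ (fun x => ∑ p ∈ T, φ p x) x =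
      ∑ p ∈ T, weightedDivergence G y₀ (φ p) x := by
  have hs : ContMDiff (𝓡 2) 𝓘(ℝ, ℝ) ∞ fun x => ∑ p ∈ T, φ p x :=
    contMDiff_finsetSum fun p _ => hφ p
  have hd : ∀ u : Euc 2, dirDeriv (fun x => ∑ p ∈ T, φ p x) x u =
      ∑ p ∈ T, dirDeriv (φ p) x u := by
    intro u
    rw [dirDeriv_eq (hs.mdifferentiable (by simp) x)]
    have h1 : fderiv ℝ (inChart x fun x => ∑ p ∈ T, φ p x) (extChartAt (𝓡 2) x x) =
        ∑ p ∈ T, fderiv ℝ (inChart x (φ p)) (extChartAt (𝓡 2) x x) :=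
      fderiv_fun_sum fun p _ => ((contDiffOn_inChart (hφ p) x).contDiffAt
        ((isOpen_extChartAt_target (I := 𝓡 2) x).mem_nhds (mem_extChartAt_target x))).differentiableAt
          (by simp)
    rw [h1, sum_apply]
    exact Finset.sum_congr rfl fun p _ => (dirDeriv_eq ((hφ p).mdifferentiable (by simp) x) u).symm
  simp only [weightedDivergence, hd, metricTrace, Finset.sum_add_distrib, Finset.mul_sum,
    Finset.sum_mul]
  congr 2
  rw [Finset.sum_comm]
  conv_rhs => rw [Finset.sum_comm]
  rw [Finset.sum_comm]
  refine Finset.sum_congr rfl fun i _ => ?_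
  rw [Finset.sum_comm]

theorem metricTrace_dirDeriv_inChart (hG : ContMDiff (𝓡 2) 𝓘(ℝ, Euc N) ∞ G)
    (hinj : ∀ x, Function.Injective (eucDiff 2 G x)) {ψ : S → ℝ}
    (hψ : ContMDiff (𝓡 2) 𝓘(ℝ, ℝ) ∞ ψ) {p : S} {y : Euc 2}
    (hy : y ∈ (extChartAt (𝓡 2) p).target) (w : Euc N) :
    metricTrace (eucDiff 2 G ((extChartAt (𝓡 2) p).symm y))
        (fun u v => dirDeriv ψ ((extChartAt (𝓡 2) p).symm y) (u : Euc 2) *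
          ⟪w, eucDiff 2 G ((extChartAt (𝓡 2) p).symm y) v⟫_ℝ) =
      metricTrace (fderiv ℝ (inChart p G) y)
        (fun u v => fderiv ℝ (inChart p ψ) y u * ⟪w, fderiv ℝ (inChart p G) y v⟫_ℝ) := by
  have hψd := hψ.mdifferentiable (by simp) ((extChartAt (𝓡 2) p).symm y)
  rw [fderiv_inChart hy (hG.mdifferentiable (by simp) _)]
  set x := (extChartAt (𝓡 2) p).symm y with hx
  have h1 : ∀ u, fderiv ℝ (inChart p ψ) y u =
      dirDeriv ψ x (chartSymmDeriv p y u : Euc 2) := fun u => fderiv_inChart_eq hy hψd u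
  simp only [h1]
  refine (metricTrace_comp (B := fun u v => dirDeriv ψ x (u : Euc 2) * ⟪w, eucDiff 2 G x v⟫_ℝ)
    (hinj x) (chartSymmDeriv_injective hy) ?_).symm
  have hadd : ∀ u v : Euc 2, dirDeriv ψ x (u + v : Euc 2) = dirDeriv ψ x u + dirDeriv ψ x v :=
    fun u v => map_add (mfderiv (𝓡 2) 𝓘(ℝ, ℝ) ψ x) u v
  have hsmul : ∀ (c : ℝ) (v : Euc 2), dirDeriv ψ x (c • v : Euc 2) = c * dirDeriv ψ x v :=
    fun c v => map_smul (mfderiv (𝓡 2) 𝓘(ℝ, ℝ) ψ x) c v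
  constructor <;> intros <;>
    simp only [map_add, map_smul, inner_add_right, real_inner_smul_right, smul_eq_mul, hadd,
      hsmul] <;> ring

theorem weightedDivergence_inChart (hG : ContMDiff (𝓡 2) 𝓘(ℝ, Euc N) ∞ G)
    (hinj : ∀ x, Function.Injective (eucDiff 2 G x)) {ψ : S → ℝ}
    (hψ : ContMDiff (𝓡 2) 𝓘(ℝ, ℝ) ∞ ψ) {p : S} {y : Euc 2}
    (hy : y ∈ (extChartAt (𝓡 2) p).target) :
    inChart p (weightedDivergence G y₀ ψ) y = 2 * inChart p ψ y
      + metricTrace (fderiv ℝ (inChart p G) y)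
          (fun u v => fderiv ℝ (inChart p ψ) y u *
            ⟪inChart p G y - y₀, fderiv ℝ (inChart p G) y v⟫_ℝ)
      + inChart p ψ y * metricTrace (fderiv ℝ (inChart p G) y)
          (fun u v => ⟪fderiv ℝ (fderiv ℝ (inChart p G)) y u v, inChart p G y - y₀ -
            tanProj (fderiv ℝ (inChart p G) y) (inChart p G y - y₀)⟫_ℝ) := by
  have hLi := fderiv_inChart_injective hy (hG.mdifferentiable (by simp) _) (hinj _)
  rw [inChart, weightedDivergence, metricTrace_dirDeriv_inChart hG hinj hψ hy,
    eucMeanCurvature_eq_inChart hG hinj p hy, tanProj_inChart hG hinj hy, inner_normalTrace]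
  · rfl
  · intro v
    rw [real_inner_comm, inner_sub_left, inner_tanProj hLi, sub_self]

theorem continuous_weightedDivergence (hG : ContMDiff (𝓡 2) 𝓘(ℝ, Euc N) ∞ G)
    (hinj : ∀ x, Function.Injective (eucDiff 2 G x)) {ψ : S → ℝ}
    (hψ : ContMDiff (𝓡 2) 𝓘(ℝ, ℝ) ∞ ψ) : Continuous (weightedDivergence G y₀ ψ) := by
  have hX : Continuous fun x => G x - y₀ := hG.continuous.sub continuous_const
  refine ((continuous_const.mul hψ.continuous).add ?_).add (hψ.continuous.mul
    ((continuous_eucMeanCurvature hG hinj).inner (hX.sub (continuous_tanProj hG hinj hX))))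
  refine continuous_of_continuousOn_inChart (k := 2) fun p => ?_
  have hL := (contDiffOn_fderiv_inChart hG p).continuousOn
  have hinv := continuousOn_gramOf_inv hL fun y hy =>
    fderiv_inChart_injective hy (hG.mdifferentiable (by simp) _) (hinj _)
  have hd : ContinuousOn (fderiv ℝ (inChart p ψ)) (extChartAt (𝓡 2) p).target :=
    ((contDiffOn_inChart hψ p).fderiv_of_isOpen (m := ∞) (isOpen_extChartAt_target p)
      (by simp)).continuousOn
  have hXc : ContinuousOn (fun y => inChart p G y - y₀) (extChartAt (𝓡 2) p).target :=
    hX.comp_continuousOn (continuousOn_extChartAt_symm p)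
  refine ContinuousOn.congr (f := fun y => metricTrace (fderiv ℝ (inChart p G) y)
          (fun u v => fderiv ℝ (inChart p ψ) y u *
            ⟪inChart p G y - y₀, fderiv ℝ (inChart p G) y v⟫_ℝ)) ?_
    fun y hy => metricTrace_dirDeriv_inChart hG hinj hψ hy _
  refine continuousOn_finsetSum _ fun i _ => continuousOn_finsetSum _ fun j _ => ?_
  exact ((continuous_apply_apply i j).comp_continuousOn hinv).mul
    ((hd.clm_apply continuousOn_const).mul
      (hXc.inner (𝕜 := ℝ) (hL.clm_apply continuousOn_const)))

variable [CompactSpace S] [MeasurableSpace S] [BorelSpace S]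

theorem integrable_areaMeasure (hG : ContMDiff (𝓡 2) 𝓘(ℝ, Euc N) ∞ G) {h : S → ℝ}
    (hh : Continuous h) : Integrable h (areaMeasure 2 G) := by
  have := isFiniteMeasure_areaMeasure hG
  exact hh.integrable_of_hasCompactSupport (HasCompactSupport.of_compactSpace h)

variable [T2Space S]

theorem integral_weightedDivergence_of_support (hG : ContMDiff (𝓡 2) 𝓘(ℝ, Euc N) ∞ G)
    (hinj : ∀ x, Function.Injective (eucDiff 2 G x)) {p : S} {ψ : S → ℝ}
    (hψ : ContMDiff (𝓡 2) 𝓘(ℝ, ℝ) ∞ ψ) (hs : tsupport ψ ⊆ (chartAt (Euc 2) p).source) :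
    ∫ x, weightedDivergence G y₀ ψ x ∂areaMeasure 2 G = 0 := by
  rw [integral_areaMeasure_of_support hG p (continuous_weightedDivergence hG hinj hψ) fun x hx =>
    weightedDivergence_of_eventuallyEq_zero
      (notMem_tsupport_iff_eventuallyEq.1 fun h => hx (hs h))]
  -- The zero on the right is replaced by the planar divergence identity, after which the integrands
  -- agree on the chart target.
  rw [← integral_sqrt_det_mul_divergence (X := fun y => inChart p G y - y₀)
    (isOpen_extChartAt_target (I := 𝓡 2) p) (contDiffOn_inChart hG p) (fun y => rfl)
    (contDiff_extendInChart hψ hs) (extendInChart_support hs).1 (extendInChart_support hs).2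
    fun y hy => fderiv_inChart_injective hy (hG.mdifferentiable (by simp) _) (hinj _)]
  refine setIntegral_congr_fun (isOpen_extChartAt_target (I := 𝓡 2) p).measurableSet
    fun y hy => ?_
  have he := extendInChart_eventuallyEq p ψ hy
  simp only [weightedDivergence_inChart hG hinj hψ hy, he.fderiv_eq, he.self_of_nhds, areaDensity]

/-- The divergence theorem on a compact immersed surface. -/
theorem integral_weightedDivergence (hG : ContMDiff (𝓡 2) 𝓘(ℝ, Euc N) ∞ G)
    (hinj : ∀ x, Function.Injective (eucDiff 2 G x)) {ψ : S → ℝ}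
    (hψ : ContMDiff (𝓡 2) 𝓘(ℝ, ℝ) ∞ ψ) :
    ∫ x, weightedDivergence G y₀ ψ x ∂areaMeasure 2 G = 0 := by
  obtain ⟨T, χ, hχ, hs, hsum⟩ := exists_finite_partition 2 S
  have hφ : ∀ p, ContMDiff (𝓡 2) 𝓘(ℝ, ℝ) ∞ fun x => χ p x * ψ x := fun p => (hχ p).mul hψ
  have hψ' : ψ = fun x => ∑ p ∈ T, χ p x * ψ x := by
    funext x
    rw [← Finset.sum_mul, hsum, one_mul]
  rw [hψ']
  simp only [weightedDivergence_sum hφ]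
  rw [integral_finsetSum _ fun p _ =>
    integrable_areaMeasure hG (continuous_weightedDivergence hG hinj (hφ p))]
  exact Finset.sum_eq_zero fun p _ => integral_weightedDivergence_of_support hG hinj (hφ p)
    ((tsupport_mul_subset_left).trans (hs p))

end WeightedDivergence

/-! ### The backward heat kernel -/

section HeatKernel

theorem metricTrace_const_mul {k : ℕ} {V : Type*} [NormedAddCommGroup V] [InnerProductSpace ℝ V]
    (L : Euc k →L[ℝ] V) (c : ℝ) (B : Euc k → Euc k → ℝ) :
    metricTrace L (fun u v => c * B u v) = c * metricTrace L B := by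
  simp only [metricTrace, Finset.mul_sum]
  exact Finset.sum_congr rfl fun i _ => Finset.sum_congr rfl fun j _ => mul_left_comm _ _ _

/-- The algebra of the monotonicity formula: X is the position, T its tangential part (not the Reeb
field), v the normal velocity, H the Euclidean mean curvature and r the remaining time. The terms
1/r and |T|²/(4r²) cancel, and what is left factors. -/
theorem inner_add_smul_normal {V : Type*} [NormedAddCommGroup V] [InnerProductSpace ℝ V]
    {X T v H : V} {r : ℝ} (hr : r ≠ 0) (ρ : ℝ) (hv : ⟪T, v⟫_ℝ = 0) (hT : ⟪T, X - T⟫_ℝ = 0) :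
    ρ * (1 / r - ‖X‖ ^ 2 / (4 * r ^ 2) - ⟪X, v⟫_ℝ / (2 * r) - ⟪H, v⟫_ℝ) -
        1 / (2 * r) * (ρ * (2 - ⟪T, X⟫_ℝ / (2 * r) + ⟪H, X - T⟫_ℝ)) =
      -(ρ * ⟪v + (1 / (2 * r)) • (X - T), H + (1 / (2 * r)) • (X - T)⟫_ℝ) := by
  have hX : ‖X‖ ^ 2 = ⟪X - T, X - T⟫_ℝ + ⟪T, X⟫_ℝ := by
    rw [inner_sub_left X T (X - T), hT, inner_sub_right, real_inner_comm T X,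
      real_inner_self_eq_norm_sq]
    ring
  have hXv : ⟪X, v⟫_ℝ = ⟪v, X - T⟫_ℝ := by
    rw [inner_sub_right, real_inner_comm T v, hv, real_inner_comm, sub_zero]
  rw [hX, hXv, inner_add_left, inner_add_right, inner_add_right, real_inner_smul_left,
    real_inner_smul_left, real_inner_smul_right, real_inner_smul_right, real_inner_comm v H,
    real_inner_comm (X - T) H]
  field_simp
  ring

variable {N : ℕ} {y₀ : Euc N} {t₀ : ℝ}

theorem backwardHeatKernel_two (z : Euc N) (τ : ℝ) : backwardHeatKernel 2 y₀ t₀ z τ =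
    1 / (4 * Real.pi * (t₀ - τ)) * Real.exp (-‖z - y₀‖ ^ 2 / (4 * (t₀ - τ))) := by
  rw [backwardHeatKernel, Nat.cast_ofNat, div_self two_ne_zero, Real.rpow_one]

theorem backwardHeatKernel_nonneg (z : Euc N) {τ : ℝ} (hτ : τ < t₀) :
    0 ≤ backwardHeatKernel 2 y₀ t₀ z τ := by
  have : 0 < t₀ - τ := sub_pos.2 hτ
  rw [backwardHeatKernel_two]
  positivity

theorem backwardHeatKernel_le (z : Euc N) {τ : ℝ} (hτ : τ < t₀) :
    backwardHeatKernel 2 y₀ t₀ z τ ≤ 1 / (4 * Real.pi * (t₀ - τ)) := by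
  have h : 0 < t₀ - τ := sub_pos.2 hτ
  rw [backwardHeatKernel_two]
  refine mul_le_of_le_one_right (by positivity) (Real.exp_le_one_iff.2 ?_)
  rw [neg_div, neg_nonpos]
  positivity

theorem contDiffOn_backwardHeatKernel {E : Type*} [NormedAddCommGroup E] [NormedSpace ℝ E]
    {τ : E → ℝ} {z : E → Euc N} {A : Set E} (hτ : ContDiffOn ℝ ∞ τ A) (hz : ContDiffOn ℝ ∞ z A)
    (hlt : ∀ q ∈ A, τ q < t₀) :
    ContDiffOn ℝ ∞ (fun q => backwardHeatKernel 2 y₀ t₀ (z q) (τ q)) A := by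
  simp only [backwardHeatKernel_two]
  have h : ContDiffOn ℝ ∞ (fun q => t₀ - τ q) A := contDiffOn_const.sub hτ
  have h0 : ∀ q ∈ A, t₀ - τ q ≠ 0 := fun q hq => (sub_pos.2 (hlt q hq)).ne'
  refine (contDiffOn_const.div (contDiffOn_const.mul h) fun q hq =>
    mul_ne_zero (by positivity) (h0 q hq)).mul (ContDiffOn.exp ?_)
  exact (((hz.sub contDiffOn_const).norm_sq ℝ).neg).div (contDiffOn_const.mul h) fun q hq =>
    mul_ne_zero (by norm_num) (h0 q hq)

theorem hasDerivWithinAt_backwardHeatKernel {z : ℝ → Euc N} {V : Euc N} {A : Set ℝ} {t : ℝ}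
    (hz : HasDerivWithinAt z V A t) (ht : t < t₀) :
    HasDerivWithinAt (fun τ => backwardHeatKernel 2 y₀ t₀ (z τ) τ)
      (backwardHeatKernel 2 y₀ t₀ (z t) t * (1 / (t₀ - t) - ‖z t - y₀‖ ^ 2 / (4 * (t₀ - t) ^ 2) -
        ⟪z t - y₀, V⟫_ℝ / (2 * (t₀ - t)))) A t := by
  have h0 : t₀ - t ≠ 0 := (sub_pos.2 ht).ne'
  simp only [backwardHeatKernel_two]
  have h1 : HasDerivWithinAt (fun τ => t₀ - τ) (-1) A t := (hasDerivWithinAt_id t A).const_sub t₀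
  have h2 := (hasDerivWithinAt_const t A (1 : ℝ)).div (h1.const_mul (4 * Real.pi))
    (mul_ne_zero (by positivity) h0)
  have h3 := (((hz.sub_const y₀).norm_sq).neg.div (h1.const_mul 4)
    (mul_ne_zero (by norm_num) h0)).exp
  refine (h2.mul h3).congr_deriv ?_
  have hpi := Real.pi_ne_zero
  simp only [Pi.div_apply, Pi.neg_apply]
  field_simp
  ring

theorem fderiv_backwardHeatKernel {k : ℕ} {z : Euc k → Euc N} {L : Euc k →L[ℝ] Euc N}
    {y : Euc k} (hz : HasFDerivAt z L y) (t : ℝ) (u : Euc k) :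
    fderiv ℝ (fun y => backwardHeatKernel 2 y₀ t₀ (z y) t) y u =
      -(backwardHeatKernel 2 y₀ t₀ (z y) t / (2 * (t₀ - t))) * ⟪z y - y₀, L u⟫_ℝ := by
  simp only [backwardHeatKernel_two]
  have h1 := (((hz.sub_const y₀).norm_sq).neg.mul_const (4 * (t₀ - t))⁻¹).exp.const_mul
    (1 / (4 * Real.pi * (t₀ - t)))
  simp only [← div_eq_mul_inv] at h1
  refine (congrArg (fun l => l u) h1.fderiv).trans ?_
  simp only [smul_apply, neg_apply, ContinuousLinearMap.comp_apply, innerSL_apply_apply,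
    smul_eq_mul, Pi.neg_apply, nsmul_eq_mul, Nat.cast_ofNat]
  field_simp
  ring

end HeatKernel

/-! ### Derivative of the Gaussian-weighted area -/

section FirstVariation

variable {N : ℕ} {S : Type*} [TopologicalSpace S] [ChartedSpace (Euc 2) S]
  {y₀ : Euc N} {t₀ : ℝ}

theorem contMDiff_backwardHeatKernel {G : S → Euc N} (hG : ContMDiff (𝓡 2) 𝓘(ℝ, Euc N) ∞ G)
    {t : ℝ} (ht : t < t₀) :
    ContMDiff (𝓡 2) 𝓘(ℝ, ℝ) ∞ fun x => backwardHeatKernel 2 y₀ t₀ (G x) t := by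
  have h : ContDiff ℝ ∞ fun z : Euc N => backwardHeatKernel 2 y₀ t₀ z t :=
    contDiffOn_univ.1 (contDiffOn_backwardHeatKernel contDiffOn_const contDiffOn_id fun _ _ => ht)
  exact h.contMDiff.comp hG

variable [IsManifold (𝓡 2) ∞ S]

/-- The gradient of the kernel along the surface is -ρX^T/(2r), so its pairing with X is a multiple
of |X^T|². -/
theorem weightedDivergence_backwardHeatKernel {G : S → Euc N}
    (hG : ContMDiff (𝓡 2) 𝓘(ℝ, Euc N) ∞ G) {t : ℝ} (ht : t < t₀) (x : S) :
    weightedDivergence G y₀ (fun x => backwardHeatKernel 2 y₀ t₀ (G x) t) x =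
      backwardHeatKernel 2 y₀ t₀ (G x) t *
        (2 - ⟪tanProj (eucDiff 2 G x) (G x - y₀), G x - y₀⟫_ℝ / (2 * (t₀ - t)) +
          ⟪eucMeanCurvature 2 G x, G x - y₀ - tanProj (eucDiff 2 G x) (G x - y₀)⟫_ℝ) := by
  have hd : ∀ u : Euc 2, dirDeriv (fun x => backwardHeatKernel 2 y₀ t₀ (G x) t) x u =
      -(backwardHeatKernel 2 y₀ t₀ (G x) t / (2 * (t₀ - t))) * ⟪G x - y₀, eucDiff 2 G x u⟫_ℝ := by
    intro u
    rw [dirDeriv_eq ((contMDiff_backwardHeatKernel hG ht).mdifferentiable (by simp) x),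
      ← fderiv_inChart_self (hG.mdifferentiable (by simp) x)]
    have hz : HasFDerivAt (inChart x G) (fderiv ℝ (inChart x G) (extChartAt (𝓡 2) x x))
        (extChartAt (𝓡 2) x x) :=
      (((contDiffOn_inChart hG x).contDiffAt ((isOpen_extChartAt_target (I := 𝓡 2) x).mem_nhds
        (mem_extChartAt_target x))).differentiableAt (by simp)).hasFDerivAt
    have h := fderiv_backwardHeatKernel (y₀ := y₀) (t₀ := t₀) hz t u
    have hx : inChart x G (extChartAt (𝓡 2) x x) = G x := congrArg G (extChartAt_to_inv x)
    rw [hx] at h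
    exact h
  rw [weightedDivergence, ← metricTrace_inner_mul]
  have hB : (fun u v => dirDeriv (fun x => backwardHeatKernel 2 y₀ t₀ (G x) t) x (u : Euc 2) *
      ⟪G x - y₀, eucDiff 2 G x v⟫_ℝ) = fun u v =>
      -(backwardHeatKernel 2 y₀ t₀ (G x) t / (2 * (t₀ - t))) *
        (⟪G x - y₀, eucDiff 2 G x u⟫_ℝ * ⟪G x - y₀, eucDiff 2 G x v⟫_ℝ) := by
    funext u v
    rw [hd, mul_assoc]
  rw [hB, metricTrace_const_mul]
  ring

variable {G : ℝ → S → Euc N}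

theorem contDiffOn_areaDensity_time
    (hG : ContMDiffOn (𝓘(ℝ, ℝ).prod (𝓡 2)) 𝓘(ℝ, Euc N) ∞ (fun p : ℝ × S => G p.1 p.2)
      (Ico 0 t₀ ×ˢ univ)) (hinj : ∀ t ∈ Ico 0 t₀, ∀ x, Function.Injective (eucDiff 2 (G t) x))
    (p : S) : ContDiffOn ℝ ∞ (fun q : ℝ × Euc 2 => areaDensity (G q.1) p q.2)
      (Ico 0 t₀ ×ˢ (extChartAt (𝓡 2) p).target) := by
  have h := contDiffOn_fderiv_slice (f := fun τ => inChart p (G τ))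
    (isOpen_extChartAt_target (I := 𝓡 2) p) (contDiffOn_time_inChart hG p)
  have hdet : ContDiff ℝ ∞ fun L : Euc 2 →L[ℝ] Euc N => (gramOf L).det := by
    have h : ∀ v : Euc 2, ContDiff ℝ ∞ fun L : Euc 2 →L[ℝ] Euc N => L v := fun v => by fun_prop
    simp only [gramOf_det_two]
    exact (((h _).inner ℝ (h _)).mul ((h _).inner ℝ (h _))).sub (((h _).inner ℝ (h _)).pow 2)
  refine ContDiffOn.sqrt (hdet.comp_contDiffOn h) fun q hq => ?_
  exact (gramOf_det_pos (fderiv_inChart_injective hq.2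
    ((contMDiff_slice hG hq.1).mdifferentiable (by simp) _) (hinj _ hq.1 _))).ne'

theorem continuous_timeDeriv
    (hG : ContMDiffOn (𝓘(ℝ, ℝ).prod (𝓡 2)) 𝓘(ℝ, Euc N) ∞ (fun p : ℝ × S => G p.1 p.2)
      (Ico 0 t₀ ×ˢ univ)) {t : ℝ} (ht : t ∈ Ico 0 t₀) :
    Continuous fun x => derivWithin (fun τ => G τ x) (Ico 0 t₀) t := by
  refine continuous_of_continuousOn_inChart (k := 2) fun p => ?_
  exact (contDiffOn_slice (f := fun τ y => derivWithin (fun τ => inChart p (G τ) y) (Ico 0 t₀) τ)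
    (contDiffOn_timeDeriv (f := fun τ => inChart p (G τ)) (isOpen_extChartAt_target (I := 𝓡 2) p)
      (contDiffOn_time_inChart hG p)) ht).continuousOn

/-- The time derivative of the heat kernel density of a normal variation, before integration by
parts. -/
def kernelVariation (y₀ : Euc N) (t₀ t : ℝ) (G V : S → Euc N) (x : S) : ℝ :=
  backwardHeatKernel 2 y₀ t₀ (G x) t *
    (1 / (t₀ - t) - ‖G x - y₀‖ ^ 2 / (4 * (t₀ - t) ^ 2) - ⟪G x - y₀, V x⟫_ℝ / (2 * (t₀ - t))
      - ⟪eucMeanCurvature 2 G x, V x⟫_ℝ)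

theorem continuous_kernelVariation {G V : S → Euc N} (hG : ContMDiff (𝓡 2) 𝓘(ℝ, Euc N) ∞ G)
    (hinj : ∀ x, Function.Injective (eucDiff 2 G x)) (hV : Continuous V) {t : ℝ} (ht : t < t₀) :
    Continuous (kernelVariation y₀ t₀ t G V) := by
  have hX : Continuous fun x => G x - y₀ := hG.continuous.sub continuous_const
  exact (contMDiff_backwardHeatKernel hG ht).continuous.mul (((continuous_const.sub
    ((hX.norm.pow 2).div_const _)).sub ((hX.inner hV).div_const _)).sub
      ((continuous_eucMeanCurvature hG hinj).inner hV))

/-- Product rule for kernel and area density; the normal trace of the second derivative is the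
Euclidean mean curvature in this chart. -/
theorem hasDerivWithinAt_kernel_mul_area (ht₀ : 0 < t₀)
    (hG : ContMDiffOn (𝓘(ℝ, ℝ).prod (𝓡 2)) 𝓘(ℝ, Euc N) ∞ (fun p : ℝ × S => G p.1 p.2)
      (Ico 0 t₀ ×ˢ univ)) (hinj : ∀ t ∈ Ico 0 t₀, ∀ x, Function.Injective (eucDiff 2 (G t) x))
    {t : ℝ} (ht : t ∈ Ico 0 t₀)
    (hV : ∀ x v, ⟪derivWithin (fun τ => G τ x) (Ico 0 t₀) t, eucDiff 2 (G t) x v⟫_ℝ = 0)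
    (p : S) {y : Euc 2} (hy : y ∈ (extChartAt (𝓡 2) p).target) :
    HasDerivWithinAt (fun τ => inChart p (fun x => backwardHeatKernel 2 y₀ t₀ (G τ x) τ) y *
        areaDensity (G τ) p y)
      (inChart p (kernelVariation y₀ t₀ t (G t) fun x =>
        derivWithin (fun τ => G τ x) (Ico 0 t₀) t) y * areaDensity (G t) p y) (Ico 0 t₀) t := by
  have hGt := contMDiff_slice hG ht
  have hU := isOpen_extChartAt_target (I := 𝓡 2) p
  have hf := contDiffOn_time_inChart hG p
  have hd : ∀ z, MDifferentiableAt (𝓡 2) 𝓘(ℝ, Euc N) (G t) z := hGt.mdifferentiable (by simp)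
  have h1 := hasDerivWithinAt_backwardHeatKernel (y₀ := y₀) (t₀ := t₀)
    (hasDerivWithinAt_time (f := fun τ => inChart p (G τ)) hf ht hy) ht.2
  have h2 := hasDerivWithinAt_area_of_normal ht₀ hU (f := fun τ => inChart p (G τ)) hf ht hy
    (fderiv_inChart_injective hy (hd _) (hinj t ht _)) fun z hz v => by
      rw [fderiv_inChart hz (hd _)]
      exact hV _ _
  refine (h1.mul h2).congr_deriv ?_
  have hn : ∀ v, ⟪fderiv ℝ (inChart p (G t)) y v,
      derivWithin (fun τ => inChart p (G τ) y) (Ico 0 t₀) t⟫_ℝ = 0 := by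
    intro v
    rw [fderiv_inChart hy (hd _), real_inner_comm]
    exact hV _ _
  have hH := eucMeanCurvature_eq_inChart hGt (hinj t ht) p hy
  simp only [inChart, kernelVariation, hH] at hn ⊢
  rw [inner_normalTrace _ _ hn]
  simp only [areaDensity]
  ring

variable [CompactSpace S] [MeasurableSpace S] [BorelSpace S]

theorem integral_eq_sum_charts {G : S → Euc N} (hG : ContMDiff (𝓡 2) 𝓘(ℝ, Euc N) ∞ G)
    {T : Finset S} {χ : S → S → ℝ} (hχ : ∀ p, Continuous (χ p))
    (hs : ∀ p, tsupport (χ p) ⊆ (chartAt (Euc 2) p).source) (hsum : ∀ x, ∑ p ∈ T, χ p x = 1)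
    {h : S → ℝ} (hh : Continuous h) :
    ∫ x, h x ∂areaMeasure 2 G = ∑ p ∈ T, ∫ y in (extChartAt (𝓡 2) p).target,
      extendInChart 2 p (χ p) y * (inChart p h y * areaDensity G p y) := by
  have h1 : ∀ x, h x = ∑ p ∈ T, χ p x * h x := fun x => by rw [← Finset.sum_mul, hsum, one_mul]
  have h2 : ∀ p ∈ T, Integrable (fun x => χ p x * h x) (areaMeasure 2 G) := fun p _ =>
    integrable_areaMeasure hG ((hχ p).mul hh)
  rw [integral_congr_ae (Filter.Eventually.of_forall h1), integral_finsetSum _ h2]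
  refine Finset.sum_congr rfl fun p _ => ?_
  refine (integral_areaMeasure_of_support hG p ((hχ p).mul hh) fun x hx => by
    rw [Pi.mul_apply, image_eq_zero_of_notMem_tsupport fun h => hx (hs p h), zero_mul]).trans ?_
  refine setIntegral_congr_fun (isOpen_extChartAt_target (I := 𝓡 2) p).measurableSet
    fun y hy => ?_
  simp only [extendInChart, indicator_of_mem hy, inChart, Pi.mul_apply]
  ring

variable [T2Space S]

/-- The partition of unity lives on the fixed surface and does not depend on time, so each summand
is an integral over a fixed planar domain and can be differentiated under the sign. -/
theorem hasDerivWithinAt_integral_kernel (ht₀ : 0 < t₀)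
    (hG : ContMDiffOn (𝓘(ℝ, ℝ).prod (𝓡 2)) 𝓘(ℝ, Euc N) ∞ (fun p : ℝ × S => G p.1 p.2)
      (Ico 0 t₀ ×ˢ univ)) (hinj : ∀ t ∈ Ico 0 t₀, ∀ x, Function.Injective (eucDiff 2 (G t) x))
    {t : ℝ} (ht : t ∈ Ico 0 t₀)
    (hV : ∀ x v, ⟪derivWithin (fun τ => G τ x) (Ico 0 t₀) t, eucDiff 2 (G t) x v⟫_ℝ = 0) :
    HasDerivWithinAt
      (fun τ => ∫ x, backwardHeatKernel 2 y₀ t₀ (G τ x) τ ∂areaMeasure 2 (G τ))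
      (∫ x, kernelVariation y₀ t₀ t (G t) (fun x => derivWithin (fun τ => G τ x) (Ico 0 t₀) t) x
        ∂areaMeasure 2 (G t)) (Ico 0 t₀) t := by
  obtain ⟨T, χ, hχ, hs, hsum⟩ := exists_finite_partition 2 S
  have hGs := fun τ (hτ : τ ∈ Ico 0 t₀) => contMDiff_slice hG hτ
  have hI : ∀ τ ∈ Ico 0 t₀, ∫ x, backwardHeatKernel 2 y₀ t₀ (G τ x) τ ∂areaMeasure 2 (G τ) =
      ∑ p ∈ T, ∫ y in (extChartAt (𝓡 2) p).target, extendInChart 2 p (χ p) y *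
        (inChart p (fun x => backwardHeatKernel 2 y₀ t₀ (G τ x) τ) y * areaDensity (G τ) p y) :=
    fun τ hτ => integral_eq_sum_charts (hGs τ hτ) (fun p => (hχ p).continuous) hs hsum
      (contMDiff_backwardHeatKernel (hGs τ hτ) hτ.2).continuous
  refine HasDerivWithinAt.congr ?_ hI (hI t ht)
  rw [integral_eq_sum_charts (hGs t ht) (fun p => (hχ p).continuous) hs hsum
    (continuous_kernelVariation (hGs t ht) (hinj t ht) (continuous_timeDeriv hG ht) ht.2)]
  refine HasDerivWithinAt.fun_sum fun p _ => ?_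
  have hU := isOpen_extChartAt_target (I := 𝓡 2) p
  have hu : ContDiffOn ℝ ∞ (fun q : ℝ × Euc 2 =>
      inChart p (fun x => backwardHeatKernel 2 y₀ t₀ (G q.1 x) q.1) q.2 *
        areaDensity (G q.1) p q.2) (Ico 0 t₀ ×ˢ (extChartAt (𝓡 2) p).target) :=
    (contDiffOn_backwardHeatKernel contDiff_fst.contDiffOn (contDiffOn_time_inChart hG p)
      fun q hq => hq.1.2).mul (contDiffOn_areaDensity_time hG hinj p)
  refine (hasDerivWithinAt_integral_mul (u := fun τ y =>
    inChart p (fun x => backwardHeatKernel 2 y₀ t₀ (G τ x) τ) y * areaDensity (G τ) p y) hU hu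
      (contDiff_extendInChart (hχ p) (hs p)).continuous (extendInChart_support (hs p)).1
        (extendInChart_support (hs p)).2 ht).congr_deriv ?_
  refine setIntegral_congr_fun hU.measurableSet fun y hy => ?_
  exact congrArg (fun c => extendInChart 2 p (χ p) y * c)
    ((hasDerivWithinAt_kernel_mul_area ht₀ hG hinj ht hV p hy).derivWithin
      (uniqueDiffOn_Ico 0 t₀ t ht))

/-- The monotonicity formula for normal variations. -/
theorem hasDerivWithinAt_integral_kernel_square (ht₀ : 0 < t₀)
    (hG : ContMDiffOn (𝓘(ℝ, ℝ).prod (𝓡 2)) 𝓘(ℝ, Euc N) ∞ (fun p : ℝ × S => G p.1 p.2)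
      (Ico 0 t₀ ×ˢ univ)) (hinj : ∀ t ∈ Ico 0 t₀, ∀ x, Function.Injective (eucDiff 2 (G t) x))
    {t : ℝ} (ht : t ∈ Ico 0 t₀)
    (hV : ∀ x v, ⟪derivWithin (fun τ => G τ x) (Ico 0 t₀) t, eucDiff 2 (G t) x v⟫_ℝ = 0) :
    HasDerivWithinAt
      (fun τ => ∫ x, backwardHeatKernel 2 y₀ t₀ (G τ x) τ ∂areaMeasure 2 (G τ))
      (∫ x, -(backwardHeatKernel 2 y₀ t₀ (G t x) t *
        ⟪derivWithin (fun τ => G τ x) (Ico 0 t₀) t +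
            (1 / (2 * (t₀ - t))) • normalPart 2 (G t) x (G t x - y₀),
          eucMeanCurvature 2 (G t) x +
            (1 / (2 * (t₀ - t))) • normalPart 2 (G t) x (G t x - y₀)⟫_ℝ)
        ∂areaMeasure 2 (G t)) (Ico 0 t₀) t := by
  have hGt := contMDiff_slice hG ht
  refine (hasDerivWithinAt_integral_kernel (y₀ := y₀) ht₀ hG hinj ht hV).congr_deriv ?_
  set V : S → Euc N := fun x => derivWithin (fun τ => G τ x) (Ico 0 t₀) t with hVdef
  have hρ := contMDiff_backwardHeatKernel (y₀ := y₀) hGt ht.2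
  have hdiv := integral_weightedDivergence (y₀ := y₀) hGt (hinj t ht) hρ
  -- Subtracts 1/(2(t₀ - t)) times an integral that is zero by the divergence theorem; this multiple
  -- makes the integrand factor.
  have hsub : ∫ x, kernelVariation y₀ t₀ t (G t) V x ∂areaMeasure 2 (G t) =
      ∫ x, kernelVariation y₀ t₀ t (G t) V x ∂areaMeasure 2 (G t) - 1 / (2 * (t₀ - t)) *
        ∫ x, weightedDivergence (G t) y₀ (fun x => backwardHeatKernel 2 y₀ t₀ (G t x) t) x
          ∂areaMeasure 2 (G t) := by
    rw [hdiv, mul_zero, sub_zero]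
  rw [hsub, ← integral_const_mul, ← integral_sub
      (integrable_areaMeasure hGt (continuous_kernelVariation hGt (hinj t ht)
        (continuous_timeDeriv hG ht) ht.2))
      ((integrable_areaMeasure hGt
        (continuous_weightedDivergence hGt (hinj t ht) hρ)).const_mul _)]
  refine integral_congr_ae (Filter.Eventually.of_forall fun x => ?_)
  have h0 : t₀ - t ≠ 0 := (sub_pos.2 ht.2).ne'
  have htan : ∀ Z, (∀ v, ⟪Z, eucDiff 2 (G t) x v⟫_ℝ = 0) →
      ⟪tanProj (eucDiff 2 (G t) x) (G t x - y₀), Z⟫_ℝ = 0 := fun Z hZ =>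
    inner_tanProj_of_normal (fun v => by rw [real_inner_comm, hZ]) _
  have hnP : ∀ v, ⟪G t x - y₀ - tanProj (eucDiff 2 (G t) x) (G t x - y₀),
      eucDiff 2 (G t) x v⟫_ℝ = 0 := fun v => by
    rw [inner_sub_left, inner_tanProj (hinj t ht x), sub_self]
  simp only [kernelVariation, weightedDivergence_backwardHeatKernel hGt ht.2,
    normalPart_eq (hinj t ht x)]
  exact inner_add_smul_normal h0 _ (htan _ (hV x)) (htan _ hnP)

end FirstVariation

/-! ### The monotonicity inequality and Gronwall's bound -/

section Monotonicity

theorem meanCurvature_sub_extrinsicE_eq {d N k : ℕ} {M : Type*} [TopologicalSpace M]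
    [ChartedSpace (Euc d) M] [IsManifold (𝓡 d) ∞ M] {g : SmoothMetric d M} {ι : M → Euc N}
    {S : Type*} [TopologicalSpace S] [ChartedSpace (Euc k) S] [IsManifold (𝓡 k) ∞ S] {F : S → M}
    (hι : IsIsometricEmbedding g ι) (hF : ContMDiff (𝓡 k) (𝓡 d) ∞ F) {x : S}
    (hinj : Function.Injective (eucDiff k (fun x => ι (F x)) x)) :
    diffMap d ι (F x) (meanCurvature k g F x) - extrinsicE k g ι F x =
      eucMeanCurvature k (fun x => ι (F x)) x := by
  refine eq_of_normal (L := eucDiff k (fun x => ι (F x)) x) (fun v => ?_)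
    (inner_normalTrace_tangent hinj _) fun Z hZ => ?_
  · rw [inner_sub_left, inner_meanCurvature_tangent hι hF hinj, ← diffMap_mfderiv hι hF,
      inner_extrinsicE hι, sub_zero]
  · rw [inner_meanCurvature_sub_extrinsicE hι hF hZ, eucMeanCurvature, inner_normalTrace _ _ hZ]

theorem continuous_normalPart {k N : ℕ} {S : Type*} [TopologicalSpace S] [ChartedSpace (Euc k) S]
    [IsManifold (𝓡 k) ∞ S] {G : S → Euc N} (hG : ContMDiff (𝓡 k) 𝓘(ℝ, Euc N) ∞ G)
    (hinj : ∀ x, Function.Injective (eucDiff k G x)) {w : S → Euc N} (hw : Continuous w) :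
    Continuous fun x => normalPart k G x (w x) :=
  (hw.sub (continuous_tanProj hG hinj hw)).congr fun x => (normalPart_eq (hinj x) (w x)).symm

/-- As E ⊥ Z, the left side is -|W|² - ⟪W, E + Z⟫, and 0 ≤ |W + E + Z|² bounds this by -|W|²/2 +
(|E|² + |Z|²)/2. In the application Z = 2αT, whence the hypothesis with 2A. -/
theorem neg_inner_add_add_le {V : Type*} [NormedAddCommGroup V] [InnerProductSpace ℝ V]
    {W E Z : V} {A B : ℝ} (hEZ : ⟪E, Z⟫_ℝ = 0) (hE : ‖E‖ ≤ B) (hZ : ‖Z‖ ≤ 2 * A) :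
    -⟪W + E, W + Z⟫_ℝ ≤ 2 * A ^ 2 + B ^ 2 / 2 - 1 / 2 * ‖W‖ ^ 2 := by
  have h1 : 0 ≤ ‖W + (E + Z)‖ ^ 2 := by positivity
  rw [norm_add_sq_real, norm_add_sq_real E Z, inner_add_right, hEZ] at h1
  rw [inner_add_left, inner_add_right, inner_add_right, real_inner_self_eq_norm_sq, hEZ,
    real_inner_comm W E]
  have h2 : ‖E‖ ^ 2 ≤ B ^ 2 := by gcongr
  have h3 : ‖Z‖ ^ 2 ≤ (2 * A) ^ 2 := by gcongr
  linarith

/-- Under the differential inequality, e^{-cτ}I(τ) is nonincreasing on [0, t]. -/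
theorem le_mul_exp_of_hasDerivWithinAt_le {I I' : ℝ → ℝ} {c t t₀ : ℝ} (ht : t ∈ Ico 0 t₀)
    (hI : ∀ τ ∈ Icc 0 t, HasDerivWithinAt I (I' τ) (Ico 0 t₀) τ)
    (hle : ∀ τ ∈ Icc 0 t, I' τ ≤ c * I τ) : I t ≤ I 0 * Real.exp (c * t) := by
  have hsub : Icc 0 t ⊆ Ico 0 t₀ := fun τ hτ => ⟨hτ.1, hτ.2.trans_lt ht.2⟩
  have hd : ∀ τ ∈ Icc 0 t, HasDerivWithinAt (fun τ => Real.exp (-c * τ) * I τ)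
      (Real.exp (-c * τ) * (I' τ - c * I τ)) (Icc 0 t) τ := by
    intro τ hτ
    have h1 : HasDerivWithinAt (fun τ => Real.exp (-c * τ)) (Real.exp (-c * τ) * (-c * 1))
        (Icc 0 t) τ := ((hasDerivWithinAt_id τ _).const_mul (-c)).exp
    exact (h1.mul ((hI τ hτ).mono hsub)).congr_deriv (by ring)
  have hanti : AntitoneOn (fun τ => Real.exp (-c * τ) * I τ) (Icc 0 t) :=
    antitoneOn_of_hasDerivWithinAt_nonpos (convex_Icc 0 t)
      (fun τ hτ => (hd τ hτ).continuousWithinAt)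
      (fun τ hτ => (hd τ (interior_subset hτ)).mono interior_subset)
      fun τ hτ => mul_nonpos_of_nonneg_of_nonpos (Real.exp_pos _).le
        (sub_nonpos.2 (hle τ (interior_subset hτ)))
  have h := hanti (left_mem_Icc.2 ht.1) (right_mem_Icc.2 ht.1) ht.1
  simp only [mul_zero, Real.exp_zero, one_mul] at h
  calc I t = Real.exp (-c * t) * I t * Real.exp (c * t) := by
        rw [mul_right_comm, ← Real.exp_add]
        simp
    _ ≤ _ := by gcongr

variable {N : ℕ} {M : Type*} [TopologicalSpace M] [ChartedSpace (Euc 5) M]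
  [IsManifold (𝓡 5) ∞ M] {s : SasakianStructure 5 M} {ι : M → Euc N}
  {S : Type*} [TopologicalSpace S] [ChartedSpace (Euc 2) S] [IsManifold (𝓡 2) ∞ S]
  {t₀ : ℝ} {F : ℝ → S → M} {α : ℝ → S → ℝ}

theorem monotonicityVector_add_smul_reebVec (hflow : IsLegendrianMCF s t₀ F α)
    (hι : IsIsometricEmbedding s.g ι) (y₀ : Euc N) {t : ℝ} (ht : t ∈ Ico 0 t₀) (x : S) :
    eucMeanCurvature 2 (fun x => ι (F t x)) x +
        (1 / (2 * (t₀ - t))) • normalPart 2 (fun x => ι (F t x)) x (ι (F t x) - y₀) =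
      monotonicityVector 2 s ι y₀ t₀ t (F t) (α t) x + (2 * α t x) • reebVec s ι (F t x) := by
  rw [← meanCurvature_sub_extrinsicE_eq hι (contMDiff_slice hflow.smooth_F ht)
    (eucDiff_injective_of_flow hflow hι ht x), monotonicityVector, reebVec]
  abel

theorem continuous_monotonicityVector (hflow : IsLegendrianMCF s t₀ F α)
    (hι : IsIsometricEmbedding s.g ι) (y₀ : Euc N) {t : ℝ} (ht : t ∈ Ico 0 t₀) :
    Continuous (monotonicityVector 2 s ι y₀ t₀ t (F t) (α t)) := by
  have hF := contMDiff_slice hflow.smooth_F ht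
  have hG := contMDiff_comp_embedding hι hF
  have hinj := eucDiff_injective_of_flow hflow hι ht
  have hX : Continuous fun x => ι (F t x) - y₀ := hG.continuous.sub continuous_const
  have h : monotonicityVector 2 s ι y₀ t₀ t (F t) (α t) = fun x =>
      eucMeanCurvature 2 (fun x => ι (F t x)) x +
        (1 / (2 * (t₀ - t))) • normalPart 2 (fun x => ι (F t x)) x (ι (F t x) - y₀) -
          (2 * α t x) • reebVec s ι (F t x) := by
    funext x
    rw [monotonicityVector_add_smul_reebVec hflow hι y₀ ht,
      add_sub_cancel_right]
  rw [h]
  exact ((continuous_eucMeanCurvature hG hinj).add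
    ((continuous_normalPart hG hinj hX).const_smul (1 / (2 * (t₀ - t))))).sub
      ((continuous_const.mul (contMDiff_slice hflow.smooth_α ht).continuous).smul
        ((contMDiff_reebVec hι).continuous.comp hF.continuous))

/-- The factors are W + E and W + 2αT, where W is the monotonicity vector; T has unit length and is
tangent to M, E is normal to M. -/
theorem neg_inner_flow_le (hflow : IsLegendrianMCF s t₀ F α) (hι : IsIsometricEmbedding s.g ι)
    (y₀ : Euc N) {t : ℝ} (ht : t ∈ Ico 0 t₀) {A B : ℝ} {x : S} (hA : |α t x| ≤ A)
    (hB : ‖extrinsicE 2 s.g ι (F t) x‖ ≤ B) :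
    -⟪derivWithin (fun τ => ι (F τ x)) (Ico 0 t₀) t +
          (1 / (2 * (t₀ - t))) • normalPart 2 (fun x => ι (F t x)) x (ι (F t x) - y₀),
        eucMeanCurvature 2 (fun x => ι (F t x)) x +
          (1 / (2 * (t₀ - t))) • normalPart 2 (fun x => ι (F t x)) x (ι (F t x) - y₀)⟫_ℝ ≤
      2 * A ^ 2 + B ^ 2 / 2 -
        1 / 2 * ‖monotonicityVector 2 s ι y₀ t₀ t (F t) (α t) x‖ ^ 2 := by
  have hV : derivWithin (fun τ => ι (F τ x)) (Ico 0 t₀) t +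
      (1 / (2 * (t₀ - t))) • normalPart 2 (fun x => ι (F t x)) x (ι (F t x) - y₀) =
      monotonicityVector 2 s ι y₀ t₀ t (F t) (α t) x + extrinsicE 2 s.g ι (F t) x := by
    rw [derivWithin_embedding_flow hflow hι ht, flowVelocity, monotonicityVector, reebVec]
    abel
  rw [hV, monotonicityVector_add_smul_reebVec hflow hι y₀ ht]
  refine neg_inner_add_add_le ?_ hB ?_
  · rw [real_inner_smul_right]
    exact mul_eq_zero_of_right _ (inner_extrinsicE hι x _)
  · have h1 : ‖reebVec s ι (F t x)‖ = 1 := by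
      rw [norm_eq_sqrt_real_inner, inner_reebVec_self hι, Real.sqrt_one]
    rw [norm_smul, h1, mul_one, Real.norm_eq_abs, abs_mul, abs_two]
    gcongr

variable [CompactSpace S] [MeasurableSpace S] [BorelSpace S]

theorem integral_kernel_zero_le (hflow : IsLegendrianMCF s t₀ F α)
    (hι : IsIsometricEmbedding s.g ι) (ht₀ : 0 < t₀) (y₀ : Euc N) {Λ : ℝ}
    (hΛ : inducedMeasure 2 s.g (F 0) univ ≤ ENNReal.ofReal Λ) :
    ∫ x, backwardHeatKernel 2 y₀ t₀ (ι (F 0 x)) 0 ∂inducedMeasure 2 s.g (F 0) ≤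
      max Λ 0 / (4 * Real.pi * t₀) := by
  have h0 : (0 : ℝ) ∈ Ico 0 t₀ := ⟨le_rfl, ht₀⟩
  have hF := contMDiff_slice hflow.smooth_F h0
  have hG := contMDiff_comp_embedding hι hF
  -- `ENNReal.ofReal` truncates a negative Λ to 0, hence `max Λ 0`.
  have hm : (inducedMeasure 2 s.g (F 0)).real univ ≤ max Λ 0 := by
    rw [← ENNReal.toReal_ofReal']
    exact ENNReal.toReal_mono ENNReal.ofReal_ne_top hΛ
  rw [inducedMeasure_eq hι hF] at hm ⊢
  calc ∫ x, backwardHeatKernel 2 y₀ t₀ (ι (F 0 x)) 0 ∂(areaMeasure 2 fun x => ι (F 0 x))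
      ≤ ∫ _, 1 / (4 * Real.pi * (t₀ - 0)) ∂(areaMeasure 2 fun x => ι (F 0 x)) :=
        integral_mono (integrable_areaMeasure hG
          (contMDiff_backwardHeatKernel hG ht₀).continuous)
          (integrable_areaMeasure hG continuous_const) fun x => backwardHeatKernel_le _ ht₀
    _ = (areaMeasure 2 fun x => ι (F 0 x)).real univ / (4 * Real.pi * t₀) := by
        rw [integral_const, smul_eq_mul, sub_zero, mul_one_div]
    _ ≤ _ := by gcongr

variable [T2Space S]

/-- The weighted monotonicity inequality along a Legendrian mean curvature flow. -/
theorem exists_hasDerivWithinAt_le (hflow : IsLegendrianMCF s t₀ F α)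
    (hι : IsIsometricEmbedding s.g ι) (ht₀ : 0 < t₀) (y₀ : Euc N) {t : ℝ} (ht : t ∈ Ico 0 t₀)
    {A B : ℝ} (hA : ∀ x, |α t x| ≤ A) (hB : ∀ x, ‖extrinsicE 2 s.g ι (F t) x‖ ≤ B) :
    ∃ D : ℝ,
      HasDerivWithinAt
        (fun τ => ∫ x, backwardHeatKernel 2 y₀ t₀ (ι (F τ x)) τ ∂inducedMeasure 2 s.g (F τ))
        D (Ico 0 t₀) t ∧
      D ≤ (2 * A ^ 2 + B ^ 2 / 2) *
          ∫ x, backwardHeatKernel 2 y₀ t₀ (ι (F t x)) t ∂inducedMeasure 2 s.g (F t) -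
        1 / 2 * ∫ x, ‖monotonicityVector 2 s ι y₀ t₀ t (F t) (α t) x‖ ^ 2 *
          backwardHeatKernel 2 y₀ t₀ (ι (F t x)) t ∂inducedMeasure 2 s.g (F t) := by
  have hF := contMDiff_slice hflow.smooth_F ht
  have hG := contMDiff_comp_embedding hι hF
  have hinj := eucDiff_injective_of_flow hflow hι ht
  have hGt := contMDiffOn_comp_flow hflow hι.smooth
  have hμ : ∀ τ ∈ Ico 0 t₀, inducedMeasure 2 s.g (F τ) = areaMeasure 2 fun x => ι (F τ x) :=
    fun τ hτ => inducedMeasure_eq hι (contMDiff_slice hflow.smooth_F hτ)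
  have hderiv := hasDerivWithinAt_integral_kernel_square (y₀ := y₀) ht₀
    (G := fun τ x => ι (F τ x)) hGt
    (fun τ hτ => eucDiff_injective_of_flow hflow hι hτ) ht fun x v => by
      rw [derivWithin_embedding_flow hflow hι ht]
      exact inner_flowVelocity_tangent hflow hι ht₀ ht x v
  refine ⟨_, hderiv.congr (fun τ hτ => by rw [hμ τ hτ]) (by rw [hμ t ht]), ?_⟩
  have hρ := (contMDiff_backwardHeatKernel (y₀ := y₀) hG ht.2).continuous
  have hW := continuous_monotonicityVector hflow hι y₀ ht
  have hX : Continuous fun x => ι (F t x) - y₀ := hG.continuous.sub continuous_const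
  have hP : Continuous fun x => (1 / (2 * (t₀ - t))) •
      normalPart 2 (fun x => ι (F t x)) x (ι (F t x) - y₀) :=
    (continuous_normalPart hG hinj hX).const_smul (1 / (2 * (t₀ - t)))
  have hV : Continuous fun x => derivWithin (fun τ => ι (F τ x)) (Ico 0 t₀) t :=
    continuous_timeDeriv (G := fun τ x => ι (F τ x)) hGt ht
  have hH := continuous_eucMeanCurvature hG hinj
  have i1 : Integrable (fun x => (2 * A ^ 2 + B ^ 2 / 2) *
      backwardHeatKernel 2 y₀ t₀ (ι (F t x)) t) (areaMeasure 2 fun x => ι (F t x)) :=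
    (integrable_areaMeasure hG hρ).const_mul _
  have i2 : Integrable (fun x => 1 / 2 * (‖monotonicityVector 2 s ι y₀ t₀ t (F t) (α t) x‖ ^ 2 *
      backwardHeatKernel 2 y₀ t₀ (ι (F t x)) t)) (areaMeasure 2 fun x => ι (F t x)) :=
    (integrable_areaMeasure hG ((hW.norm.pow 2).mul hρ)).const_mul _
  rw [hμ t ht, ← integral_const_mul, ← integral_const_mul, ← integral_sub i1 i2]
  refine integral_mono
    (integrable_areaMeasure hG (hρ.mul ((hV.add hP).inner (hH.add hP))).neg) (i1.sub i2)
    fun x => ?_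
  have h := mul_le_mul_of_nonneg_left (neg_inner_flow_le hflow hι y₀ ht (hA x) (hB x))
    (backwardHeatKernel_nonneg (y₀ := y₀) (ι (F t x)) ht.2)
  simp only at h ⊢
  linarith

end Monotonicity

end

theorem mainTheorem9 (A B Λ t₀ : ℝ) (ht₀ : 0 < t₀) :
    ∃ C : ℝ, 0 < C ∧
      ∀ (M : Type u) [TopologicalSpace M] [ChartedSpace (Euc 5) M] [IsManifold (𝓡 5) ∞ M]
        (s : SasakianStructure 5 M)
        (m : ℕ) (ι : M → Euc (5 + m)) (_ : IsIsometricEmbedding s.g ι)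
        (S : Type v) [TopologicalSpace S] [CompactSpace S] [T2Space S] [ChartedSpace (Euc 2) S]
        [IsManifold (𝓡 2) ∞ S] [MeasurableSpace S] [BorelSpace S]
        (F : ℝ → S → M) (α : ℝ → S → ℝ) (_ : IsLegendrianMCF s t₀ F α)
        (_ : inducedMeasure 2 s.g (F 0) univ ≤ ENNReal.ofReal Λ)
        (y₀ : Euc (5 + m)) (t : ℝ) (_ : t ∈ Ico 0 t₀)
        (_ : ∀ τ ∈ Icc 0 t, ∀ x, |α τ x| ≤ A)
        (_ : ∀ τ ∈ Icc 0 t, ∀ x, ‖extrinsicE 2 s.g ι (F τ) x‖ ≤ B),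
        ∃ D : ℝ,
          HasDerivWithinAt
            (fun τ => ∫ x, backwardHeatKernel 2 y₀ t₀ (ι (F τ x)) τ ∂inducedMeasure 2 s.g (F τ))
            D (Ico 0 t₀) t ∧
          D ≤ C - 1 / 2 * ∫ x, ‖monotonicityVector 2 s ι y₀ t₀ t (F t) (α t) x‖ ^ 2 *
            backwardHeatKernel 2 y₀ t₀ (ι (F t x)) t ∂inducedMeasure 2 s.g (F t) := by
  have hc : 0 ≤ 2 * A ^ 2 + B ^ 2 / 2 := by positivity
  have hC : 0 ≤ (2 * A ^ 2 + B ^ 2 / 2) *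
      (max Λ 0 / (4 * Real.pi * t₀) * Real.exp ((2 * A ^ 2 + B ^ 2 / 2) * t₀)) := by positivity
  -- The factor c bounds the integrand and the rest bounds ∫ρ up to time t₀. The summand 1 gives
  -- strict positivity, since the product vanishes when A = B = 0 or Λ ≤ 0.
  refine ⟨(2 * A ^ 2 + B ^ 2 / 2) *
      (max Λ 0 / (4 * Real.pi * t₀) * Real.exp ((2 * A ^ 2 + B ^ 2 / 2) * t₀)) + 1,
    by linarith, ?_⟩
  intro M _ _ _ s m ι hι S _ _ _ _ _ _ _ F α hflow hΛ y₀ t ht hA hB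
  have hsub : ∀ τ ∈ Icc 0 t, τ ∈ Ico 0 t₀ := fun τ hτ => ⟨hτ.1, hτ.2.trans_lt ht.2⟩
  -- The inequality is needed at all times in [0, t], not only at t, because the bound for ∫ρ at
  -- time t comes from integrating it.
  choose! I' hI hle using fun τ (hτ : τ ∈ Icc 0 t) =>
    exists_hasDerivWithinAt_le hflow hι ht₀ y₀ (hsub τ hτ) (hA τ hτ) (hB τ hτ)
  refine ⟨I' t, hI t (right_mem_Icc.2 ht.1), (hle t (right_mem_Icc.2 ht.1)).trans ?_⟩
  -- For growth the nonnegative square term is thrown away; it is kept in the estimate at the final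
  -- time.
  have hgrow := le_mul_exp_of_hasDerivWithinAt_le ht hI fun τ hτ =>
    (hle τ hτ).trans (sub_le_self _ (mul_nonneg (by norm_num) (integral_nonneg fun x =>
      mul_nonneg (sq_nonneg _) (backwardHeatKernel_nonneg _ (hsub τ hτ).2))))
  have h0 := integral_kernel_zero_le hflow hι ht₀ y₀ hΛ
  have hbound : ∫ x, backwardHeatKernel 2 y₀ t₀ (ι (F t x)) t ∂inducedMeasure 2 s.g (F t) ≤
      max Λ 0 / (4 * Real.pi * t₀) * Real.exp ((2 * A ^ 2 + B ^ 2 / 2) * t₀) := by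
    refine hgrow.trans (mul_le_mul h0 ?_ (Real.exp_pos _).le (by positivity))
    exact Real.exp_le_exp.2 (mul_le_mul_of_nonneg_left ht.2.le hc)
  have := mul_le_mul_of_nonneg_left hbound hc
  linarith
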